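/- Consider a content delivery network with finite sets $\mathcal I$ of demand points, $\mathcal J$ of edge servers, $\mathcal K$ of origin servers, and $\Theta$ of request types, satisfying the following assumptions. (A1) The allocation is deterministic: each demand point $i$ is assigned to exactly one edge server and each edge server to exactly one origin server. Let $\mathcal I_j$ be the set of demand points assigned to $j\in\mathcal J$. (A2) Demand point $i\in\mathcal I$ generates requests according to a Poisson process of rate $\xi_i>0$. (A3) Each request of demand point $i$ is of type $\vartheta\in\Theta$ with probability $p_i^\vartheta\in[0,1]$, where $\sum_{\vartheta\in\Theta}p_i^\vartheta=1$. (A4) At each edge server $j$, the successive service times of the requests of type $\vartheta$ are exponentially distributed with rate $\mu_j^\vartheta>0$. All request processes, request types and service times are mutually independent. The service regime is disaggregated: at each edge server, the requests of each type $\vartheta\in\Theta$ are served, in order of arrival, by a separate single-server queue with unlimited waiting room, which is empty at time $0$. For $j\in\mathcal J$ put $$\Lambda_j=\sum_{i\in\mathcal I_j}\xi_i,\qquad \Lambda_j^\vartheta=\sum_{i\in\mathcal I_j}\xi_i\,p_i^\vartheta\quad(\vartheta\in\Theta).$$ **Theorem.** Let $j\in\mathcal J$ be an edge server such that $\Lambda_j^\vartheta<\mu_j^\vartheta$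 for every $\vartheta\in\Theta$. Then the service system at $j$ decomposes into $|\Theta|$ independent $\mathrm M/\mathrm M/1$ queues: for each $\vartheta$, the queue for type $\vartheta$ has Poisson arrivals of rate $\Lambda_j^\vartheta$ (no arrivals if $\Lambda_j^\vartheta=0$) and i.i.d. exponential service times of rate $\mu_j^\vartheta$ independent of its arrivals, and the pairs (arrival process, service times) belonging to different types are independent. If moreover $\mathcal I_j\neq\emptyset$, then the sojourn time (waiting plus service) of the $n$-th request arriving at $j$ converges in distribution as $n\to\infty$, and its limit $T_j$, the steady-state sojourn time at $j$, is hyperexponential: its law is the mixture, with weights $\Lambda_j^\vartheta/\Lambda_j$, of the exponential distributions with rates $\mu_j^\vartheta-\Lambda_j^\vartheta$, $\vartheta\in\Theta$. In particular, $T_j$ is integrable and $$\mathbb E[T_j]=\sum_{\vartheta\in\Theta}\frac{\Lambda_j^\vartheta}{\Lambda_j\,(\mu_j^\vartheta-\Lambda_j^\vartheta)}.$$ -/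

import Mathlib

open MeasureTheory ProbabilityTheory Filter Topology
open scoped NNReal ENNReal

noncomputable section

namespace CDN

/-- `N` is (the counting process of) a homogeneous Poisson process of rate `r ≥ 0` on `[0, ∞)`:
almost all paths start at `0`, are nondecreasing and right-continuous, increments over disjoint
intervals are independent, and `N t - N s` is Poisson with mean `r (t - s)`.
(`r = 0` gives the process without points. The natural-number subtraction is harmless,
since the paths are nondecreasing.) -/
structure IsPoissonProcess {Ω : Type*} [MeasurableSpace Ω] (N : ℝ≥0 → Ω → ℕ) (r : ℝ)
    (P : Measure Ω) : Prop where
  rate_nonneg : 0 ≤ r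
  measurable : ∀ t, Measurable (N t)
  start : ∀ᵐ ω ∂P, N 0 ω = 0
  mono : ∀ᵐ ω ∂P, Monotone fun t => N t ω
  rightCont : ∀ᵐ ω ∂P, ∀ t, ContinuousWithinAt (fun s => N s ω) (Set.Ici t) t
  indep : HasIndepIncrements N P
  law : ∀ s t, s ≤ t →
    HasLaw (fun ω => N t ω - N s ω) (poissonMeasure (r.toNNReal * (t - s))) P

/-- Epoch of the point number `n` (numbered from `0`) of a counting process: the first time at
which the count exceeds `n`. -/
def epoch {Ω : Type*} (N : ℝ≥0 → Ω → ℕ) (n : ℕ) (ω : Ω) : ℝ≥0 :=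
  sInf {t | n < N t ω}

/-- A single-server queue with unlimited waiting room, given by the counting process of its
arrivals and by the service times of its customers in order of arrival. -/
structure Queue (Ω : Type*) where
  arrivals : ℝ≥0 → Ω → ℕ
  service : ℕ → Ω → ℝ

namespace Queue

variable {Ω : Type*}

/-- Departure epochs under first-come-first-served service by one server, starting empty: the
service of a customer starts at its arrival or at the departure of its predecessor, whichever
comes later. -/
def departure (Q : Queue Ω) : ℕ → Ω → ℝ
  | 0, ω => epoch Q.arrivals 0 ω + Q.service 0 ω
  | m + 1, ω => max (epoch Q.arrivals (m + 1) ω : ℝ) (Q.departure m ω) + Q.service (m + 1) ω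

/-- Sojourn time (waiting plus service) of customer number `m`. -/
def sojourn (Q : Queue Ω) (m : ℕ) (ω : Ω) : ℝ :=
  Q.departure m ω - epoch Q.arrivals m ω

/-- The randomness driving the queue: its arrival process and its service times. -/
def input (Q : Queue Ω) (ω : Ω) : (ℝ≥0 → ℕ) × (ℕ → ℝ) :=
  (fun t => Q.arrivals t ω, fun m => Q.service m ω)

/-- `M/M/1` with arrival rate `l` and service rate `m`: Poisson arrivals, i.i.d. exponential
service times, arrivals independent of service times. (The single server is part of `Queue`.) -/
structure IsMM1 [MeasurableSpace Ω] (Q : Queue Ω) (l m : ℝ) (P : Measure Ω) : Prop where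
  rate_pos : 0 < m
  arrivals_poisson : IsPoissonProcess Q.arrivals l P
  service_law : ∀ n, HasLaw (Q.service n) (expMeasure m) P
  service_indep : iIndepFun Q.service P
  arrivals_indep_service :
    IndepFun (fun ω t => Q.arrivals t ω) (fun ω n => Q.service n ω) P

end Queue

/-- Hyperexponential distribution: the mixture, with weights `w`, of the exponential
distributions of rates `r`. -/
def hyperexpMeasure {Θ : Type*} [Fintype Θ] (w r : Θ → ℝ) : Measure ℝ :=
  ∑ θ, ENNReal.ofReal (w θ) • expMeasure (r θ)

/-- The deterministic data of a content delivery network with demand points `I`, edge servers `J`,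
origin servers `K` and request types `Θ`. The allocation is a (deterministic) pair of maps. -/
structure Network (I J K Θ : Type*) [Fintype Θ] where
  /-- the edge server of a demand point -/
  edge : I → J
  /-- the origin server of an edge server -/
  origin : J → K
  /-- request rates -/
  ξ : I → ℝ
  ξ_pos : ∀ i, 0 < ξ i
  /-- type probabilities -/
  p : I → Θ → ℝ
  p_mem : ∀ i θ, p i θ ∈ Set.Icc (0 : ℝ) 1
  p_sum : ∀ i, ∑ θ, p i θ = 1
  /-- service rates -/
  μ : J → Θ → ℝ
  μ_pos : ∀ j θ, 0 < μ j θ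

namespace Network

variable {I J K Θ : Type*} [Fintype I] [Fintype Θ]

open Classical in
/-- Total request rate `Λ_j` at an edge server. -/
def rate (C : Network I J K Θ) (j : J) : ℝ :=
  ∑ i with C.edge i = j, C.ξ i

open Classical in
/-- Request rate `Λ_j^θ` of type `θ` at an edge server. -/
def typeRate (C : Network I J K Θ) (j : J) (θ : Θ) : ℝ :=
  ∑ i with C.edge i = j, C.ξ i * C.p i θ

end Network

/-- The random primitives of the network:
`req i t` is the number of requests generated at demand point `i` up to time `t`,
`type i n` is the type of request number `n` of demand point `i`,
`service j θ m` is the service time of the `m`-th request of type `θ` arriving at edge server `j`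
(all requests being numbered from `0`). -/
structure Primitives (I J Θ Ω : Type*) where
  req : I → ℝ≥0 → Ω → ℕ
  type : I → ℕ → Ω → Θ
  service : J → Θ → ℕ → Ω → ℝ

namespace Primitives

variable {I J K Θ Ω : Type*}

/-- The σ-algebras generated by the individual primitives: the request process of each demand
point, the type of each request, and each service time. -/
@[reducible] def sigma (X : Primitives I J Θ Ω) : I ⊕ (I × ℕ) ⊕ (J × Θ × ℕ) → MeasurableSpace Ω
  | .inl i => MeasurableSpace.comap (fun ω t => X.req i t ω) inferInstance
  | .inr (.inl (i, n)) => MeasurableSpace.comap (X.type i n) ⊤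
  | .inr (.inr (j, θ, m)) => MeasurableSpace.comap (X.service j θ m) inferInstance

/-- The arrival and service assumptions: Poisson requests, random classification, exponential
service times, all of these primitives being mutually independent. -/
structure Satisfies [Fintype Θ] [MeasurableSpace Ω] (X : Primitives I J Θ Ω)
    (C : Network I J K Θ) (P : Measure Ω) : Prop where
  req_poisson : ∀ i, IsPoissonProcess (X.req i) (C.ξ i) P
  type_measurable : ∀ i n θ, MeasurableSet {ω | X.type i n ω = θ}
  type_law : ∀ i n θ, P {ω | X.type i n ω = θ} = ENNReal.ofReal (C.p i θ)
  service_measurable : ∀ j θ m, Measurable (X.service j θ m)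
  service_law : ∀ j θ m, HasLaw (X.service j θ m) (expMeasure (C.μ j θ)) P
  indep : iIndep X.sigma P

variable [Fintype I]

open Classical in
/-- Number of requests arriving at edge server `j` up to time `t`. -/
def total [Fintype Θ] (X : Primitives I J Θ Ω) (C : Network I J K Θ) (j : J) (t : ℝ≥0) (ω : Ω) :
    ℕ :=
  ∑ i with C.edge i = j, X.req i t ω

open Classical in
/-- Number of requests of type `θ` arriving at edge server `j` up to time `t`. -/
def typeCount [Fintype Θ] (X : Primitives I J Θ Ω) (C : Network I J K Θ) (j : J) (θ : Θ)
    (t : ℝ≥0) (ω : Ω) : ℕ :=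
  ∑ i with C.edge i = j, ((Finset.range (X.req i t ω)).filter fun n => X.type i n ω = θ).card

/-- Disaggregated service regime: at edge server `j`, the requests of type `θ` are processed by a
single-server queue of their own. -/
def dsrQueue [Fintype Θ] (X : Primitives I J Θ Ω) (C : Network I J K Θ) (j : J) (θ : Θ) :
    Queue Ω where
  arrivals := X.typeCount C j θ
  service := X.service j θ

open Classical in
/-- Sojourn time of request number `n` (of any type) at edge server `j` in the disaggregated
regime. Let `e` be the arrival epoch of this request at `j`. The request has the type `θ` whose
count jumps at `e` (almost surely there is exactly one such type if `j` receives requests), it is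
the customer number `typeCount e - 1` of the queue for type `θ`, and its sojourn time is the one
in that queue. -/
def sojourn [Fintype Θ] (X : Primitives I J Θ Ω) (C : Network I J K Θ) (j : J) (n : ℕ) (ω : Ω) :
    ℝ :=
  let e := epoch (X.total C j) n ω
  ∑ θ, if ∀ s < e, X.typeCount C j θ s ω < X.typeCount C j θ e ω then
    (X.dsrQueue C j θ).sojourn (X.typeCount C j θ e ω - 1) ω else 0

/-- `T` is a steady-state sojourn time at edge server `j` in the disaggregated regime: the sojourn
time of the `n`-th request arriving at `j` converges to `T` in distribution as `n → ∞`. -/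
def IsSteadyStateSojourn [Fintype Θ] [MeasurableSpace Ω] (X : Primitives I J Θ Ω)
    (C : Network I J K Θ) (P : Measure Ω) [IsProbabilityMeasure P] (j : J)
    {Ω' : Type*} [MeasurableSpace Ω'] (T : Ω' → ℝ) (P' : Measure Ω') [IsProbabilityMeasure P'] :
    Prop :=
  TendstoInDistribution (fun n => X.sojourn C j n) atTop T (fun _ => P) P'

end Primitives

end CDN

end

open MeasureTheory ProbabilityTheory Filter Topology
open scoped NNReal ENNReal

noncomputable section

namespace CDN

/-! ### Exponential distributions -/

/-! Decomposition into queues. The counts of the different types are controlled through a joint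
generating function over a partition of time. For one demand point, freeze the request counts: the
types are then independent, and averaging over the Poisson counts gives `exp (ξ Δt (∑ p z - 1))` for
each cell of length `Δt`. Since the `p` sum to one, the exponent is `∑ ξ Δt p (z - 1)`, which is
additive over demand points and over types. The resulting product over cells and types
(`integral_prod_pow_typeCount_sub`), taken at unimodular `z`, is the characteristic function of
independent Poisson variables, so the increments of all types are jointly independent and Poisson
(`map_typeCount_sub_eq_pi`). Service times come in by grouping independent σ-algebras
(`iIndep_iSup_fiber`).

Sojourn times. Request number `n` at the server is not customer number `n` of a fixed queue, so each
queue is observed at the arrivals of all types. Let `L` be the total rate, `m` the service rate of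
type `θ`, `q` the probability that a request has type `θ`, and `η = m - q L`. Just after successive
arrivals the workload of type `θ` obeys `W' = max (W - A) 0 + (S if the new request has type θ)`,
where `A ~ Exp(L)`, the mark and `S ~ Exp(m)` are independent of each other and of `W`. Its
equilibrium is explicit: just before an arrival the workload is `0` with probability `η / m` and
otherwise `Exp(η)`, and a request that joins adds its service time and leaves exactly `Exp(η)`
(`atomExp_conv_expMeasure`). In the variable `exp (α W)` with `0 < α < η` one step contracts on
average (`slotWeight_lt_one`), so the chain started empty converges geometrically
(`abs_integral_iterate_sub_le`). On the event that request `n` has type `θ`, its sojourn time is the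
workload just after its arrival; summing over `θ` gives the hyperexponential mixture, and uniqueness
of weak limits transfers it to `T`.

The recursion rests on a strong Markov property at the first arrival: its time, its type and the
process after it are independent, and the latter has the original law (`IsPoissonLaw.map_jump`). It
is deduced from the Markov property at deterministic times by observing the path on a grid whose
mesh tends to `0`. -/

lemma expMeasure_eq_withDensity (r : ℝ) :
    expMeasure r = (volume.restrict (Set.Ioi (0 : ℝ))).withDensity
      fun x => ENNReal.ofReal (r * Real.exp (-(r * x))) := by
  rw [restrict_Ioi_eq_restrict_Ici, ← withDensity_indicator measurableSet_Ici]
  change volume.withDensity (exponentialPDF r) = _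
  congr 1
  ext x
  by_cases hx : 0 ≤ x
  · rw [exponentialPDF_of_nonneg hx, Set.indicator_of_mem (Set.mem_Ici.2 hx)]
  · rw [exponentialPDF_of_neg (not_le.1 hx), Set.indicator_of_notMem (by simpa using hx)]

lemma integral_expMeasure {E : Type*} [NormedAddCommGroup E] [NormedSpace ℝ E] {r : ℝ}
    (hr : 0 < r) (f : ℝ → E) :
    ∫ x, f x ∂(expMeasure r) = ∫ x in Set.Ioi 0, (r * Real.exp (-(r * x))) • f x := by
  rw [expMeasure_eq_withDensity,
    integral_withDensity_eq_integral_toReal_smul (by fun_prop) (by simp)]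
  refine integral_congr_ae (ae_of_all _ fun x => ?_)
  simp only
  rw [ENNReal.toReal_ofReal (by positivity)]

lemma integrable_expMeasure_iff {E : Type*} [NormedAddCommGroup E] [NormedSpace ℝ E] {r : ℝ}
    (hr : 0 < r) (f : ℝ → E) :
    Integrable f (expMeasure r) ↔
      IntegrableOn (fun x => (r * Real.exp (-(r * x))) • f x) (Set.Ioi 0) := by
  rw [expMeasure_eq_withDensity, IntegrableOn,
    integrable_withDensity_iff_integrable_smul' (by fun_prop) (by simp)]
  refine integrable_congr (ae_of_all _ fun x => ?_)
  simp only
  rw [ENNReal.toReal_ofReal (by positivity)]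

/-- Imaginary `z` gives the characteristic function, real `z` the exponential moments that enter the
contraction factor. -/
lemma integral_cexp_expMeasure {r : ℝ} (hr : 0 < r) {z : ℂ} (hz : z.re < r) :
    ∫ x, Complex.exp (z * x) ∂(expMeasure r) = r / (r - z) := by
  have hne : z - r ≠ 0 := by
    intro h
    have := congrArg Complex.re h
    simp at this
    linarith
  have hne' : (r : ℂ) - z ≠ 0 := by
    rw [← neg_sub]; exact neg_ne_zero.2 hne
  have key := integral_exp_mul_complex_Ioi (a := z - r) (by simpa using hz) 0
  rw [integral_expMeasure hr]
  have : ∀ x : ℝ, (r * Real.exp (-(r * x))) • Complex.exp (z * x)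
      = (r : ℂ) * Complex.exp ((z - r) * x) := by
    intro x
    rw [Complex.real_smul]
    push_cast
    rw [mul_assoc, ← Complex.exp_add]
    ring_nf
  simp_rw [this, integral_const_mul, key]
  simp
  field_simp
  ring

lemma integrable_rexp_expMeasure {r a : ℝ} (hr : 0 < r) (ha : a < r) :
    Integrable (fun x => Real.exp (a * x)) (expMeasure r) := by
  rw [integrable_expMeasure_iff hr]
  have := (integrableOn_exp_mul_Ioi (a := a - r) (by linarith) 0).const_mul r
  refine this.congr (ae_of_all _ fun x => ?_)
  simp only [smul_eq_mul]
  rw [mul_assoc, ← Real.exp_add]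
  ring_nf

lemma integral_rexp_expMeasure {r a : ℝ} (hr : 0 < r) (ha : a < r) :
    ∫ x, Real.exp (a * x) ∂(expMeasure r) = r / (r - a) := by
  have := integral_cexp_expMeasure hr (z := a) (by simpa using ha)
  have h2 : ∀ x : ℝ, Complex.exp (a * x) = ((Real.exp (a * x) : ℝ) : ℂ) := by
    intro x; push_cast; rfl
  simp_rw [h2] at this
  rw [integral_complex_ofReal] at this
  exact_mod_cast this

lemma charFun_expMeasure {r : ℝ} (hr : 0 < r) (t : ℝ) :
    charFun (expMeasure r) t = r / (r - t * Complex.I) := by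
  rw [charFun_apply_real, ← integral_cexp_expMeasure hr (z := t * Complex.I) (by simpa using hr)]
  congr 1
  ext x
  ring_nf

lemma integrable_id_expMeasure {r : ℝ} (hr : 0 < r) : Integrable (fun x => x) (expMeasure r) := by
  -- Dominating function: `x ≤ (2 / r) exp (r x / 2)`, from `t + 1 ≤ exp t` at `t = r x / 2`.
  have h := (integrable_rexp_expMeasure hr (a := r / 2) (by linarith)).const_mul (2 / r)
  refine h.mono' (by fun_prop) ?_
  have hpos : ∀ᵐ x ∂(expMeasure r), 0 < x := by
    rw [expMeasure_eq_withDensity]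
    exact (withDensity_absolutelyContinuous _ _).ae_le (ae_restrict_mem measurableSet_Ioi)
  filter_upwards [hpos] with x hx
  rw [Real.norm_of_nonneg hx.le]
  have := Real.add_one_le_exp (r / 2 * x)
  calc x = 2 / r * (r / 2 * x) := by field_simp
    _ ≤ _ := by gcongr; linarith

lemma ae_pos_expMeasure (r : ℝ) : ∀ᵐ x ∂(expMeasure r), 0 < x := by
  rw [expMeasure_eq_withDensity]
  exact (withDensity_absolutelyContinuous _ _).ae_le (ae_restrict_mem measurableSet_Ioi)

lemma integral_id_expMeasure {r : ℝ} (hr : 0 < r) : ∫ x, x ∂(expMeasure r) = 1 / r := by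
  rw [integral_expMeasure hr]
  have := Real.integral_rpow_mul_exp_neg_mul_Ioi (a := 2) (r := r) (by norm_num) hr
  simp only [smul_eq_mul, mul_assoc, integral_const_mul]
  have h2 : ∀ x ∈ Set.Ioi (0 : ℝ), x ^ ((2 : ℝ) - 1) * Real.exp (-(r * x))
      = Real.exp (-(r * x)) * x := by
    intro x _; norm_num; ring
  rw [setIntegral_congr_fun measurableSet_Ioi h2] at this
  rw [this]
  norm_num [Real.Gamma_two]
  field_simp

lemma expMeasure_Ioi {r : ℝ} (hr : 0 < r) {x : ℝ} (hx : 0 ≤ x) :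
    expMeasure r (Set.Ioi x) = ENNReal.ofReal (Real.exp (-(r * x))) := by
  have := isProbabilityMeasure_expMeasure hr
  have h := cdf_expMeasure_eq hr x
  rw [cdf_eq_real, if_pos hx] at h
  rw [← Set.compl_Iic, prob_compl_eq_one_sub measurableSet_Iic, ← ofReal_measureReal, h,
    ← ENNReal.ofReal_one, ← ENNReal.ofReal_sub _ (by
      rw [sub_nonneg, Real.exp_le_one_iff, neg_nonpos]; positivity)]
  congr 1; ring

lemma expMeasure_Ioi_of_nonpos {r : ℝ} (hr : 0 < r) {x : ℝ} (hx : x ≤ 0) :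
    expMeasure r (Set.Ioi x) = 1 := by
  have := isProbabilityMeasure_expMeasure hr
  rw [← prob_compl_eq_zero_iff measurableSet_Ioi]
  have := ae_pos_expMeasure r
  exact measure_mono_null (fun y hy => by simp at hy ⊢; linarith) (ae_iff.1 this)

/-- The mixture `w δ₀ + (1 - w) Exp(r)`. -/
def atomExp (w r : ℝ) : Measure ℝ :=
  ENNReal.ofReal w • Measure.dirac 0 + ENNReal.ofReal (1 - w) • expMeasure r

lemma isProbabilityMeasure_atomExp {w r : ℝ} (hw : 0 ≤ w) (hw1 : w ≤ 1) (hr : 0 < r) :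
    IsProbabilityMeasure (atomExp w r) := by
  have := isProbabilityMeasure_expMeasure hr
  constructor
  simp [atomExp]
  rw [← ENNReal.ofReal_add hw (by linarith)]
  simp

/-- On characteristic functions, `r/s + (1 - r/s) r/(r - it) = r (s - it) / (s (r - it))`, and the
factor `s/(s - it)` cancels. With `s` the service rate and `r` the service rate minus the arrival
rate, this says that stationary waiting time plus service time is exponential. -/
lemma atomExp_conv_expMeasure {r s : ℝ} (hr : 0 < r) (hrs : r ≤ s) :
    (atomExp (r / s) r) ∗ (expMeasure s) = expMeasure r := by
  have hs : 0 < s := hr.trans_le hrs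
  have := isProbabilityMeasure_expMeasure hr
  have := isProbabilityMeasure_expMeasure hs
  have hrs1 : r / s ≤ 1 := (div_le_one hs).2 hrs
  have hrs0 : 0 ≤ r / s := by positivity
  have := isProbabilityMeasure_atomExp hrs0 hrs1 hr
  refine Measure.ext_of_charFun (funext fun t => ?_)
  have hat : charFun (atomExp (r / s) r) t
      = (r / s : ℝ) + ((1 - r / s : ℝ) : ℂ) * (r / (r - t * Complex.I)) := by
    rw [atomExp, charFun_apply_real, integral_add_measure]
    · rw [integral_smul_measure, integral_smul_measure, ← charFun_apply_real,
        ← charFun_apply_real, charFun_expMeasure hr, charFun_dirac,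
        ENNReal.toReal_ofReal hrs0, ENNReal.toReal_ofReal (by linarith)]
      simp
    all_goals
      refine Integrable.smul_measure ?_ ENNReal.ofReal_ne_top
      refine Integrable.of_bound (by fun_prop) 1 (ae_of_all _ fun x => ?_)
      have := Complex.norm_exp_ofReal_mul_I (t * x)
      push_cast at this
      exact this.le
  have h1 : (r : ℂ) - t * Complex.I ≠ 0 := by
    intro h; have := congrArg Complex.re h; simp at this; linarith
  have h2 : (s : ℂ) - t * Complex.I ≠ 0 := by
    intro h; have := congrArg Complex.re h; simp at this; linarith
  have h3 : (s : ℂ) ≠ 0 := by exact_mod_cast hs.ne'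
  rw [charFun_conv, hat, charFun_expMeasure hs, charFun_expMeasure hr]
  push_cast
  field_simp
  ring

/-- Lack of memory: the first variable is the smaller one with probability `r / (r + s)`, and
otherwise its excess over the second is again `Exp(r)`. The two laws are compared through their
tails. -/
lemma map_sub_posPart_expMeasure {r s : ℝ} (hr : 0 < r) (hs : 0 < s) :
    ((expMeasure r).prod (expMeasure s)).map (fun q => max (q.1 - q.2) 0)
      = atomExp (r / (r + s)) r := by
  have := isProbabilityMeasure_expMeasure hr
  have := isProbabilityMeasure_expMeasure hs
  have hw0 : 0 ≤ r / (r + s) := by positivity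
  have hw1 : r / (r + s) ≤ 1 := (div_le_one (by positivity)).2 (by linarith)
  have := isProbabilityMeasure_atomExp hw0 hw1 hr
  have hm : Measurable fun q : ℝ × ℝ => max (q.1 - q.2) 0 := by fun_prop
  have := Measure.isProbabilityMeasure_map (μ := (expMeasure r).prod (expMeasure s))
    hm.aemeasurable
  have key : ∀ x, (((expMeasure r).prod (expMeasure s)).map (fun q => max (q.1 - q.2) 0))
      (Set.Ioi x) = atomExp (r / (r + s)) r (Set.Ioi x) := by
    intro x
    rw [Measure.map_apply hm measurableSet_Ioi]
    by_cases hx : x < 0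
    · have h1 : (fun q : ℝ × ℝ => max (q.1 - q.2) 0) ⁻¹' Set.Ioi x = Set.univ := by
        ext q; simp [hx]
      rw [h1, measure_univ]
      simp only [atomExp, Measure.add_apply, Measure.smul_apply, smul_eq_mul,
        expMeasure_Ioi_of_nonpos hr hx.le, mul_one]
      rw [Measure.dirac_apply' _ measurableSet_Ioi, Set.indicator_of_mem (by simpa using hx),
        Pi.one_apply, mul_one, ← ENNReal.ofReal_add hw0 (by linarith)]
      simp
    · push Not at hx
      have h1 : (fun q : ℝ × ℝ => max (q.1 - q.2) 0) ⁻¹' Set.Ioi x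
          = {q : ℝ × ℝ | q.2 + x < q.1} := by
        ext q; simp [not_lt.2 hx]; constructor <;> intro h <;> linarith
      have hms : MeasurableSet {q : ℝ × ℝ | q.2 + x < q.1} :=
        measurableSet_lt (by fun_prop) (by fun_prop)
      rw [h1, Measure.prod_apply_symm hms]
      have h2 : ∀ᵐ a ∂(expMeasure s),
          expMeasure r ((fun y => (y, a)) ⁻¹' {q : ℝ × ℝ | q.2 + x < q.1})
          = ENNReal.ofReal (Real.exp (-(r * x)) * Real.exp ((-r) * a)) := by
        filter_upwards [ae_pos_expMeasure s] with a ha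
        have : (fun y : ℝ => (y, a)) ⁻¹' {q : ℝ × ℝ | q.2 + x < q.1} = Set.Ioi (a + x) := by
          ext y; simp
        rw [this, expMeasure_Ioi hr (by positivity), ← Real.exp_add]
        congr 2; ring
      rw [lintegral_congr_ae h2, ← ofReal_integral_eq_lintegral_ofReal, integral_const_mul,
        integral_rexp_expMeasure hs (by linarith)]
      · simp only [atomExp, Measure.add_apply, Measure.smul_apply, smul_eq_mul,
          expMeasure_Ioi hr hx]
        rw [Measure.dirac_apply' _ measurableSet_Ioi, Set.indicator_of_notMem (by simpa using hx),
          mul_zero, zero_add, ← ENNReal.ofReal_mul (by linarith)]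
        congr 1
        have : r + s ≠ 0 := by positivity
        rw [sub_neg_eq_add, add_comm s r]
        field_simp
        ring
      · exact (integrable_rexp_expMeasure hs (by linarith)).const_mul _
      · exact ae_of_all _ fun a => by positivity
  refine Measure.ext_of_Iic _ _ fun x => ?_
  rw [← compl_compl (Set.Iic x), prob_compl_eq_one_sub (by simp), Set.compl_Iic, key,
    ← Set.compl_Iic, ← prob_compl_eq_one_sub (by simp)]

/-! ### Hyperexponential mixtures. -/

lemma isProbabilityMeasure_hyperexpMeasure {Θ : Type*} [Fintype Θ] {w r : Θ → ℝ}
    (hw : ∀ θ, 0 ≤ w θ) (hw1 : ∑ θ, w θ = 1) (hr : ∀ θ, 0 < r θ) :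
    IsProbabilityMeasure (hyperexpMeasure w r) := by
  constructor
  have := fun θ => isProbabilityMeasure_expMeasure (hr θ)
  simp [hyperexpMeasure]
  rw [← ENNReal.ofReal_sum_of_nonneg fun θ _ => hw θ, hw1, ENNReal.ofReal_one]

lemma integral_hyperexpMeasure {Θ : Type*} [Fintype Θ] {w r : Θ → ℝ}
    (hw : ∀ θ, 0 ≤ w θ) {f : ℝ → ℝ} (hf : ∀ θ, Integrable f (expMeasure (r θ))) :
    ∫ x, f x ∂(hyperexpMeasure w r) = ∑ θ, w θ * ∫ x, f x ∂(expMeasure (r θ)) := by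
  rw [hyperexpMeasure, integral_finsetSum_measure]
  · refine Finset.sum_congr rfl fun θ _ => ?_
    rw [integral_smul_measure, ENNReal.toReal_ofReal (hw θ), smul_eq_mul]
  · exact fun θ _ => (hf θ).smul_measure ENNReal.ofReal_ne_top

lemma integrable_hyperexpMeasure {Θ : Type*} [Fintype Θ] {w r : Θ → ℝ} {f : ℝ → ℝ}
    (hf : ∀ θ, Integrable f (expMeasure (r θ))) : Integrable f (hyperexpMeasure w r) := by
  rw [hyperexpMeasure, integrable_finsetSum_measure]
  exact fun θ _ => (hf θ).smul_measure ENNReal.ofReal_ne_top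

/-! ### Convergence of contracting Markov recursions -/

lemma integrable_of_abs_le {Y : Type*} [MeasurableSpace Y] {m : Measure Y} [IsFiniteMeasure m]
    {f : Y → ℝ} (hf : Measurable f) {B : ℝ} (hB : ∀ x, |f x| ≤ B) : Integrable f m :=
  Integrable.of_bound hf.aestronglyMeasurable B (ae_of_all _ hB)

section Contraction

variable {E : Type*} [MeasurableSpace E]

/-- The transition operator `f ↦ ∫ f (Ψ (·, e)) dκ` turns a bound `|f x - f y| ≤ C |g x - g y|` into
the same bound with `C ∫ w`. The induction moves one step of the chain onto the test function, hence
the quantification over `f`, `B` and `C` inside it; at time `0` a Dirac mass is compared with `π`.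
-/
lemma abs_integral_iterate_sub_le (κ : Measure E) [IsProbabilityMeasure κ]
    {Ψ : ℝ × E → ℝ} (hΨ : Measurable Ψ) {g : ℝ → ℝ} {w : E → ℝ} (hw : Integrable w κ)
    (hcontr : ∀ᵐ e ∂κ, ∀ x ≥ 0, ∀ y ≥ 0, 0 ≤ Ψ (x, e) ∧ 0 ≤ w e ∧
      |g (Ψ (x, e)) - g (Ψ (y, e))| ≤ w e * |g x - g y|)
    {ν : ℕ → Measure ℝ} [∀ n, IsProbabilityMeasure (ν n)] (hν0 : ν 0 = Measure.dirac 0)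
    (hν : ∀ n, ν (n + 1) = ((ν n).prod κ).map Ψ)
    {π : Measure ℝ} [IsProbabilityMeasure π] (hπ0 : ∀ᵐ x ∂π, 0 ≤ x) (hgπ : Integrable g π)
    (hπ : (π.prod κ).map Ψ = π) (n : ℕ) :
    ∀ (f : ℝ → ℝ) (B C : ℝ), Measurable f → (∀ x, |f x| ≤ B) → 0 ≤ C →
      (∀ x ≥ 0, ∀ y ≥ 0, |f x - f y| ≤ C * |g x - g y|) →
      |∫ x, f x ∂(ν n) - ∫ x, f x ∂π| ≤ C * (∫ e, w e ∂κ) ^ n * ∫ x, |g 0 - g x| ∂π := by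
  induction n with
  | zero =>
    intro f B C hf hB hC hfg
    rw [hν0, integral_dirac, pow_zero, mul_one, ← integral_const_mul]
    have h1 : f 0 - ∫ x, f x ∂π = ∫ x, (f 0 - f x) ∂π := by
      rw [integral_sub (integrable_const _) (integrable_of_abs_le hf hB)]
      simp
    rw [h1]
    refine (abs_integral_le_integral_abs).trans (integral_mono_ae ?_ ?_ ?_)
    · exact ((integrable_const _).sub (integrable_of_abs_le hf hB)).abs
    · exact (((integrable_const _).sub hgπ).abs).const_mul C
    · filter_upwards [hπ0] with x hx
      exact hfg 0 le_rfl x hx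
  | succ n ih =>
    intro f B C hf hB hC hfg
    have hfΨ : Measurable fun z : ℝ × E => f (Ψ z) := hf.comp hΨ
    have hstep : ∀ (m : Measure ℝ) [IsProbabilityMeasure m],
        ∫ x, f x ∂((m.prod κ).map Ψ) = ∫ x, ∫ e, f (Ψ (x, e)) ∂κ ∂m := by
      intro m _
      rw [integral_map hΨ.aemeasurable hf.aestronglyMeasurable, integral_prod]
      exact integrable_of_abs_le hfΨ fun z => hB _
    have hw0 : 0 ≤ ∫ e, w e ∂κ := by
      refine integral_nonneg_of_ae ?_
      filter_upwards [hcontr] with e he using (he 0 le_rfl 0 le_rfl).2.1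
    have hsec : ∀ x, Measurable fun e => f (Ψ (x, e)) := fun x =>
      hfΨ.comp measurable_prodMk_left
    have hsec' : ∀ x, Integrable (fun e => f (Ψ (x, e))) κ := fun x =>
      integrable_of_abs_le (hsec x) fun _ => hB _
    -- The new test function is the old one averaged over a single step, which costs one factor `∫
    -- w`.
    have := ih (fun x => ∫ e, f (Ψ (x, e)) ∂κ) B (C * ∫ e, w e ∂κ)
      hfΨ.stronglyMeasurable.integral_prod_right'.measurable ?_ (by positivity) ?_
    · rw [hν, hstep (ν n)]
      nth_rw 1 [← hπ]
      rw [hstep π]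
      refine this.trans (le_of_eq ?_)
      ring
    · intro x
      have h := norm_integral_le_of_norm_le_const (μ := κ) (C := B)
        (f := fun e => f (Ψ (x, e))) (ae_of_all κ fun e => hB (Ψ (x, e)))
      simpa using h
    · intro x hx y hy
      rw [← integral_sub (hsec' x) (hsec' y),
        mul_assoc, ← integral_mul_const, ← integral_const_mul]
      refine (abs_integral_le_integral_abs).trans (integral_mono_ae ?_ ?_ ?_)
      · exact ((hsec' x).sub
          (hsec' y)).abs
      · exact (hw.mul_const _).const_mul C
      · filter_upwards [hcontr] with e he
        refine (hfg _ (he x hx y hy).1 _ (he y hy x hx).1).trans ?_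
        exact mul_le_mul_of_nonneg_left (he x hx y hy).2.2 hC

end Contraction

/-! ### The workload recursion -/

/-- The mixture `q δ_true + (1 - q) δ_false`. -/
def markMeasure (q : ℝ) : Measure Bool :=
  ENNReal.ofReal q • Measure.dirac true + ENNReal.ofReal (1 - q) • Measure.dirac false

lemma isProbabilityMeasure_markMeasure {q : ℝ} (h0 : 0 ≤ q) (h1 : q ≤ 1) :
    IsProbabilityMeasure (markMeasure q) := by
  constructor
  simp [markMeasure]
  rw [← ENNReal.ofReal_add h0 (by linarith)]
  simp

lemma integral_markMeasure {q : ℝ} (h0 : 0 ≤ q) (h1 : q ≤ 1) (f : Bool → ℝ) :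
    ∫ b, f b ∂(markMeasure q) = q * f true + (1 - q) * f false := by
  have hi : ∀ m : Measure Bool, IsFiniteMeasure m → Integrable f m :=
    fun m _ => Integrable.of_finite
  rw [markMeasure, integral_add_measure, integral_smul_measure, integral_smul_measure,
    integral_dirac, integral_dirac, ENNReal.toReal_ofReal h0, ENNReal.toReal_ofReal (by linarith),
    smul_eq_mul, smul_eq_mul]
  all_goals exact (hi _ inferInstance).smul_measure ENNReal.ofReal_ne_top

/-- The law of the time since the last arrival, of the mark telling whether the next request joins
the queue, and of its service time. -/
def slotMeasure (L q m : ℝ) : Measure (ℝ × Bool × ℝ) :=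
  (expMeasure L).prod ((markMeasure q).prod (expMeasure m))

/-- The workload of a queue left behind by an arrival at the server, given the workload left
behind by the preceding one. -/
def workloadStep (z : ℝ × ℝ × Bool × ℝ) : ℝ :=
  max (z.1 - z.2.1) 0 + if z.2.2.1 then z.2.2.2 else 0

lemma measurable_workloadStep : Measurable workloadStep := by
  refine Measurable.add (by fun_prop) (Measurable.ite ?_ (by fun_prop) measurable_const)
  exact (measurableSet_singleton true).preimage (by fun_prop)

section Slot

variable {L q m : ℝ} (hL : 0 < L) (h0 : 0 ≤ q) (h1 : q ≤ 1) (hm : 0 < m)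

include hL h0 h1 hm

lemma isProbabilityMeasure_slotMeasure : IsProbabilityMeasure (slotMeasure L q m) := by
  have := isProbabilityMeasure_expMeasure hL
  have := isProbabilityMeasure_expMeasure hm
  have := isProbabilityMeasure_markMeasure h0 h1
  unfold slotMeasure
  infer_instance

lemma integral_slotMeasure {f : ℝ × Bool × ℝ → ℝ} (hf : Integrable f (slotMeasure L q m)) :
    ∫ e, f e ∂(slotMeasure L q m) = ∫ a, (q * ∫ s, f (a, true, s) ∂(expMeasure m)
      + (1 - q) * ∫ s, f (a, false, s) ∂(expMeasure m)) ∂(expMeasure L) := by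
  have := isProbabilityMeasure_expMeasure hL
  have := isProbabilityMeasure_expMeasure hm
  have := isProbabilityMeasure_markMeasure h0 h1
  unfold slotMeasure at hf ⊢
  rw [integral_prod _ hf]
  refine integral_congr_ae ?_
  filter_upwards [hf.prod_right_ae] with a ha
  rw [integral_prod _ ha, integral_markMeasure h0 h1]

lemma integrable_slotWeight {α : ℝ} (hα0 : 0 < α) (hα : α < m) :
    Integrable (fun e : ℝ × Bool × ℝ => Real.exp (-α * e.1) *
      if e.2.1 then Real.exp (α * e.2.2) else 1) (slotMeasure L q m) := by
  have := isProbabilityMeasure_expMeasure hL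
  have := isProbabilityMeasure_expMeasure hm
  have := isProbabilityMeasure_markMeasure h0 h1
  refine Integrable.mul_prod (integrable_rexp_expMeasure hL (by linarith)) ?_
    (g := fun e : Bool × ℝ => if e.1 then Real.exp (α * e.2) else 1)
  have hi : Integrable (fun e : Bool × ℝ => (1 : ℝ) * Real.exp (α * e.2))
    ((markMeasure q).prod (expMeasure m)) := Integrable.mul_prod (f := fun _ : Bool => (1 : ℝ))
      (integrable_const (1 : ℝ)) (integrable_rexp_expMeasure hm hα)
  refine (hi.add (integrable_const 1)).mono' ?_ (ae_of_all _ fun e => ?_)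
  · refine (Measurable.ite ?_ (by fun_prop) measurable_const).aestronglyMeasurable
    exact (measurableSet_singleton true).preimage (by fun_prop)
  · simp only [Pi.add_apply, one_mul]
    split_ifs <;> (simp; try positivity)

lemma integral_slotWeight {α : ℝ} (hα0 : 0 < α) (hα : α < m) :
    ∫ e : ℝ × Bool × ℝ, Real.exp (-α * e.1) * (if e.2.1 then Real.exp (α * e.2.2) else 1)
      ∂(slotMeasure L q m) = L / (L + α) * (q * (m / (m - α)) + (1 - q)) := by
  have := isProbabilityMeasure_expMeasure hm
  rw [integral_slotMeasure hL h0 h1 hm (integrable_slotWeight hL h0 h1 hm hα0 hα)]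
  simp only [if_true, Bool.false_eq_true, if_false, integral_const_mul, mul_one, integral_const,
    smul_eq_mul, probReal_univ, one_mul, integral_rexp_expMeasure hm hα]
  have : ∀ a : ℝ, q * (Real.exp (-α * a) * (m / (m - α))) + (1 - q) * Real.exp (-α * a)
      = (q * (m / (m - α)) + (1 - q)) * Real.exp (-α * a) := fun a => by ring
  simp_rw [this]
  rw [integral_const_mul, integral_rexp_expMeasure hL (by linarith), sub_neg_eq_add]
  ring

/-- The place where stability produces contraction: since `q m/(m - α) + (1 - q) = 1 + q α/(m - α)`,
clearing denominators reduces the upper bound to `q L < m - α`. -/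
lemma slotWeight_lt_one {α : ℝ} (hα0 : 0 < α) (hα : α < m - q * L) :
    0 ≤ L / (L + α) * (q * (m / (m - α)) + (1 - q)) ∧
      L / (L + α) * (q * (m / (m - α)) + (1 - q)) < 1 := by
  have hmα : 0 < m - α := by nlinarith
  have h2 : 0 ≤ q * (m / (m - α)) := by positivity
  constructor
  · have : 0 ≤ L / (L + α) := by positivity
    exact mul_nonneg this (by linarith)
  · rw [div_mul_eq_mul_div, div_lt_one (by positivity)]
    have : q * (m / (m - α)) + (1 - q) = 1 + q * α / (m - α) := by field_simp; ring
    rw [this, mul_add, mul_one, add_lt_add_iff_left, mul_div_assoc', div_lt_iff₀ hmα]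
    nlinarith

end Slot

/-- Under `exp (α ·)` the reflection at `0` becomes the maximum with `1`, which does not increase
distances, while subtracting the elapsed time and adding the service time become multiplications. -/
lemma abs_exp_workloadStep_sub_le {α x y : ℝ} (hα : 0 < α) (e : ℝ × Bool × ℝ) :
    |Real.exp (α * workloadStep (x, e)) - Real.exp (α * workloadStep (y, e))|
      ≤ Real.exp (-α * e.1) * (if e.2.1 then Real.exp (α * e.2.2) else 1) *
        |Real.exp (α * x) - Real.exp (α * y)| := by
  obtain ⟨a, b, s⟩ := e
  have hpos : |Real.exp (α * max (x - a) 0) - Real.exp (α * max (y - a) 0)|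
      ≤ |Real.exp (α * (x - a)) - Real.exp (α * (y - a))| := by
    have h : ∀ t : ℝ, Real.exp (α * max t 0) = max (Real.exp (α * t)) 1 := by
      intro t
      rw [← Real.exp_zero, ← mul_zero α, mul_max_of_nonneg _ _ hα.le, Real.exp_monotone.map_max]
      simp
    rw [h, h]
    exact abs_max_sub_max_le_abs _ _ _
  have hfac : |Real.exp (α * (x - a)) - Real.exp (α * (y - a))|
      = Real.exp (-α * a) * |Real.exp (α * x) - Real.exp (α * y)| := by
    rw [← abs_of_pos (Real.exp_pos (-α * a)), ← abs_mul, mul_sub (Real.exp _),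
      ← Real.exp_add, ← Real.exp_add]
    congr 2 <;> congr 1 <;> ring
  cases b
  · simpa [workloadStep, hfac] using hpos
  · simp only [workloadStep, if_true]
    rw [mul_add, mul_add, Real.exp_add, Real.exp_add, ← sub_mul, abs_mul,
      abs_of_pos (Real.exp_pos (α * s))]
    rw [hfac] at hpos
    calc _ ≤ _ := mul_le_mul_of_nonneg_right hpos (Real.exp_pos (α * s)).le
      _ = _ := by ring

/-! ### The stationary workload -/

/-- The atom at `0` stays there, and the exponential part loses the fraction `r / (r + s)` of its
mass to it by `map_sub_posPart_expMeasure`. -/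
lemma map_sub_posPart_atomExp {w r s : ℝ} (hw0 : 0 ≤ w) (hw1 : w ≤ 1) (hr : 0 < r) (hs : 0 < s) :
    ((atomExp w r).prod (expMeasure s)).map (fun q => max (q.1 - q.2) 0)
      = atomExp (w + (1 - w) * (r / (r + s))) r := by
  have := isProbabilityMeasure_expMeasure hr
  have := isProbabilityMeasure_expMeasure hs
  have hm : Measurable fun q : ℝ × ℝ => max (q.1 - q.2) 0 := by fun_prop
  have hd : ((Measure.dirac (0 : ℝ)).prod (expMeasure s)).map (fun q => max (q.1 - q.2) 0)
      = Measure.dirac 0 := by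
    rw [Measure.dirac_prod, Measure.map_map hm (by fun_prop),
      Measure.map_congr (g := fun _ => (0 : ℝ))]
    · simp
    · filter_upwards [ae_pos_expMeasure s] with a ha
      simp [ha.le]
  have hρ : r / (r + s) ≤ 1 := (div_le_one (by positivity)).2 (by linarith)
  have hρ0 : 0 ≤ r / (r + s) := by positivity
  rw [atomExp, Measure.add_prod, Measure.prod_smul_left, Measure.prod_smul_left,
    Measure.map_add _ _ hm, Measure.map_smul, Measure.map_smul, hd,
    map_sub_posPart_expMeasure hr hs, atomExp, atomExp, smul_add, ← add_assoc, smul_smul,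
    smul_smul, ← add_smul, ← ENNReal.ofReal_mul (by linarith), ← ENNReal.ofReal_mul (by linarith),
    ← ENNReal.ofReal_add hw0 (mul_nonneg (by linarith) hρ0)]
  congr 3
  ring

section Stationary

variable {L q m : ℝ} (hL : 0 < L) (h0 : 0 ≤ q) (h1 : q ≤ 1) (hm : 0 < m) (hst : q * L < m)

include hL h0 h1 hm hst

lemma stationary_bounds :
    0 < m - q * L ∧ 0 ≤ (1 - q) * ((m - q * L) / m) ∧ (1 - q) * ((m - q * L) / m) ≤ 1 ∧
      m - q * L ≤ m := by
  have h2 : (m - q * L) / m ≤ 1 := (div_le_one hm).2 (by nlinarith)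
  have h3 : 0 ≤ (m - q * L) / m := div_nonneg (by linarith) hm.le
  refine ⟨by linarith, mul_nonneg (by linarith) h3, by nlinarith, by nlinarith⟩

/-- Passage, in equilibrium, from just after an arrival to just before the next one. The result is
the classical M/M/1 workload with load `q L / m`. -/
lemma map_sub_posPart_stationary :
    ((atomExp ((1 - q) * ((m - q * L) / m)) (m - q * L)).prod (expMeasure L)).map
      (fun z => max (z.1 - z.2) 0) = atomExp ((m - q * L) / m) (m - q * L) := by
  obtain ⟨hη, hw0, hw1, -⟩ := stationary_bounds hL h0 h1 hm hst
  rw [map_sub_posPart_atomExp hw0 hw1 hη hL]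
  congr 1
  have : m - q * L + L ≠ 0 := by linarith
  field_simp
  ring

/-- Mark and service time are independent of the workload found on arrival. A request that joins
turns it into `Exp(m - q L)` by `atomExp_conv_expMeasure`; any other leaves it alone. Keeping track
of the mark yields both the invariance of the law and the value of the limit. -/
lemma lintegral_workloadStep_stationary {f : Bool × ℝ → ℝ≥0∞} (hf : Measurable f) :
    ∫⁻ z : ℝ × ℝ × Bool × ℝ, f (z.2.2.1, workloadStep z)
        ∂((atomExp ((1 - q) * ((m - q * L) / m)) (m - q * L)).prod (slotMeasure L q m))
      = ENNReal.ofReal q * ∫⁻ x, f (true, x) ∂(expMeasure (m - q * L)) +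
        ENNReal.ofReal (1 - q) *
          ∫⁻ x, f (false, x) ∂(atomExp ((m - q * L) / m) (m - q * L)) := by
  obtain ⟨hη, hw0, hw1, hle⟩ := stationary_bounds hL h0 h1 hm hst
  have := isProbabilityMeasure_expMeasure hL
  have := isProbabilityMeasure_expMeasure hm
  have := isProbabilityMeasure_expMeasure hη
  have := isProbabilityMeasure_markMeasure h0 h1
  have := isProbabilityMeasure_atomExp hw0 hw1 hη
  have := isProbabilityMeasure_slotMeasure hL h0 h1 hm
  have := isProbabilityMeasure_atomExp (w := (m - q * L) / m) (by positivity)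
    ((div_le_one hm).2 hle) hη
  have hmax : Measurable fun q : ℝ × ℝ => max (q.1 - q.2) 0 := by fun_prop
  have hG : Measurable fun v : ℝ => ENNReal.ofReal q * ∫⁻ s, f (true, v + s) ∂(expMeasure m)
      + ENNReal.ofReal (1 - q) * f (false, v) := by
    refine Measurable.add (Measurable.const_mul ?_ _) (by fun_prop)
    exact Measurable.lintegral_prod_right' (f := fun z : ℝ × ℝ => f (true, z.1 + z.2))
      (by fun_prop)
  have hF : Measurable fun z : ℝ × ℝ × Bool × ℝ => f (z.2.2.1, workloadStep z) :=
    hf.comp ((by fun_prop : Measurable fun z : ℝ × ℝ × Bool × ℝ => z.2.2.1).prodMk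
      measurable_workloadStep)
  calc _ = ∫⁻ x, ∫⁻ a, (ENNReal.ofReal q * ∫⁻ s, f (true, max (x - a) 0 + s) ∂(expMeasure m)
      + ENNReal.ofReal (1 - q) * f (false, max (x - a) 0)) ∂(expMeasure L)
        ∂(atomExp ((1 - q) * ((m - q * L) / m)) (m - q * L)) := by
        rw [lintegral_prod _ hF.aemeasurable]
        refine lintegral_congr fun x => ?_
        have hFx := hF.comp (measurable_prodMk_left (x := x))
        refine (lintegral_prod _ hFx.aemeasurable).trans ?_
        refine lintegral_congr fun a => ?_
        have hFa := hFx.comp (measurable_prodMk_left (x := a))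
        refine (lintegral_prod _ hFa.aemeasurable).trans ?_
        rw [markMeasure, lintegral_add_measure,
          lintegral_smul_measure, lintegral_smul_measure, lintegral_dirac, lintegral_dirac]
        simp [workloadStep]
    _ = ∫⁻ v, (ENNReal.ofReal q * ∫⁻ s, f (true, v + s) ∂(expMeasure m)
      + ENNReal.ofReal (1 - q) * f (false, v)) ∂(atomExp ((m - q * L) / m) (m - q * L)) := by
        rw [← map_sub_posPart_stationary hL h0 h1 hm hst, lintegral_map hG hmax]
        exact (lintegral_prod _ (hG.comp hmax).aemeasurable).symm
    _ = _ := by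
        rw [lintegral_add_right _ (by fun_prop), lintegral_const_mul' _ _ ENNReal.ofReal_ne_top,
          lintegral_const_mul' _ _ ENNReal.ofReal_ne_top]
        congr 2
        rw [← atomExp_conv_expMeasure hη hle, Measure.lintegral_conv (by fun_prop)]

/-- Once the mark is forgotten, only requests that do not join contribute to the atom at `0`, giving
it mass `(1 - q) (m - q L) / m`; the remainder is `Exp(m - q L)`. -/
lemma map_workloadStep_stationary :
    ((atomExp ((1 - q) * ((m - q * L) / m)) (m - q * L)).prod (slotMeasure L q m)).map workloadStep
      = atomExp ((1 - q) * ((m - q * L) / m)) (m - q * L) := by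
  obtain ⟨hη, hw0, hw1, hle⟩ := stationary_bounds hL h0 h1 hm hst
  have hρ : (m - q * L) / m ≤ 1 := (div_le_one hm).2 hle
  refine Measure.ext_of_lintegral _ fun f hf => ?_
  rw [lintegral_map hf measurable_workloadStep,
    lintegral_workloadStep_stationary hL h0 h1 hm hst (f := fun z => f z.2) (by fun_prop)]
  simp only [atomExp, lintegral_add_measure, lintegral_smul_measure, lintegral_dirac, smul_eq_mul]
  rw [mul_add, ← mul_assoc, ← mul_assoc, ← ENNReal.ofReal_mul (by linarith),
    ← ENNReal.ofReal_mul (by linarith), add_left_comm, ← add_mul,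
    ← ENNReal.ofReal_add h0 (mul_nonneg (by linarith) (by linarith))]
  congr 3
  ring

lemma integral_workload_stationary {f : ℝ → ℝ} (hf : Measurable f) :
    ∫ z : ℝ × ℝ × Bool × ℝ, (if z.2.2.1 then f (workloadStep z) else 0)
        ∂((atomExp ((1 - q) * ((m - q * L) / m)) (m - q * L)).prod (slotMeasure L q m))
      = q * ∫ x, f x ∂(expMeasure (m - q * L)) := by
  obtain ⟨hη, hw0, hw1, hle⟩ := stationary_bounds hL h0 h1 hm hst
  have := isProbabilityMeasure_expMeasure hη
  have := isProbabilityMeasure_atomExp hw0 hw1 hη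
  have := isProbabilityMeasure_slotMeasure hL h0 h1 hm
  have hlaw : ((((atomExp ((1 - q) * ((m - q * L) / m)) (m - q * L)).prod
      (slotMeasure L q m)).restrict {z | z.2.2.1 = true}).map workloadStep)
      = ENNReal.ofReal q • expMeasure (m - q * L) := by
    have hms : MeasurableSet {z : ℝ × ℝ × Bool × ℝ | z.2.2.1 = true} :=
      (measurableSet_singleton true).preimage (by fun_prop)
    refine Measure.ext_of_lintegral _ fun g hg => ?_
    rw [lintegral_map hg measurable_workloadStep, ← lintegral_indicator hms,
      lintegral_smul_measure]
    have := lintegral_workloadStep_stationary hL h0 h1 hm hst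
      (f := fun z => if z.1 then g z.2 else 0)
      (Measurable.ite ((measurableSet_singleton true).preimage measurable_fst) (by fun_prop)
        measurable_const)
    simp only [if_true, Bool.false_eq_true, if_false, lintegral_zero, mul_zero, add_zero] at this
    rw [smul_eq_mul, ← this]
    refine lintegral_congr fun z => ?_
    simp [Set.indicator_apply]
  have hms : MeasurableSet {z : ℝ × ℝ × Bool × ℝ | z.2.2.1 = true} :=
    (measurableSet_singleton true).preimage (by fun_prop)
  have h2 : ∀ z : ℝ × ℝ × Bool × ℝ, (if z.2.2.1 then f (workloadStep z) else 0)
      = {z : ℝ × ℝ × Bool × ℝ | z.2.2.1 = true}.indicator (fun z => f (workloadStep z)) z := by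
    intro z; simp [Set.indicator_apply]
  simp_rw [h2]
  rw [integral_indicator hms, ← integral_map (φ := workloadStep)
    measurable_workloadStep.aemeasurable (hf.aestronglyMeasurable), hlaw, integral_smul_measure,
    ENNReal.toReal_ofReal h0, smul_eq_mul]

/-- Started empty, a stable queue observed at the arrivals joining it has a sojourn time whose law
converges to an exponential distribution. -/
theorem tendsto_integral_workload {ν : ℕ → Measure ℝ} [∀ n, IsProbabilityMeasure (ν n)]
    (hν0 : ν 0 = Measure.dirac 0)
    (hν : ∀ n, ν (n + 1) = ((ν n).prod (slotMeasure L q m)).map workloadStep)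
    {f : ℝ → ℝ} {K : ℝ≥0} (hf : LipschitzWith K f) {B : ℝ} (hB : ∀ x, |f x| ≤ B) :
    Tendsto (fun n => ∫ z : ℝ × ℝ × Bool × ℝ, (if z.2.2.1 then f (workloadStep z) else 0)
        ∂((ν n).prod (slotMeasure L q m))) atTop
      (𝓝 (q * ∫ x, f x ∂(expMeasure (m - q * L)))) := by
  obtain ⟨hη, hw0, hw1, hle⟩ := stationary_bounds hL h0 h1 hm hst
  have := isProbabilityMeasure_expMeasure hη
  have := isProbabilityMeasure_atomExp hw0 hw1 hη
  have := isProbabilityMeasure_slotMeasure hL h0 h1 hm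
  have hfm : Measurable f := hf.continuous.measurable
  set α := (m - q * L) / 2 with hα
  have hα0 : 0 < α := by positivity
  have hα1 : α < m - q * L := by linarith
  obtain ⟨hc0, hc1⟩ := slotWeight_lt_one hL h0 h1 hm hα0 hα1
  set c := L / (L + α) * (q * (m / (m - α)) + (1 - q)) with hc
  set π := atomExp ((1 - q) * ((m - q * L) / m)) (m - q * L) with hπ
  have hFm : Measurable fun z : ℝ × ℝ × Bool × ℝ => if z.2.2.1 then f (workloadStep z) else 0 :=
    Measurable.ite ((measurableSet_singleton true).preimage (by fun_prop))
      (hfm.comp measurable_workloadStep) measurable_const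
  have hFB : ∀ z : ℝ × ℝ × Bool × ℝ, |if z.2.2.1 then f (workloadStep z) else 0| ≤ B := by
    intro z
    split_ifs
    · exact hB _
    · simpa using (abs_nonneg _).trans (hB 0)
  -- Averaging over the slot makes the functional a function of the preceding workload alone, to
  -- which the contraction estimate applies.
  set h : ℝ → ℝ := fun x => ∫ e, (if e.2.1 then f (workloadStep (x, e)) else 0)
    ∂(slotMeasure L q m) with hh
  have hprod : ∀ (μ : Measure ℝ) [IsProbabilityMeasure μ],
      ∫ z : ℝ × ℝ × Bool × ℝ, (if z.2.2.1 then f (workloadStep z) else 0)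
        ∂(μ.prod (slotMeasure L q m)) = ∫ x, h x ∂μ := by
    intro μ _
    rw [integral_prod _ (integrable_of_abs_le hFm hFB)]
  have hsec : ∀ x, Measurable fun e : ℝ × Bool × ℝ =>
      if e.2.1 then f (workloadStep (x, e)) else 0 := fun x => hFm.comp measurable_prodMk_left
  have hlip : ∀ x ≥ 0, ∀ y ≥ 0,
      |h x - h y| ≤ K / α * |Real.exp (α * x) - Real.exp (α * y)| := by
    intro x hx y hy
    -- On the half-line `exp (α ·)` has slope at least `α`, so a `K`-Lipschitz function satisfies
    -- the required comparison with constant `K / α`.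
    have hexp : ∀ x ≥ 0, ∀ y ≥ 0, x ≤ y →
        α * (y - x) ≤ Real.exp (α * y) - Real.exp (α * x) := by
      intro x hx y hy hxy
      have e1 : Real.exp (α * y) = Real.exp (α * x) * Real.exp (α * (y - x)) := by
        rw [← Real.exp_add]; ring_nf
      have e2 := Real.add_one_le_exp (α * (y - x))
      have e3 : 1 ≤ Real.exp (α * x) := Real.one_le_exp (by positivity)
      have e4 : 0 ≤ α * (y - x) := mul_nonneg hα0.le (by linarith)
      rw [e1]
      nlinarith
    have hxy : α * |x - y| ≤ |Real.exp (α * x) - Real.exp (α * y)| := by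
      rcases le_total x y with hle | hle
      · rw [abs_sub_comm, abs_sub_comm (Real.exp _), abs_of_nonneg (by linarith)]
        exact (hexp x hx y hy hle).trans (le_abs_self _)
      · rw [abs_of_nonneg (by linarith)]
        exact (hexp y hy x hx hle).trans (le_abs_self _)
    have h1 : |h x - h y| ≤ K * |x - y| := by
      rw [hh]
      simp only
      rw [← integral_sub (integrable_of_abs_le (hsec x) fun e => hFB (x, e))
        (integrable_of_abs_le (hsec y) fun e => hFB (y, e))]
      have := norm_integral_le_of_norm_le_const (μ := slotMeasure L q m) (C := K * |x - y|)
        (f := fun e => (if e.2.1 then f (workloadStep (x, e)) else 0)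
          - if e.2.1 then f (workloadStep (y, e)) else 0) (ae_of_all _ fun e => ?_)
      · simpa using this
      · split_ifs
        · refine (hf.norm_sub_le _ _).trans ?_
          refine mul_le_mul_of_nonneg_left ?_ K.2
          simp only [workloadStep, Real.norm_eq_abs]
          rw [add_sub_add_right_eq_sub]
          refine (abs_max_sub_max_le_abs _ _ _).trans ?_
          simp
        · simp; positivity
    calc _ ≤ K * |x - y| := h1
      _ = K / α * (α * |x - y|) := by field_simp
      _ ≤ _ := by gcongr
  have hbound : ∀ n, |∫ x, h x ∂(ν n) - ∫ x, h x ∂π| ≤ K / α * c ^ n *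
      ∫ x, |Real.exp (α * 0) - Real.exp (α * x)| ∂π := by
    intro n
    rw [hc, ← integral_slotWeight hL h0 h1 hm hα0 (by linarith)]
    refine abs_integral_iterate_sub_le (slotMeasure L q m) measurable_workloadStep
      (g := fun x => Real.exp (α * x)) (integrable_slotWeight hL h0 h1 hm hα0 (by linarith))
      ?_ hν0 hν ?_ ?_ (map_workloadStep_stationary hL h0 h1 hm hst) n h B (K / α)
      hFm.stronglyMeasurable.integral_prod_right'.measurable ?_ (by positivity) hlip
    · have hpos : ∀ᵐ e ∂(slotMeasure L q m), 0 < e.2.2 := by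
        have := isProbabilityMeasure_expMeasure hL
        have := isProbabilityMeasure_expMeasure hm
        have := isProbabilityMeasure_markMeasure h0 h1
        have q1 : Measure.QuasiMeasurePreserving (fun e : ℝ × Bool × ℝ => e.2.2)
            (slotMeasure L q m) (expMeasure m) :=
          Measure.quasiMeasurePreserving_snd.comp Measure.quasiMeasurePreserving_snd
        exact q1.ae (ae_pos_expMeasure m)
      filter_upwards [hpos] with e he x hx y hy
      refine ⟨?_, ?_, abs_exp_workloadStep_sub_le hα0 e⟩
      · unfold workloadStep
        have := le_max_right (x - e.1) 0
        split_ifs <;> (simp_all; try positivity)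
      · split_ifs <;> positivity
    · rw [atomExp, ae_add_measure_iff]
      constructor
      · refine Measure.ae_smul_measure ?_ _
        rw [ae_dirac_iff measurableSet_Ici]
      · refine Measure.ae_smul_measure ?_ _
        filter_upwards [ae_pos_expMeasure (m - q * L)] with x hx using hx.le
    · rw [atomExp, integrable_add_measure]
      refine ⟨Integrable.smul_measure ?_ ENNReal.ofReal_ne_top,
        (integrable_rexp_expMeasure hη hα1).smul_measure ENNReal.ofReal_ne_top⟩
      exact integrable_dirac (by simp)
    · intro x
      have := norm_integral_le_of_norm_le_const (μ := slotMeasure L q m) (C := B)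
        (f := fun e => if e.2.1 then f (workloadStep (x, e)) else 0)
        (ae_of_all _ fun e => hFB (x, e))
      simpa using this
  have htend : Tendsto (fun n => ∫ x, h x ∂(ν n)) atTop (𝓝 (∫ x, h x ∂π)) := by
    rw [tendsto_iff_dist_tendsto_zero]
    refine squeeze_zero (fun n => dist_nonneg) hbound ?_
    have := ((tendsto_pow_atTop_nhds_zero_of_lt_one hc0 hc1).const_mul (K / α)).mul_const
      (∫ x, |Real.exp (α * 0) - Real.exp (α * x)| ∂π)
    simpa using this
  rw [← integral_workload_stationary hL h0 h1 hm hst hfm, hprod π]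
  exact htend.congr fun n => (hprod (ν n)).symm

end Stationary

/-! ### Grouping independent σ-algebras -/

section Grouping

variable {Ω ι β : Type*} [mΩ : MeasurableSpace Ω] {P : Measure Ω}

/-- Each group is generated by the π-system of finite intersections of sets of its members. Index
sets taken from different fibres are disjoint, so an intersection over several groups is a single
finite intersection, to which independence of the original family applies. -/
lemma iIndep_iSup_fiber {m : ι → MeasurableSpace Ω} (h_le : ∀ i, m i ≤ mΩ) (h : iIndep m P)
    (g : ι → β) : iIndep (fun b => ⨆ i ∈ {i | g i = b}, m i) P := by
  classical
  refine iIndepSets.iIndep (fun b => iSup₂_le fun i _ => h_le i)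
    (fun b => piiUnionInter (fun i => {s | MeasurableSet[m i] s}) {i | g i = b})
    (fun b => isPiSystem_piiUnionInter _
      (fun i => @MeasurableSpace.isPiSystem_measurableSet _ (m i)) _)
    (fun b => (generateFrom_piiUnionInter_measurableSet m _).symm) ?_
  rw [iIndepSets_iff]
  intro s f hf
  -- The choice is made for every `b`, with dummy values outside `s`, so that `choose` yields total
  -- functions.
  have hf' : ∀ b, ∃ t : Finset ι, ∃ u : ι → Set Ω, b ∈ s →
      (∀ i ∈ t, g i = b) ∧ (∀ i ∈ t, MeasurableSet[m i] (u i)) ∧ f b = ⋂ i ∈ t, u i := by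
    intro b
    by_cases hb : b ∈ s
    · obtain ⟨t, ht, u, hu, he⟩ := hf b hb
      exact ⟨t, u, fun _ => ⟨fun i hi => ht hi, hu, he⟩⟩
    · exact ⟨∅, fun _ => ∅, fun h => absurd h hb⟩
  choose t u htu using hf'
  have hdisj : Set.PairwiseDisjoint (s : Set β) t := by
    intro b hb c hc hbc
    refine Finset.disjoint_left.2 fun i hi hi' => hbc ?_
    rw [← (htu b hb).1 i hi, (htu c hc).1 i hi']
  have hset : ⋂ b ∈ s, f b = ⋂ i ∈ s.biUnion t, u (g i) i := by
    ext ω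
    simp only [Set.mem_iInter, Finset.mem_biUnion]
    constructor
    · rintro hω i ⟨b, hb, hi⟩
      have := hω b hb
      rw [(htu b hb).2.2] at this
      rw [(htu b hb).1 i hi]
      exact Set.mem_iInter₂.1 this i hi
    · intro hω b hb
      rw [(htu b hb).2.2]
      refine Set.mem_iInter₂.2 fun i hi => ?_
      have := hω i ⟨b, hb, hi⟩
      rwa [(htu b hb).1 i hi] at this
  rw [hset, h.meas_biInter, Finset.prod_biUnion hdisj]
  · refine Finset.prod_congr rfl fun b hb => ?_
    rw [(htu b hb).2.2, h.meas_biInter (htu b hb).2.1]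
    exact Finset.prod_congr rfl fun i hi => by rw [(htu b hb).1 i hi]
  · intro i hi
    obtain ⟨b, hb, hi⟩ := Finset.mem_biUnion.1 hi
    rw [(htu b hb).1 i hi]
    exact (htu b hb).2.1 i hi

lemma iIndep_sumElim {m : ι → MeasurableSpace Ω} {n : β → MeasurableSpace Ω}
    (hm : iIndep m P) (hn : iIndep n P) (hmn : Indep (⨆ i, m i) (⨆ b, n b) P) :
    iIndep (Sum.elim m n) P := by
  classical
  rw [iIndep_iff]
  intro s f hf
  have hset : ⋂ i ∈ s, f i = (⋂ i ∈ s.toLeft, f (.inl i)) ∩ ⋂ b ∈ s.toRight, f (.inr b) := by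
    ext ω
    simp
  rw [hset, (Indep_iff _ _ _).1 hmn]
  · rw [hm.meas_biInter, hn.meas_biInter]
    · conv_rhs => rw [← Finset.toLeft_disjSum_toRight (u := s), Finset.prod_disjSum]
    · exact fun b hb => hf _ (Finset.mem_toRight.1 hb)
    · exact fun b hb => hf _ (Finset.mem_toLeft.1 hb)
  · refine Finset.measurableSet_biInter _ fun i hi => ?_
    exact le_iSup m i _ (hf _ (Finset.mem_toLeft.1 hi))
  · refine Finset.measurableSet_biInter _ fun i hi => ?_
    exact le_iSup n i _ (hf _ (Finset.mem_toRight.1 hi))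

/-- Both families together form an independent family over `ι ⊕ ι`, which is then grouped along the
folding map onto `ι`. -/
lemma iIndep_sup {m n : ι → MeasurableSpace Ω} (hm_le : ∀ i, m i ≤ mΩ) (hn_le : ∀ i, n i ≤ mΩ)
    (hm : iIndep m P) (hn : iIndep n P) (hmn : Indep (⨆ i, m i) (⨆ b, n b) P) :
    iIndep (fun i => m i ⊔ n i) P := by
  refine iIndep_of_iIndep_of_le (iIndep_iSup_fiber ?_ (iIndep_sumElim hm hn hmn) (Sum.elim id id))
    fun i => ?_
  · rintro (i | i)
    exacts [hm_le i, hn_le i]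
  · exact sup_le (le_iSup₂_of_le (Sum.inl i) rfl le_rfl) (le_iSup₂_of_le (Sum.inr i) rfl le_rfl)

end Grouping

/-! ### Marking the points of a Poisson process -/

section Marking

variable {Ω Θ : Type*} [MeasurableSpace Ω] {P : Measure Ω}

/-- A general complex base is needed: it will be an average of unimodular numbers over the types,
hence not unimodular itself. -/
lemma integral_pow_of_hasLaw_poissonMeasure {D : Ω → ℕ} {r : ℝ≥0}
    (hD : HasLaw D (poissonMeasure r) P) (φ : ℂ) :
    ∫ ω, φ ^ D ω ∂P = Complex.exp (r * (φ - 1)) := by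
  have h := hD.integral_comp (f := fun n : ℕ => φ ^ n) (by fun_prop)
  have h' : ∫ ω, φ ^ D ω ∂P = ∫ n, φ ^ n ∂(poissonMeasure r) := h
  rw [h', integral_poissonMeasure]
  calc _ = ∑' n : ℕ, (Real.exp (-r) : ℂ) * ((r * φ) ^ n / n.factorial) := by
        congr with n
        rw [Complex.real_smul]
        push_cast
        ring
    _ = (Real.exp (-r) : ℂ) * ∑' n : ℕ, ((r * φ) ^ n / n.factorial) := tsum_mul_left
    _ = _ := by
        rw [(NormedSpace.expSeries_div_hasSum_exp (r * φ)).tsum_eq, ← Complex.exp_eq_exp_ℂ,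
          Complex.ofReal_exp, ← Complex.exp_add]
        push_cast
        ring_nf

variable [MeasurableSpace Θ] [DiscreteMeasurableSpace Θ]

/-- The product, over the blocks `[n l, n (l + 1))`, of the values of `z l` at the marks. -/
def blockProd (z : ℕ → Θ → ℂ) (k : ℕ) (n : ℕ → ℕ) (y : ℕ → Θ) : ℂ :=
  ∏ l ∈ Finset.range k, ∏ m ∈ Finset.Ico (n l) (n (l + 1)), z l (y m)

lemma measurable_blockProd (z : ℕ → Θ → ℂ) (k : ℕ) :
    Measurable fun q : (ℕ → ℕ) × (ℕ → Θ) => blockProd z k q.1 q.2 := by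
  unfold blockProd
  refine Finset.measurable_fun_prod _ fun l _ => ?_
  -- The end points of a block range over a countable set, so measurability may be checked for fixed
  -- end points.
  have h : Measurable fun q : (ℕ × ℕ) × (ℕ → Θ) =>
      ∏ m ∈ Finset.Ico q.1.1 q.1.2, z l (q.2 m) := by
    refine measurable_from_prod_countable_right fun c => ?_
    exact Finset.measurable_fun_prod (Finset.Ico c.1 c.2)
      (f := fun m (y : ℕ → Θ) => z l (y m)) fun m _ =>
      Measurable.of_discrete.comp (measurable_pi_apply m)
  have h' : Measurable fun q : (ℕ → ℕ) × (ℕ → Θ) => ((q.1 l, q.1 (l + 1)), q.2) := by fun_prop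
  exact h.comp h'

lemma norm_blockProd_le {Θ : Type*} {z : ℕ → Θ → ℂ} (hz : ∀ l θ, ‖z l θ‖ ≤ 1) (k : ℕ) (n : ℕ → ℕ)
    (y : ℕ → Θ) : ‖blockProd z k n y‖ ≤ 1 := by
  rw [blockProd, norm_prod]
  refine Finset.prod_le_one (fun _ _ => norm_nonneg _) fun l _ => ?_
  rw [norm_prod]
  exact Finset.prod_le_one (fun _ _ => norm_nonneg _) fun m _ => hz _ _

variable [Fintype Θ] [IsProbabilityMeasure P] {Y : ℕ → Ω → Θ} {p : Θ → ℝ}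

lemma integral_comp_mark (hYm : ∀ n, Measurable (Y n)) (hp : ∀ θ, 0 ≤ p θ)
    (hYp : ∀ n θ, P {ω | Y n ω = θ} = ENNReal.ofReal (p θ)) (n : ℕ) (z : Θ → ℂ) :
    ∫ ω, z (Y n ω) ∂P = ∑ θ, p θ * z θ := by
  rw [← integral_map (φ := Y n) (f := z) (hYm n).aemeasurable (by fun_prop),
    integral_fintype Integrable.of_finite]
  refine Finset.sum_congr rfl fun θ _ => ?_
  rw [Measure.real, Measure.map_apply (hYm n) (measurableSet_singleton θ), Complex.real_smul]
  have : Y n ⁻¹' {θ} = {ω | Y n ω = θ} := rfl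
  rw [this, hYp, ENNReal.toReal_ofReal (hp θ)]

/-- With deterministic end points the blocks are disjoint, so each mark occurs at most once and the
expectation factors. -/
lemma integral_blockProd_const (hYm : ∀ n, Measurable (Y n)) (hp : ∀ θ, 0 ≤ p θ)
    (hYp : ∀ n θ, P {ω | Y n ω = θ} = ENNReal.ofReal (p θ)) (hYi : iIndepFun Y P)
    (z : ℕ → Θ → ℂ) (k : ℕ) {n : ℕ → ℕ} (hn : Monotone n) :
    ∫ ω, blockProd z k n (fun m => Y m ω) ∂P =
      ∏ l ∈ Finset.range k, (∑ θ, p θ * z l θ) ^ (n (l + 1) - n l) := by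
  -- All pairs (block, position in the block). Injectivity of the position is the disjointness of
  -- the blocks.
  let S := (l : Finset.range k) × Finset.Ico (n l) (n (l + 1))
  have hinj : Function.Injective fun i : S => (i.2 : ℕ) := by
    rintro ⟨⟨a, ha⟩, b, hb⟩ ⟨⟨c, hc⟩, d, hd⟩ h
    simp only at h
    subst h
    simp only [Finset.mem_Ico] at hb hd
    have hac : a = c := by
      by_contra hne
      rcases lt_or_gt_of_ne hne with hlt | hlt
      · have := hn (Nat.succ_le_of_lt hlt); simp only [Nat.succ_eq_add_one] at this; omega
      · have := hn (Nat.succ_le_of_lt hlt); simp only [Nat.succ_eq_add_one] at this; omega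
    subst hac
    rfl
  have hS := (hYi.precomp hinj).integral_fun_prod_comp (f := fun i : S => z i.1)
    (fun i => (hYm _).aemeasurable) (fun i => by fun_prop)
  have h1 : ∀ (f : ℕ → ℕ → ℂ), ∏ l ∈ Finset.range k, ∏ m ∈ Finset.Ico (n l) (n (l + 1)), f l m
      = ∏ i : S, f i.1 i.2 := by
    intro f
    rw [Fintype.prod_sigma, ← Finset.prod_coe_sort]
    refine Finset.prod_congr rfl fun l _ => ?_
    rw [← Finset.prod_coe_sort]
  unfold blockProd
  simp_rw [h1]
  refine hS.trans ?_
  refine (Finset.prod_congr rfl fun i _ => integral_comp_mark hYm hp hYp _ _).trans ?_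
  rw [← h1 (fun l _ => ∑ θ, p θ * z l θ)]
  simp

/-- The counts are independent of the marks, so Fubini allows them to be frozen while the marks are
integrated out. -/
lemma integral_blockProd_of_indepFun (hYm : ∀ n, Measurable (Y n)) (hp : ∀ θ, 0 ≤ p θ)
    (hYp : ∀ n θ, P {ω | Y n ω = θ} = ENNReal.ofReal (p θ)) (hYi : iIndepFun Y P)
    {z : ℕ → Θ → ℂ} (hz : ∀ l θ, ‖z l θ‖ ≤ 1) (k : ℕ) {M : ℕ → Ω → ℕ}
    (hMm : ∀ l, Measurable (M l)) (hM : ∀ᵐ ω ∂P, Monotone fun l => M l ω)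
    (hMY : IndepFun (fun ω l => M l ω) (fun ω m => Y m ω) P) :
    ∫ ω, blockProd z k (fun l => M l ω) (fun m => Y m ω) ∂P =
      ∫ ω, ∏ l ∈ Finset.range k, (∑ θ, p θ * z l θ) ^ (M (l + 1) ω - M l ω) ∂P := by
  have hM' : Measurable fun ω l => M l ω := measurable_pi_lambda _ hMm
  have hY' : Measurable fun ω m => Y m ω := measurable_pi_lambda _ hYm
  have := Measure.isProbabilityMeasure_map (μ := P) hM'.aemeasurable
  have := Measure.isProbabilityMeasure_map (μ := P) hY'.aemeasurable
  have hmeas := measurable_blockProd z k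
  have h1 : ∫ ω, blockProd z k (fun l => M l ω) (fun m => Y m ω) ∂P
      = ∫ q, blockProd z k q.1 q.2 ∂((P.map fun ω l => M l ω).prod (P.map fun ω m => Y m ω)) := by
    rw [← (indepFun_iff_map_prod_eq_prod_map_map hM'.aemeasurable hY'.aemeasurable).1 hMY,
      integral_map (hM'.prodMk hY').aemeasurable hmeas.aestronglyMeasurable]
  rw [h1, integral_prod _ (Integrable.of_bound hmeas.aestronglyMeasurable 1
    (ae_of_all _ fun q => norm_blockProd_le hz k _ _)),
    integral_map hM'.aemeasurable
      hmeas.stronglyMeasurable.integral_prod_right'.aestronglyMeasurable]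
  refine integral_congr_ae ?_
  filter_upwards [hM] with ω hω
  refine (integral_map hY'.aemeasurable
    (hmeas.comp measurable_prodMk_left).aestronglyMeasurable).trans ?_
  exact integral_blockProd_const hYm hp hYp hYi z k hω

/-- Once the marks are integrated out, what remains is a product of powers of independent Poisson
increments, that is, of Poisson generating functions. -/
theorem integral_blockProd_poisson (hYm : ∀ n, Measurable (Y n)) (hp : ∀ θ, 0 ≤ p θ)
    (hYp : ∀ n θ, P {ω | Y n ω = θ} = ENNReal.ofReal (p θ)) (hYi : iIndepFun Y P)
    {z : ℕ → Θ → ℂ} (hz : ∀ l θ, ‖z l θ‖ ≤ 1) (k : ℕ) {N : ℝ≥0 → Ω → ℕ} {r : ℝ}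
    (hN : IsPoissonProcess N r P) (hNY : IndepFun (fun ω t => N t ω) (fun ω m => Y m ω) P)
    {t : ℕ → ℝ≥0} (ht : Monotone t) :
    ∫ ω, blockProd z k (fun l => N (t l) ω) (fun m => Y m ω) ∂P =
      ∏ l ∈ Finset.range k,
        Complex.exp (r * (t (l + 1) - t l : ℝ) * (∑ θ, p θ * z l θ - 1)) := by
  rw [integral_blockProd_of_indepFun hYm hp hYp hYi hz k (fun l => hN.measurable (t l)) ?_ ?_]
  · have hi := (hN.indep.nat ht).precomp (g := fun l : Fin k => (l : ℕ)) Fin.val_injective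
    have h2 := hi.integral_fun_prod_comp
      (f := fun (l : Fin k) (d : ℕ) => (∑ θ, p θ * z l θ) ^ d)
      (fun l => ((hN.measurable _).sub (hN.measurable _)).aemeasurable)
      (fun l => by fun_prop)
    simp_rw [Finset.prod_range]
    refine h2.trans (Finset.prod_congr rfl fun l _ => ?_)
    rw [integral_pow_of_hasLaw_poissonMeasure (hN.law _ _ (ht (Nat.le_succ l)))]
    congr 2
    have h3 : ((t (l + 1) - t l : ℝ≥0) : ℝ) = t (l + 1) - t l :=
      NNReal.coe_sub (ht (Nat.le_succ l))
    rw [NNReal.coe_mul, h3, Real.coe_toNNReal _ hN.rate_nonneg]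
    push_cast
    ring
  · filter_upwards [hN.mono] with ω hω using fun a b hab => hω (ht hab)
  · exact hNY.comp (φ := fun x l => x (t l)) (ψ := id)
      (measurable_pi_lambda _ fun l => measurable_pi_apply _) measurable_id

end Marking

/-! ### Independence structure of the primitives -/

namespace Primitives

variable {I J K Θ Ω : Type*} {X : Primitives I J Θ Ω}

/-- The σ-algebra generated by the requests of a demand point and their types. -/
@[reducible] def demandSigma (X : Primitives I J Θ Ω) (i : I) : MeasurableSpace Ω :=
  X.sigma (.inl i) ⊔ ⨆ n, X.sigma (.inr (.inl (i, n)))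

/-- The σ-algebra generated by the service times of a queue. -/
@[reducible] def serviceSigma (X : Primitives I J Θ Ω) (j : J) (θ : Θ) : MeasurableSpace Ω :=
  ⨆ m, X.sigma (.inr (.inr (j, θ, m)))

lemma measurable_req_demandSigma (i : I) (t : ℝ≥0) :
    Measurable[X.demandSigma i] (X.req i t) := by
  have h : Measurable[X.sigma (.inl i)] (fun ω t => X.req i t ω) := comap_measurable _
  exact ((measurable_pi_apply t).comp h).mono le_sup_left le_rfl

lemma measurable_type_demandSigma (i : I) (n : ℕ) :
    @Measurable _ _ (X.demandSigma i) ⊤ (X.type i n) := by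
  have h : @Measurable _ _ (X.sigma (.inr (.inl (i, n)))) ⊤ (X.type i n) := comap_measurable _
  exact h.mono ((le_iSup (fun n => X.sigma (.inr (.inl (i, n)))) n).trans le_sup_right) le_rfl

lemma measurable_service_serviceSigma (j : J) (θ : Θ) (m : ℕ) :
    Measurable[X.serviceSigma j θ] (X.service j θ m) := by
  have h : Measurable[X.sigma (.inr (.inr (j, θ, m)))] (X.service j θ m) := comap_measurable _
  exact h.mono (le_iSup (fun n => X.sigma (.inr (.inr (j, θ, n)))) m) le_rfl

lemma measurable_type_of_forall [Fintype Θ] {m : MeasurableSpace Ω} {i : I} {n : ℕ}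
    (h : ∀ θ, MeasurableSet[m] {ω | X.type i n ω = θ}) :
    @Measurable _ _ m ⊤ (X.type i n) := by
  let _ : MeasurableSpace Θ := ⊤
  have : DiscreteMeasurableSpace Θ := ⟨fun _ => trivial⟩
  exact measurable_to_countable' h

/-- The σ-algebra is left free because the statement is used both for the ambient one and for the
one generated by the demands, where it yields independence of the service times. -/
lemma measurable_typeCount_of_forall [Fintype I] [Fintype Θ]
    {C : Network I J K Θ} {m : MeasurableSpace Ω} {j : J}
    (hr : ∀ i, C.edge i = j → ∀ t, Measurable[m] (X.req i t))
    (ht : ∀ i, C.edge i = j → ∀ n, @Measurable _ _ m ⊤ (X.type i n))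
    (θ : Θ) (t : ℝ≥0) : Measurable[m] (X.typeCount C j θ t) := by
  classical
  unfold typeCount
  refine Finset.measurable_fun_sum _ fun i hi => ?_
  have hi : C.edge i = j := (Finset.mem_filter.1 hi).2
  have h1 : ∀ k : ℕ, Measurable[m] fun ω =>
      ((Finset.range k).filter fun n => X.type i n ω = θ).card := by
    intro k
    simp_rw [Finset.card_filter]
    refine Finset.measurable_fun_sum _ fun n _ => ?_
    refine Measurable.ite ?_ measurable_const measurable_const
    exact ht i hi n (t := {θ}) trivial
  have h2 : Measurable fun q : ℕ × Ω =>
      ((Finset.range q.1).filter fun n => X.type i n q.2 = θ).card :=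
    measurable_from_prod_countable_right h1
  convert! h2.comp ((hr i hi t).prodMk measurable_id)

variable [Fintype Θ] [MeasurableSpace Ω] {P : Measure Ω} {C : Network I J K Θ}

lemma Satisfies.sigma_le [IsProbabilityMeasure P] (hX : X.Satisfies C P) (a) :
    X.sigma a ≤ ‹MeasurableSpace Ω› := by
  rcases a with i | ⟨i, n⟩ | ⟨j, θ, m⟩
  · exact (measurable_pi_lambda _ (hX.req_poisson i).measurable).comap_le
  · exact (measurable_type_of_forall (hX.type_measurable i n)).comap_le
  · exact (hX.service_measurable j θ m).comap_le

/-- The primitives are grouped by owner: a demand point owns its request process and its types, a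
queue its service times. -/
lemma iIndep_demandSigma_serviceSigma [IsProbabilityMeasure P] (hX : X.Satisfies C P) :
    iIndep (Sum.elim X.demandSigma fun q : J × Θ => X.serviceSigma q.1 q.2) P := by
  refine iIndep_of_iIndep_of_le (iIndep_iSup_fiber hX.sigma_le hX.indep
    (β := I ⊕ (J × Θ)) (fun a => Sum.elim .inl (Sum.elim (fun q => .inl q.1)
      fun q => .inr (q.1, q.2.1)) a)) ?_
  rintro (i | ⟨j, θ⟩)
  · refine sup_le (le_iSup₂_of_le (.inl i) rfl le_rfl) (iSup_le fun n => ?_)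
    exact le_iSup₂_of_le (.inr (.inl (i, n))) rfl le_rfl
  · exact iSup_le fun m => le_iSup₂_of_le (.inr (.inr (j, θ, m))) rfl le_rfl

lemma demandSigma_le [IsProbabilityMeasure P] (hX : X.Satisfies C P) (i : I) :
    X.demandSigma i ≤ ‹MeasurableSpace Ω› :=
  sup_le (hX.sigma_le _) (iSup_le fun _ => hX.sigma_le _)

lemma serviceSigma_le [IsProbabilityMeasure P] (hX : X.Satisfies C P) (j : J) (θ : Θ) :
    X.serviceSigma j θ ≤ ‹MeasurableSpace Ω› :=
  iSup_le fun _ => hX.sigma_le _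

lemma iIndepFun_type [IsProbabilityMeasure P] (hX : X.Satisfies C P) (i : I) :
    @iIndepFun _ _ _ _ (fun _ => ⊤) (X.type i) P :=
  let _ : MeasurableSpace Θ := ⊤
  (iIndepFun_iff_iIndep _ _ _).2 (hX.indep.precomp
    (g := fun n : ℕ => (.inr (.inl (i, n)) : I ⊕ (I × ℕ) ⊕ (J × Θ × ℕ)))
    fun a b h => by simpa using h)

lemma indepFun_req_type [IsProbabilityMeasure P] (hX : X.Satisfies C P) (i : I) :
    let _ : MeasurableSpace Θ := ⊤
    IndepFun (fun ω t => X.req i t ω) (fun ω n => X.type i n ω) P := by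
  intro _
  have h := indep_iSup_of_disjoint hX.sigma_le hX.indep (S := {.inl i})
    (T := Set.range fun n => .inr (.inl (i, n))) (by simp)
  rw [IndepFun_iff_Indep]
  refine indep_of_indep_of_le h ?_ ?_
  · simp
  · rw [iSup_range]
    refine Measurable.comap_le ?_
    refine @measurable_pi_lambda _ _ _ (⨆ n, X.sigma (.inr (.inl (i, n)))) _ _ fun n => ?_
    have h : @Measurable _ _ (X.sigma (.inr (.inl (i, n)))) ⊤ (X.type i n) := comap_measurable _
    exact h.mono (le_iSup (fun n => X.sigma (.inr (.inl (i, n)))) n) le_rfl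

variable [Fintype I]

lemma measurable_typeCount [IsProbabilityMeasure P] (hX : X.Satisfies C P) (j : J) (θ : Θ)
    (t : ℝ≥0) : Measurable (X.typeCount C j θ t) :=
  measurable_typeCount_of_forall (fun i _ => (hX.req_poisson i).measurable)
    (fun i _ n => measurable_type_of_forall (hX.type_measurable i n)) θ t

lemma ae_req [IsProbabilityMeasure P] (hX : X.Satisfies C P) :
    ∀ᵐ ω ∂P, ∀ i, X.req i 0 ω = 0 ∧ (Monotone fun t => X.req i t ω) ∧
      ∀ t, ∀ᶠ s in 𝓝[≥] t, X.req i s ω = X.req i t ω := by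
  refine ae_all_iff.2 fun i => ?_
  filter_upwards [(hX.req_poisson i).start, (hX.req_poisson i).mono,
    (hX.req_poisson i).rightCont] with ω h1 h2 h3
  refine ⟨h1, h2, fun t => ?_⟩
  exact (h3 t).eventually_mem (mem_nhds_discrete.2 (Set.mem_singleton _))

/-- Almost all paths of the arrival counts start at `0`, are nondecreasing and are locally
constant to the right. -/
lemma ae_typeCount [IsProbabilityMeasure P] (hX : X.Satisfies C P) (j : J) :
    ∀ᵐ ω ∂P, ∀ θ, X.typeCount C j θ 0 ω = 0 ∧ (Monotone fun t => X.typeCount C j θ t ω) ∧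
      ∀ t, ∀ᶠ s in 𝓝[≥] t, X.typeCount C j θ s ω = X.typeCount C j θ t ω := by
  classical
  filter_upwards [ae_req hX] with ω hω θ
  refine ⟨?_, fun s t hst => ?_, fun t => ?_⟩
  · simp [typeCount, (hω _).1]
  · refine Finset.sum_le_sum fun i _ => Finset.card_le_card fun n hn => ?_
    rw [Finset.mem_filter, Finset.mem_range] at hn ⊢
    exact ⟨hn.1.trans_le ((hω i).2.1 hst), hn.2⟩
  · filter_upwards [eventually_all.2 fun i => (hω i).2.2 t] with s hs
    simp only [typeCount, hs]

omit [MeasurableSpace Ω] in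
open Classical in
-- Both sides multiply `z l (type)` over the requests reaching `j` in cell `l`; the left sorts them
-- by type, the right by demand point.
lemma prod_cexp_pow_typeCount_sub {j : J} {ω : Ω} (hω : ∀ i, Monotone fun t => X.req i t ω)
    {t : ℕ → ℝ≥0} (ht : Monotone t) (z : ℕ → Θ → ℂ) (k : ℕ) :
    ∏ l ∈ Finset.range k, ∏ θ,
        z l θ ^ (X.typeCount C j θ (t (l + 1)) ω - X.typeCount C j θ (t l) ω)
      = ∏ i, if C.edge i = j then
          blockProd z k (fun l => X.req i (t l) ω) (fun m => X.type i m ω) else 1 := by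
  rw [← Finset.prod_filter]
  unfold blockProd
  refine Eq.trans ?_ Finset.prod_comm
  refine Finset.prod_congr rfl fun l _ => ?_
  have h1 : ∀ i, ∏ m ∈ Finset.Ico (X.req i (t l) ω) (X.req i (t (l + 1)) ω), z l (X.type i m ω)
      = ∏ θ, z l θ ^ ((Finset.Ico (X.req i (t l) ω) (X.req i (t (l + 1)) ω)).filter
        fun n => X.type i n ω = θ).card := by
    intro i
    rw [← Finset.prod_fiberwise' _ (fun m => X.type i m ω) (z l)]
    simp
  simp_rw [h1]
  refine Eq.trans ?_ Finset.prod_comm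
  refine Finset.prod_congr rfl fun θ _ => ?_
  rw [Finset.prod_pow_eq_pow_sum]
  congr 1
  rw [Nat.sub_eq_iff_eq_add]
  · simp only [typeCount]
    rw [← Finset.sum_add_distrib]
    refine Finset.sum_congr rfl fun i _ => ?_
    have hle := hω i (ht (Nat.le_succ l))
    rw [← Finset.card_union_of_disjoint, ← Finset.filter_union]
    · congr 2
      ext n
      have : X.req i (t l) ω ≤ X.req i (t (l + 1)) ω := hle
      simp only [Finset.mem_union, Finset.mem_Ico, Finset.mem_range]
      omega
    · refine Finset.disjoint_filter_filter ?_
      rw [Finset.disjoint_left]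
      intro n hn
      simp only [Finset.mem_Ico, Finset.mem_range] at hn ⊢
      omega
  · refine Finset.sum_le_sum fun i _ => Finset.card_le_card ?_
    exact Finset.filter_subset_filter _ (Finset.range_mono (hω i (ht (Nat.le_succ l))))

/-- Thinning and superposition at once. The demand points are independent, so the expectation
factors over them, and the Poisson exponents add up. That the result factors over cells and types is
what makes the increments independent. -/
theorem integral_prod_pow_typeCount_sub [IsProbabilityMeasure P] (hX : X.Satisfies C P) (j : J)
    {t : ℕ → ℝ≥0} (ht : Monotone t) {z : ℕ → Θ → ℂ} (hz : ∀ l θ, ‖z l θ‖ ≤ 1) (k : ℕ) :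
    ∫ ω, ∏ l ∈ Finset.range k, ∏ θ,
        z l θ ^ (X.typeCount C j θ (t (l + 1)) ω - X.typeCount C j θ (t l) ω) ∂P
      = ∏ l ∈ Finset.range k, ∏ θ,
        Complex.exp (C.typeRate j θ * (t (l + 1) - t l : ℝ) * (z l θ - 1)) := by
  classical
  let _ : MeasurableSpace Θ := ⊤
  have : DiscreteMeasurableSpace Θ := ⟨fun _ => trivial⟩
  have h1 : ∫ ω, ∏ l ∈ Finset.range k, ∏ θ,
        z l θ ^ (X.typeCount C j θ (t (l + 1)) ω - X.typeCount C j θ (t l) ω) ∂P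
      = ∫ ω, ∏ i, (if C.edge i = j then
          blockProd z k (fun l => X.req i (t l) ω) (fun m => X.type i m ω) else 1) ∂P := by
    refine integral_congr_ae ?_
    filter_upwards [ae_req hX] with ω hω
    convert prod_cexp_pow_typeCount_sub (fun i => (hω i).2.1) ht z k
  set G : I → Ω → ℂ := fun i ω => if C.edge i = j then
    blockProd z k (fun l => X.req i (t l) ω) (fun m => X.type i m ω) else 1 with hG
  have hGm : ∀ i, Measurable[X.demandSigma i] (G i) := by
    intro i
    by_cases hi : C.edge i = j
    · simp only [hG, hi, if_true]
      refine (measurable_blockProd z k).comp (Measurable.prodMk ?_ ?_)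
      · exact @measurable_pi_lambda _ _ _ (X.demandSigma i) _ _
          fun l => measurable_req_demandSigma i _
      · exact @measurable_pi_lambda _ _ _ (X.demandSigma i) _ _
          fun m => measurable_type_demandSigma i _
    · simp only [hG, hi, if_false]
      exact measurable_const
  have hGi : iIndepFun G P := by
    refine iIndep_of_iIndep_of_le ((iIndep_demandSigma_serviceSigma hX).precomp
      (g := Sum.inl) Sum.inl_injective) fun i => ?_
    exact (hGm i).comap_le
  rw [h1, hGi.integral_fun_prod_eq_prod_integral fun i =>
    ((hGm i).mono (demandSigma_le hX i) le_rfl).aestronglyMeasurable]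
  have h2 : ∀ i, ∫ ω, G i ω ∂P = if C.edge i = j then ∏ l ∈ Finset.range k,
      Complex.exp (C.ξ i * (t (l + 1) - t l : ℝ) * (∑ θ, C.p i θ * z l θ - 1)) else 1 := by
    intro i
    by_cases hi : C.edge i = j
    · simp only [hG, hi, if_true]
      exact integral_blockProd_poisson
        (fun n => measurable_type_of_forall (hX.type_measurable i n))
        (fun θ => (C.p_mem i θ).1) (hX.type_law i) (iIndepFun_type hX i) hz k
        (hX.req_poisson i) (indepFun_req_type hX i) ht
    · simp [hG, hi]
  simp_rw [h2]
  rw [← Finset.prod_filter]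
  refine Finset.prod_comm.trans ?_
  refine Finset.prod_congr rfl fun l _ => ?_
  rw [← Complex.exp_sum, ← Complex.exp_sum]
  congr 1
  -- Writing `1` as the sum of the type probabilities splits the exponent by type.
  have h3 : ∀ i, (∑ θ, C.p i θ * z l θ - 1 : ℂ) = ∑ θ, (C.p i θ : ℂ) * (z l θ - 1) := by
    intro i
    have : (1 : ℂ) = ∑ θ, (C.p i θ : ℂ) := by exact_mod_cast (C.p_sum i).symm
    simp_rw [mul_sub, Finset.sum_sub_distrib, mul_one, ← this]
  simp_rw [h3, Network.typeRate]
  push_cast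
  simp_rw [Finset.mul_sum, Finset.sum_mul]
  refine Finset.sum_comm.trans ?_
  refine Finset.sum_congr rfl fun θ _ => ?_
  convert rfl using 2
  ring

end Primitives

/-! ### The arrival processes of the different types -/

lemma charFun_map_toLp {Ω ι : Type*} [MeasurableSpace Ω] {P : Measure Ω} [Fintype ι]
    {D : Ω → ι → ℝ} (hD : Measurable D) (u : EuclideanSpace ℝ ι) :
    charFun ((P.map D).map (WithLp.toLp 2)) u
      = ∫ ω, ∏ i, Complex.exp (D ω i * (u i * Complex.I)) ∂P := by
  have h : Continuous fun x : EuclideanSpace ℝ ι => Complex.exp (inner ℝ x u * Complex.I) := by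
    fun_prop
  rw [charFun_apply, integral_map (WithLp.measurable_toLp 2 _).aemeasurable
    h.aestronglyMeasurable]
  refine (integral_map hD.aemeasurable
    (h.measurable.comp (WithLp.measurable_toLp 2 _)).aestronglyMeasurable).trans ?_
  refine integral_congr_ae (ae_of_all _ fun ω => ?_)
  simp only [PiLp.inner_apply, Function.comp_apply]
  rw [← Complex.exp_sum]
  push_cast
  rw [Finset.sum_mul]
  congr 1
  refine Finset.sum_congr rfl fun i _ => ?_
  simp
  ring

namespace Primitives

variable {I J K Θ Ω : Type*} [Fintype I] [Fintype Θ] [MeasurableSpace Ω]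
  {P : Measure Ω} [IsProbabilityMeasure P] {C : Network I J K Θ} {X : Primitives I J Θ Ω}

lemma typeRate_nonneg (C : Network I J K Θ) (j : J) (θ : Θ) : 0 ≤ C.typeRate j θ :=
  Finset.sum_nonneg fun i _ => mul_nonneg (C.ξ_pos i).le (C.p_mem i θ).1

/-- At `z = exp (i u)` the generating function is the joint characteristic function, which
determines the law. The counts are cast to `ℝ` for this purpose only. -/
lemma map_typeCount_sub_eq_pi (hX : X.Satisfies C P) (j : J) {t : ℕ → ℝ≥0} (ht : Monotone t)
    (k : ℕ) :
    P.map (fun ω (q : Fin k × Θ) =>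
        ((X.typeCount C j q.2 (t (q.1 + 1)) ω - X.typeCount C j q.2 (t q.1) ω : ℕ) : ℝ))
      = Measure.pi fun q : Fin k × Θ =>
        (poissonMeasure ((C.typeRate j q.2).toNNReal * (t (q.1 + 1) - t q.1))).map
          (Nat.cast : ℕ → ℝ) := by
  classical
  have hm : Measurable (fun ω (q : Fin k × Θ) =>
      ((X.typeCount C j q.2 (t (q.1 + 1)) ω - X.typeCount C j q.2 (t q.1) ω : ℕ) : ℝ)) :=
    measurable_pi_lambda _ fun q => measurable_from_nat.comp
      ((measurable_typeCount hX j _ _).sub (measurable_typeCount hX j _ _))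
  have := Measure.isProbabilityMeasure_map (μ := P) hm.aemeasurable
  have hpr : ∀ q : Fin k × Θ, IsProbabilityMeasure
      ((poissonMeasure ((C.typeRate j q.2).toNNReal * (t (q.1 + 1) - t q.1))).map
          (Nat.cast : ℕ → ℝ)) := fun q =>
    Measure.isProbabilityMeasure_map measurable_from_nat.aemeasurable
  rw [← charFun_eq_pi_iff]
  intro u
  rw [charFun_map_toLp hm]
  simp_rw [charFun_map_cast_poissonMeasure]
  -- The generating function is indexed by all of `ℕ`; beyond the `k` cells the value `1` is a
  -- filler.
  set z : ℕ → Θ → ℂ := fun l θ =>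
    if h : l < k then Complex.exp (u (⟨l, h⟩, θ) * Complex.I) else 1 with hz
  have hz1 : ∀ l θ, ‖z l θ‖ ≤ 1 := by
    intro l θ
    simp only [hz]
    split_ifs
    · exact (Complex.norm_exp_ofReal_mul_I _).le
    · simp
  have key := integral_prod_pow_typeCount_sub hX j ht hz1 k
  simp_rw [Finset.prod_range] at key
  have hzf : ∀ (l : Fin k) θ, z l θ = Complex.exp (u (l, θ) * Complex.I) := by
    intro l θ; simp [hz]
  simp_rw [hzf] at key
  rw [Fintype.prod_prod_type]
  refine Eq.trans ?_ (key.trans ?_)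
  · refine integral_congr_ae (ae_of_all _ fun ω => ?_)
    simp only
    rw [Fintype.prod_prod_type]
    simp_rw [← Complex.exp_nat_mul, Complex.ofReal_natCast]
  · refine Finset.prod_congr rfl fun l _ => Finset.prod_congr rfl fun θ _ => ?_
    congr 2
    have h3 : ((t (l + 1) - t l : ℝ≥0) : ℝ) = t (l + 1) - t l :=
      NNReal.coe_sub (ht (Nat.le_succ l))
    rw [← Complex.ofReal_mul]
    have : ((((C.typeRate j θ).toNNReal * (t (l + 1) - t l) : ℝ≥0) : ℝ))
        = C.typeRate j θ * (t (l + 1) - t l : ℝ) := by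
      rw [NNReal.coe_mul, h3, Real.coe_toNNReal _ (typeRate_nonneg C j θ)]
    rw [← this]

lemma hasLaw_typeCount_sub_fin (hX : X.Satisfies C P) (j : J) {t : ℕ → ℝ≥0} (ht : Monotone t)
    (k : ℕ) (q : Fin k × Θ) :
    HasLaw (fun ω => X.typeCount C j q.2 (t (q.1 + 1)) ω - X.typeCount C j q.2 (t q.1) ω)
      (poissonMeasure ((C.typeRate j q.2).toNNReal * (t (q.1 + 1) - t q.1))) P := by
  have hm : ∀ q : Fin k × Θ, Measurable fun ω =>
      X.typeCount C j q.2 (t (q.1 + 1)) ω - X.typeCount C j q.2 (t q.1) ω := fun q =>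
    (measurable_typeCount hX j _ _).sub (measurable_typeCount hX j _ _)
  have hpr : ∀ q : Fin k × Θ, IsProbabilityMeasure
      ((poissonMeasure ((C.typeRate j q.2).toNNReal * (t (q.1 + 1) - t q.1))).map
          (Nat.cast : ℕ → ℝ)) := fun q =>
    Measure.isProbabilityMeasure_map measurable_from_nat.aemeasurable
  have hmc : ∀ q : Fin k × Θ, Measurable fun ω =>
      ((X.typeCount C j q.2 (t (q.1 + 1)) ω - X.typeCount C j q.2 (t q.1) ω : ℕ) : ℝ) :=
    fun q => measurable_from_nat.comp (hm q)
  refine ⟨(hm q).aemeasurable, ?_⟩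
  have h := congrArg (Measure.map fun x => x q) (map_typeCount_sub_eq_pi hX j ht k)
  rw [(measurePreserving_eval _ q).map_eq, Measure.map_map (by fun_prop)
    (measurable_pi_lambda _ hmc)] at h
  change P.map ((Nat.cast : ℕ → ℝ) ∘ fun ω =>
      X.typeCount C j q.2 (t (q.1 + 1)) ω - X.typeCount C j q.2 (t q.1) ω) = _ at h
  rw [← Measure.map_map measurable_from_nat (hm q)] at h
  -- The floor undoes the cast and brings the law back to `ℕ`.
  have h3 := congrArg (Measure.map (Nat.floor : ℝ → ℕ)) h
  rw [Measure.map_map (by fun_prop) measurable_from_nat,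
    Measure.map_map (by fun_prop) measurable_from_nat] at h3
  have h4 : (Nat.floor ∘ (Nat.cast : ℕ → ℝ)) = id := by ext n; simp
  rw [h4, Measure.map_id, Measure.map_id] at h3
  exact h3

lemma iIndepFun_typeCount_sub_fin (hX : X.Satisfies C P) (j : J) {t : ℕ → ℝ≥0} (ht : Monotone t)
    (k : ℕ) :
    iIndepFun (fun (q : Fin k × Θ) ω =>
      X.typeCount C j q.2 (t (q.1 + 1)) ω - X.typeCount C j q.2 (t q.1) ω) P := by
  have hm : ∀ q : Fin k × Θ, Measurable fun ω =>
      X.typeCount C j q.2 (t (q.1 + 1)) ω - X.typeCount C j q.2 (t q.1) ω := fun q =>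
    (measurable_typeCount hX j _ _).sub (measurable_typeCount hX j _ _)
  have h : iIndepFun (fun (q : Fin k × Θ) ω =>
      ((X.typeCount C j q.2 (t (q.1 + 1)) ω - X.typeCount C j q.2 (t q.1) ω : ℕ) : ℝ)) P := by
    have hmc : ∀ q : Fin k × Θ, Measurable fun ω =>
        ((X.typeCount C j q.2 (t (q.1 + 1)) ω - X.typeCount C j q.2 (t q.1) ω : ℕ) : ℝ) :=
      fun q => measurable_from_nat.comp (hm q)
    rw [iIndepFun_iff_map_fun_eq_pi_map fun q => (hmc q).aemeasurable,
      map_typeCount_sub_eq_pi hX j ht k]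
    congr with q : 1
    rw [← (hasLaw_typeCount_sub_fin hX j ht k q).map_eq,
      Measure.map_map measurable_from_nat (hm q)]
    rfl
  have h2 := h.comp (fun _ => (Nat.floor : ℝ → ℕ)) fun _ => by fun_prop
  convert h2 using 2 with q
  ext ω
  simp

/-- The increments of the arrival counts over the cells of a partition are independent. -/
theorem iIndepFun_typeCount_sub (hX : X.Satisfies C P) (j : J) {t : ℕ → ℝ≥0} (ht : Monotone t) :
    iIndepFun (fun (q : ℕ × Θ) ω =>
      X.typeCount C j q.2 (t (q.1 + 1)) ω - X.typeCount C j q.2 (t q.1) ω) P := by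
  refine iIndepFun_iff_finset.2 fun s => ?_
  set k := s.sup Prod.fst + 1 with hk
  have hs : ∀ q ∈ s, q.1 < k := fun q hq => Nat.lt_succ_of_le (Finset.le_sup (f := Prod.fst) hq)
  refine (iIndepFun_typeCount_sub_fin hX j ht k).precomp
    (g := fun q : s => ((⟨q.1.1, hs q.1 q.2⟩, q.1.2) : Fin k × Θ)) ?_
  rintro ⟨⟨a, b⟩, h⟩ ⟨⟨c, d⟩, h'⟩ hq
  simpa using hq

lemma hasLaw_typeCount_sub (hX : X.Satisfies C P) (j : J) (θ : Θ) {s t : ℝ≥0} (hst : s ≤ t) :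
    HasLaw (fun ω => X.typeCount C j θ t ω - X.typeCount C j θ s ω)
      (poissonMeasure ((C.typeRate j θ).toNNReal * (t - s))) P := by
  -- The partition `s, t, t, …`, whose cell number `0` is the interval in question.
  have hmono : Monotone fun n : ℕ => if n = 0 then s else t := by
    refine monotone_nat_of_le_succ fun n => ?_
    by_cases hn : n = 0 <;> simp [hn, hst]
  have h := hasLaw_typeCount_sub_fin hX j hmono 1 (0, θ)
  simpa using h

/-- The requests of a type arriving at an edge server form a Poisson process. -/
theorem isPoissonProcess_typeCount (hX : X.Satisfies C P) (j : J) (θ : Θ) :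
    IsPoissonProcess (X.typeCount C j θ) (C.typeRate j θ) P where
  rate_nonneg := typeRate_nonneg C j θ
  measurable := measurable_typeCount hX j θ
  start := (ae_typeCount hX j).mono fun ω h => (h θ).1
  mono := (ae_typeCount hX j).mono fun ω h => (h θ).2.1
  rightCont := (ae_typeCount hX j).mono fun ω h t =>
    tendsto_nhds_of_eventually_eq ((h θ).2.2 t)
  indep := hasIndepIncrements_iff_nat.2 fun t ht =>
    (iIndepFun_typeCount_sub hX j ht).precomp (g := fun l => (l, θ)) fun a b h => by simpa using h
  law s t hst := hasLaw_typeCount_sub hX j θ hst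

/-- Finitely many times become points of one partition starting at `0`, so the values of a path
there are sums of its increments over the first cells. -/
lemma exists_monotone_enum (F : Finset ℝ≥0) :
    ∃ t : ℕ → ℝ≥0, Monotone t ∧ t 0 = 0 ∧ ∀ x ∈ F, ∃ n, t n = x := by
  -- Strengthened for the induction: the points of `F` occur up to index `k` and nothing exceeds
  -- their maximum, so a new maximum can be appended from index `k + 1` on.
  suffices h : ∃ (t : ℕ → ℝ≥0) (k : ℕ), Monotone t ∧ t 0 = 0 ∧ (∀ x ∈ F, ∃ n ≤ k, t n = x) ∧
      (∀ n, t n ≤ F.sup id) by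
    obtain ⟨t, k, h1, h2, h3, -⟩ := h
    exact ⟨t, h1, h2, fun x hx => (h3 x hx).imp fun n hn => hn.2⟩
  induction F using Finset.induction_on_max with
  | empty => exact ⟨fun _ => 0, 0, monotone_const, rfl, by simp, by simp⟩
  | insert a F ha ih =>
    obtain ⟨t, k, h1, h2, h3, h4⟩ := ih
    have hle : ∀ n, t n ≤ a := fun n =>
      (h4 n).trans (Finset.sup_le fun x hx => (ha x hx).le)
    refine ⟨fun n => if n ≤ k then t n else a, k + 1, ?_, by simpa using h2, ?_, ?_⟩
    · intro m n hmn
      by_cases hn : n ≤ k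
      · simpa [hn, hmn.trans hn] using h1 hmn
      · by_cases hm : m ≤ k
        · simpa [hn, hm] using hle m
        · simp [hn, hm]
    · intro x hx
      rcases Finset.mem_insert.1 hx with rfl | hx
      · exact ⟨k + 1, le_rfl, by simp⟩
      · obtain ⟨n, hn, rfl⟩ := h3 x hx
        exact ⟨n, by omega, by simp [hn]⟩
    · intro n
      have : a ≤ (insert a F).sup id := Finset.le_sup (f := id) (Finset.mem_insert_self a F)
      simp only
      split_ifs
      exacts [(hle n).trans this, this]

/-- The arrival processes of the different types are independent. -/
theorem iIndepFun_typeCount (hX : X.Satisfies C P) (j : J) :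
    iIndepFun (fun θ ω t => X.typeCount C j θ t ω) P := by
  classical
  refine iIndepFun.iIndepFun_process (fun θ t => measurable_typeCount hX j θ t) fun A F => ?_
  -- A common partition for all types, even though each type has its own finite set of times.
  obtain ⟨t, htm, ht0, htF⟩ := exists_monotone_enum (A.attach.biUnion F)
  choose! n hn using htF
  have hD := iIndepFun_typeCount_sub hX j htm
  have hDm : ∀ q : ℕ × Θ, Measurable fun ω =>
      X.typeCount C j q.2 (t (q.1 + 1)) ω - X.typeCount C j q.2 (t q.1) ω := fun q =>
    (measurable_typeCount hX j _ _).sub (measurable_typeCount hX j _ _)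
  have hgrp := (iIndep_iSup_fiber (fun q => (hDm q).comap_le) hD.iIndep Prod.snd).precomp
    (g := fun a : A => (a : Θ)) Subtype.val_injective
  have hsum : iIndepFun (fun (a : A) ω (x : F a) => ∑ l ∈ Finset.range (n x),
      (X.typeCount C j a (t (l + 1)) ω - X.typeCount C j a (t l) ω)) P := by
    refine iIndep_of_iIndep_of_le hgrp fun a => Measurable.comap_le ?_
    refine @measurable_pi_lambda _ _ _ (_) _ _ fun x => ?_
    refine Finset.measurable_fun_sum _ fun l _ => ?_
    have h1 : Measurable[MeasurableSpace.comap (fun ω =>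
        X.typeCount C j (a : Θ) (t (l + 1)) ω - X.typeCount C j a (t l) ω) inferInstance]
        fun ω => X.typeCount C j a (t (l + 1)) ω - X.typeCount C j a (t l) ω :=
      comap_measurable _
    refine h1.mono ?_ le_rfl
    exact le_iSup₂_of_le (f := fun (q : ℕ × Θ) (_ : q ∈ {q | q.2 = (a : Θ)}) =>
      MeasurableSpace.comap (fun ω =>
        X.typeCount C j q.2 (t (q.1 + 1)) ω - X.typeCount C j q.2 (t q.1) ω) inferInstance)
      (l, (a : Θ)) rfl le_rfl
  refine (iIndepFun_congr fun a => ?_).1 hsum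
  filter_upwards [ae_typeCount hX j] with ω hω
  ext x
  obtain ⟨h0, hmono, -⟩ := hω a
  have hx : t (n x) = x := hn x (Finset.mem_biUnion.2 ⟨a, Finset.mem_attach _ _, x.2⟩)
  rw [Finset.sum_range_tsub fun a b hab => hmono (htm hab), ht0]
  show X.typeCount C j a (t (n x)) ω - X.typeCount C j a 0 ω = _
  rw [h0, hx, Nat.sub_zero]

omit [Fintype I] in
theorem indep_typeCount_service (hX : X.Satisfies C P) (j : J) :
    Indep (⨆ i, X.demandSigma i) (⨆ θ, X.serviceSigma j θ) P := by
  have h := indep_iSup_of_disjoint (S := Set.range Sum.inl)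
    (T := Set.range fun θ => Sum.inr (j, θ)) ?_ (iIndep_demandSigma_serviceSigma hX) ?_
  · simpa only [iSup_range, Sum.elim_inl, Sum.elim_inr] using h
  · rintro (i | ⟨j, θ⟩)
    exacts [demandSigma_le hX i, serviceSigma_le hX j θ]
  · rw [Set.disjoint_left]
    rintro _ ⟨i, rfl⟩ ⟨θ, h⟩
    cases h

omit [MeasurableSpace Ω] in
lemma measurable_typeCount_demandSigma (j : J) (θ : Θ) :
    Measurable[⨆ i, X.demandSigma i] fun ω t => X.typeCount C j θ t ω := by
  refine @measurable_pi_lambda _ _ _ (_) _ _ fun t => ?_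
  refine measurable_typeCount_of_forall (fun i _ t => ?_) (fun i _ n => ?_) θ t
  · exact (measurable_req_demandSigma i t).mono (le_iSup _ i) le_rfl
  · exact (measurable_type_demandSigma i n).mono (le_iSup _ i) le_rfl

omit [Fintype I] [Fintype Θ] [MeasurableSpace Ω] in
lemma measurable_service_pi (j : J) (θ : Θ) :
    Measurable[X.serviceSigma j θ] fun ω m => X.service j θ m ω :=
  @measurable_pi_lambda _ _ _ (_) _ _ fun m => measurable_service_serviceSigma j θ m

lemma indepFun_typeCount_service (hX : X.Satisfies C P) (j : J) :
    IndepFun (fun ω θ t => X.typeCount C j θ t ω) (fun ω θ m => X.service j θ m ω) P := by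
  refine indep_of_indep_of_le (indep_typeCount_service hX j) ?_ ?_
  · exact (@measurable_pi_lambda _ _ _ (_) _ _ fun θ =>
      measurable_typeCount_demandSigma j θ).comap_le
  · exact (@measurable_pi_lambda _ _ _ (_) _ _ fun θ =>
      (measurable_service_pi j θ).mono (le_iSup _ θ) le_rfl).comap_le

theorem isMM1_dsrQueue (hX : X.Satisfies C P) (j : J) (θ : Θ) :
    (X.dsrQueue C j θ).IsMM1 (C.typeRate j θ) (C.μ j θ) P where
  rate_pos := C.μ_pos j θ
  arrivals_poisson := isPoissonProcess_typeCount hX j θ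
  service_law n := hX.service_law j θ n
  service_indep := (iIndepFun_iff_iIndep _ _ _).2 (hX.indep.precomp
    (g := fun n : ℕ => (.inr (.inr (j, θ, n)) : I ⊕ (I × ℕ) ⊕ (J × Θ × ℕ)))
    fun a b h => by simpa using h)
  arrivals_indep_service := (indepFun_typeCount_service hX j).comp
    (measurable_pi_apply θ) (measurable_pi_apply θ)

/-- Arrivals are independent across types, service times are independent across types, and all
arrivals are independent of all service times; `iIndep_sup` joins the three facts. -/
theorem iIndepFun_input (hX : X.Satisfies C P) (j : J) :
    iIndepFun (fun θ => (X.dsrQueue C j θ).input) P := by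
  have hA : iIndep (fun θ => MeasurableSpace.comap (fun ω t => X.typeCount C j θ t ω)
    inferInstance) P := (iIndepFun_typeCount hX j).iIndep
  have hS : iIndep (fun θ => X.serviceSigma j θ) P :=
    (iIndep_demandSigma_serviceSigma hX).precomp (g := fun θ => Sum.inr (j, θ))
      fun a b h => by simpa using h
  have hle : ∀ θ, MeasurableSpace.comap (fun ω t => X.typeCount C j θ t ω) inferInstance
      ≤ ⨆ i, X.demandSigma i := fun θ => (measurable_typeCount_demandSigma j θ).comap_le
  refine iIndep_of_iIndep_of_le (iIndep_sup
    (fun θ => (hle θ).trans (iSup_le (demandSigma_le hX))) (serviceSigma_le hX j) hA hS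
    (indep_of_indep_of_le_left (indep_typeCount_service hX j) (iSup_le hle))) fun θ => ?_
  refine Measurable.comap_le ?_
  refine Measurable.prodMk ?_ ?_
  · exact (comap_measurable _).mono le_sup_left le_rfl
  · exact (measurable_service_pi j θ).mono le_sup_right le_rfl

end Primitives

/-! ### Paths of multivariate counting processes -/

/-- The paths of a multivariate counting process: started at `0`, nondecreasing, and locally
constant to the right. -/
structure IsJumpPath {Θ : Type*} (x : ℝ≥0 → Θ → ℕ) : Prop where
  zero : x 0 = 0
  mono : Monotone x
  right : ∀ t, ∀ᶠ s in 𝓝[≥] t, x s = x t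

/-- The space of paths of multivariate counting processes. -/
abbrev JumpPath (Θ : Type*) := {x : ℝ≥0 → Θ → ℕ // IsJumpPath x}

namespace JumpPath

variable {Θ : Type*}

lemma tendsto_add_left_nhdsGE (s t : ℝ≥0) :
    Tendsto (fun h => s + h) (𝓝[≥] t) (𝓝[≥] (s + t)) := by
  refine tendsto_nhdsWithin_iff.2 ⟨?_, ?_⟩
  · exact ((continuous_const.add continuous_id).tendsto t).mono_left nhdsWithin_le_nhds
  · filter_upwards [self_mem_nhdsWithin] with h hh
    exact add_le_add_right hh s

/-- The path after time `s`, started afresh. -/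
def shift (s : ℝ≥0) (x : JumpPath Θ) : JumpPath Θ :=
  ⟨fun h => x.1 (s + h) - x.1 s, by simp,
    fun a b hab => tsub_le_tsub_right (x.2.mono (add_le_add_right hab s)) _, fun t => by
      filter_upwards [(tendsto_add_left_nhdsGE s t).eventually (x.2.right (s + t))] with h hh
      rw [hh]⟩

lemma shift_apply (s h : ℝ≥0) (x : JumpPath Θ) : (shift s x).1 h = x.1 (s + h) - x.1 s := rfl

/-- The time of the first jump. -/
def jumpTime (x : JumpPath Θ) : ℝ≥0 := sInf {t | x.1 t ≠ 0}

/-- The path after the first jump. -/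
def next (x : JumpPath Θ) : JumpPath Θ := shift (jumpTime x) x

/-- The value of the path at its first jump. -/
def jump (x : JumpPath Θ) : Θ → ℕ := x.1 (jumpTime x)

/-- The infimum is attained: a path still at `0` at its first jump time would stay there a little
longer. Without a jump the infimum would be `0` by convention. -/
lemma eq_zero_iff {x : JumpPath Θ} (hx : ∃ t, x.1 t ≠ 0) {t : ℝ≥0} :
    x.1 t = 0 ↔ t < jumpTime x := by
  refine ⟨fun h => ?_, fun h => by_contra fun h' => notMem_of_lt_csInf h (OrderBot.bddBelow _) h'⟩
  by_contra hlt
  rw [not_lt] at hlt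
  have h0 : x.1 (jumpTime x) = 0 := le_antisymm (h ▸ x.2.mono hlt) (zero_le)
  have h1 : ∀ᶠ s in 𝓝[>] jumpTime x, x.1 s = 0 := by
    filter_upwards [nhdsWithin_mono _ Set.Ioi_subset_Ici_self (x.2.right (jumpTime x))] with s hs
    exact hs.trans h0
  obtain ⟨s, hs, hlt⟩ := (h1.and self_mem_nhdsWithin).exists
  refine absurd (le_csInf hx fun t ht => ?_ : s ≤ jumpTime x) (not_le.2 hlt)
  by_contra hts
  exact ht (le_antisymm (hs ▸ x.2.mono (not_le.1 hts).le) (zero_le))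

lemma exists_ne_zero_of_jump {x : JumpPath Θ} (h : jump x ≠ 0) : ∃ t, x.1 t ≠ 0 := ⟨_, h⟩

lemma jumpTime_pos {x : JumpPath Θ} (hx : ∃ t, x.1 t ≠ 0) : 0 < jumpTime x :=
  (eq_zero_iff hx).1 x.2.zero

/-! #### Measurability -/

section Measurability

variable [Fintype Θ] {α : Type*} [MeasurableSpace α]

omit [Fintype Θ] in
lemma measurable_eval (t : ℝ≥0) : Measurable fun x : JumpPath Θ => x.1 t :=
  (measurable_pi_apply t).comp measurable_subtype_coe

lemma measurableSet_eval_eq (t : ℝ≥0) (c : Θ → ℕ) :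
    MeasurableSet {x : JumpPath Θ | x.1 t = c} :=
  measurable_eval t (measurableSet_singleton c)

lemma measurable_jumpTime : Measurable (jumpTime : JumpPath Θ → ℝ≥0) := by
  refine measurable_of_Ioi fun u => ?_
  -- Paths without a jump have `jumpTime = 0` by convention and must be excluded; integer times
  -- suffice to detect a jump.
  have : jumpTime ⁻¹' Set.Ioi u
      = {x : JumpPath Θ | x.1 u = 0} ∩ ⋃ n : ℕ, {x : JumpPath Θ | x.1 n = 0}ᶜ := by
    ext x
    simp only [Set.mem_preimage, Set.mem_Ioi, Set.mem_inter_iff, Set.mem_ofPred_eq, Set.mem_iUnion,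
      Set.mem_compl_iff]
    by_cases hx : ∃ t, x.1 t ≠ 0
    · rw [eq_zero_iff hx]
      refine (and_iff_left ?_).symm
      obtain ⟨n, hn⟩ := exists_nat_ge (jumpTime x)
      exact ⟨n, by rw [eq_zero_iff hx]; exact not_lt.2 hn⟩
    · have h0 : jumpTime x = 0 := by
        have : {t | x.1 t ≠ 0} = ∅ := Set.eq_empty_of_forall_notMem fun t ht => hx ⟨t, ht⟩
        simp [jumpTime, this]
      rw [h0]
      refine ⟨fun h => absurd h (not_lt.2 (zero_le)), fun ⟨_, n, hn⟩ => absurd ⟨_, hn⟩ hx⟩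
  rw [this]
  exact (measurableSet_eval_eq u 0).inter
    (MeasurableSet.iUnion fun n => (measurableSet_eval_eq _ 0).compl)

lemma tendsto_grid (u t : ℝ≥0) :
    Tendsto (fun k : ℕ => u + (⌊t * (k + 1)⌋₊ + 1) / ((k : ℝ≥0) + 1)) atTop (𝓝[≥] (u + t)) := by
  refine (tendsto_add_left_nhdsGE u t).comp (tendsto_nhdsWithin_iff.2 ⟨?_, ?_⟩)
  · have h1 : Tendsto (fun k : ℕ => t + 1 / ((k : ℝ≥0) + 1)) atTop (𝓝 (t + 0)) :=
      tendsto_const_nhds.add tendsto_one_div_add_atTop_nhds_zero_nat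
    rw [add_zero] at h1
    refine tendsto_of_tendsto_of_tendsto_of_le_of_le tendsto_const_nhds h1 (fun k => ?_) fun k => ?_
    · rw [le_div_iff₀ (by positivity)]
      exact (Nat.lt_floor_add_one _).le
    · simp only
      rw [add_div]
      gcongr
      rw [div_le_iff₀ (by positivity)]
      exact Nat.floor_le (zero_le)
  · refine Eventually.of_forall fun k => ?_
    rw [Set.mem_Ici, le_div_iff₀ (by positivity)]
    exact (Nat.lt_floor_add_one _).le

/-- The random time is approximated from the right by times with countably many values; paths are
constant to the right, so the values agree from some index on. -/
lemma measurable_eval_comp {f : α → JumpPath Θ} (hf : Measurable f) {T : α → ℝ≥0}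
    (hT : Measurable T) : Measurable fun a => (f a).1 (T a) := by
  refine measurable_of_tendsto_metrizable
    (f := fun (k : ℕ) a => (f a).1 (0 + (⌊T a * (k + 1)⌋₊ + 1) / ((k : ℝ≥0) + 1))) (fun k => ?_) ?_
  · have h2 : Measurable fun q : ℕ × α => (f q.2).1 (0 + (q.1 + 1) / ((k : ℝ≥0) + 1)) :=
      measurable_from_prod_countable_right fun n =>
        (measurable_eval (0 + ((n : ℝ≥0) + 1) / ((k : ℝ≥0) + 1))).comp hf
    exact h2.comp ((Nat.measurable_floor.comp (hT.mul_const _)).prodMk measurable_id)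
  · refine tendsto_pi_nhds.2 fun a => ?_
    have h := tendsto_grid 0 (T a)
    rw [zero_add] at h
    exact tendsto_nhds_of_eventually_eq (h.eventually ((f a).2.right (T a)))

lemma measurable_shift_comp {f : α → JumpPath Θ} (hf : Measurable f) {T : α → ℝ≥0}
    (hT : Measurable T) : Measurable fun a => shift (T a) (f a) := by
  refine Measurable.subtype_mk (measurable_pi_lambda _ fun h => measurable_pi_lambda _ fun θ => ?_)
  have h1 := (measurable_pi_apply θ).comp (measurable_eval_comp hf (hT.add_const h))
  have h2 := (measurable_pi_apply θ).comp (measurable_eval_comp hf hT)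
  exact h1.sub h2

lemma measurable_next : Measurable (next : JumpPath Θ → JumpPath Θ) :=
  measurable_shift_comp measurable_id measurable_jumpTime

lemma measurable_jump : Measurable (jump : JumpPath Θ → Θ → ℕ) :=
  measurable_eval_comp measurable_id measurable_jumpTime

end Measurability

/-! #### Successive jumps -/

/-- The time of jump number `n`, where `0` is counted as the jump number `0`. -/
def jumpEpoch (x : JumpPath Θ) (n : ℕ) : ℝ≥0 :=
  ∑ k ∈ Finset.range n, jumpTime (next^[k] x)

lemma jumpEpoch_succ (x : JumpPath Θ) (n : ℕ) :
    jumpEpoch x (n + 1) = jumpEpoch x n + jumpTime (next^[n] x) :=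
  Finset.sum_range_succ _ n

lemma iterate_next_apply (x : JumpPath Θ) (n : ℕ) (h : ℝ≥0) :
    (next^[n] x).1 h = x.1 (jumpEpoch x n + h) - x.1 (jumpEpoch x n) := by
  induction n generalizing h with
  | zero => simp [jumpEpoch, x.2.zero]
  | succ n ih =>
    rw [Function.iterate_succ_apply', next, shift_apply, ih, ih, jumpEpoch_succ, ← add_assoc]
    ext θ
    have h1 : x.1 (jumpEpoch x n) θ ≤ x.1 (jumpEpoch x n + jumpTime (next^[n] x)) θ :=
      x.2.mono le_self_add θ
    simp only [Pi.sub_apply]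
    omega

lemma apply_jumpEpoch_succ (x : JumpPath Θ) (n : ℕ) :
    x.1 (jumpEpoch x (n + 1)) = x.1 (jumpEpoch x n) + jump (next^[n] x) := by
  rw [jump, iterate_next_apply, ← jumpEpoch_succ, add_tsub_cancel_of_le]
  exact x.2.mono (by rw [jumpEpoch_succ]; exact le_self_add)

lemma apply_le_of_lt_jumpEpoch_succ {x : JumpPath Θ} {n : ℕ} (hn : jump (next^[n] x) ≠ 0)
    {s : ℝ≥0} (hs : s < jumpEpoch x (n + 1)) : x.1 s ≤ x.1 (jumpEpoch x n) := by
  rcases le_total s (jumpEpoch x n) with h | h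
  · exact x.2.mono h
  · obtain ⟨r, rfl⟩ := exists_add_of_le h
    rw [jumpEpoch_succ, add_lt_add_iff_left] at hs
    have := (eq_zero_iff (exists_ne_zero_of_jump hn)).2 hs
    rw [iterate_next_apply, tsub_eq_zero_iff_le] at this
    exact this

end JumpPath

/-! ### The first jump of a multivariate Poisson process -/

namespace JumpPath

variable {Θ : Type*} [Fintype Θ]

/-- The paths with prescribed increments over the first `k` cells of a partition. -/
def incrementSet (t : ℕ → ℝ≥0) (k : ℕ) (c : Fin k → Θ → ℕ) : Set (JumpPath Θ) :=
  {x | ∀ i : Fin k, x.1 (t (i + 1)) - x.1 (t i) = c i}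

omit [Fintype Θ] in
lemma measurable_increment (s t : ℝ≥0) :
    Measurable fun x : JumpPath Θ => x.1 t - x.1 s :=
  measurable_pi_lambda _ fun θ => ((measurable_pi_apply θ).comp (measurable_eval t)).sub
    ((measurable_pi_apply θ).comp (measurable_eval s))

lemma measurableSet_incrementSet (t : ℕ → ℝ≥0) (k : ℕ) (c : Fin k → Θ → ℕ) :
    MeasurableSet (incrementSet t k c) := by
  have : incrementSet t k c
      = ⋂ i : Fin k, (fun x : JumpPath Θ => x.1 (t (i + 1)) - x.1 (t i)) ⁻¹' {c i} := by
    ext x; simp [incrementSet]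
  rw [this]
  exact MeasurableSet.iInter fun i => measurable_increment _ _ (measurableSet_singleton _)

/-- The law of a random path is determined by the laws of its increments. -/
theorem ext_of_incrementSet {μ ν : Measure (JumpPath Θ)} [IsFiniteMeasure μ]
    (h : ∀ t : ℕ → ℝ≥0, Monotone t → t 0 = 0 → ∀ (k : ℕ) (c : Fin k → Θ → ℕ),
      μ (incrementSet t k c) = ν (incrementSet t k c)) : μ = ν := by
  have hval : μ.map Subtype.val = ν.map Subtype.val := by
    -- Finite-dimensional distributions determine the law on the product space, and those at the
    -- times `F` are images, under the map `g` of partial sums, of the law of the increments.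
    refine IsProjectiveLimit.unique (P := fun F => (μ.map Subtype.val).map F.restrict)
      (fun F => rfl) fun F => ?_
    obtain ⟨t, htm, ht0, htF⟩ := Primitives.exists_monotone_enum F
    choose! n hn using htF
    set k := F.sup n with hk
    set g : (Fin k → Θ → ℕ) → F → Θ → ℕ := fun c s => ∑ i : Fin k, if (i : ℕ) < n s then c i else 0
      with hg
    have hgm : Measurable g := measurable_of_countable g
    set D : JumpPath Θ → Fin k → Θ → ℕ := fun x i => x.1 (t (i + 1)) - x.1 (t i) with hD
    have hDm : Measurable D := measurable_pi_lambda _ fun i => measurable_increment _ _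
    have hgD : ∀ x : JumpPath Θ, g (D x) = F.restrict x.1 := by
      intro x
      ext s θ
      have h1 : n s ≤ k := Finset.le_sup s.2
      have h2 : g (D x) s
          = ∑ i ∈ Finset.range k, if i < n s then x.1 (t (i + 1)) - x.1 (t i) else 0 := by
        rw [Finset.sum_range]
      have h3 : {i ∈ Finset.range k | i < n s} = Finset.range (n s) := by
        ext i; simp only [Finset.mem_filter, Finset.mem_range]; omega
      rw [h2, ← Finset.sum_filter, h3,
        Finset.sum_range_tsub (f := fun i => x.1 (t i)) fun a b hab => x.2.mono (htm hab), ht0,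
        x.2.zero, hn s s.2, tsub_zero]
      rfl
    have hDlaw : μ.map D = ν.map D := by
      refine Measure.ext_of_singleton fun c => ?_
      rw [Measure.map_apply hDm (measurableSet_singleton c),
        Measure.map_apply hDm (measurableSet_singleton c)]
      convert h t htm ht0 k c using 2 <;>
      · ext x
        simp only [incrementSet, hD, Set.mem_preimage, Set.mem_singleton_iff, Set.mem_ofPred_eq]
        exact funext_iff
    have hmap : ∀ m : Measure (JumpPath Θ),
        (m.map Subtype.val).map F.restrict = (m.map D).map g := by
      intro m
      rw [Measure.map_map (by fun_prop) measurable_subtype_coe, Measure.map_map hgm hDm]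
      congr 1
      ext1 x
      exact (hgD x).symm
    simp only
    rw [hmap, hmap, hDlaw]
  ext s hs
  obtain ⟨s', hs', rfl⟩ := hs
  rw [← Measure.map_apply measurable_subtype_coe hs', hval,
    Measure.map_apply measurable_subtype_coe hs']

omit [Fintype Θ] in
lemma shift_shift (s h : ℝ≥0) (x : JumpPath Θ) : shift h (shift s x) = shift (s + h) x := by
  ext r θ
  have h1 : x.1 s θ ≤ x.1 (s + h) θ := x.2.mono le_self_add θ
  simp only [shift_apply, Pi.sub_apply, ← add_assoc]
  omega

/-- The law of a family of independent Poisson processes of rates `l θ`. -/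
def IsPoissonLaw (l : Θ → ℝ≥0) (ρ : Measure (JumpPath Θ)) : Prop :=
  ∀ t : ℕ → ℝ≥0, Monotone t → t 0 = 0 → ∀ (k : ℕ) (c : Fin k → Θ → ℕ),
    ρ (incrementSet t k c)
      = ∏ i : Fin k, ∏ θ, poissonMeasure (l θ * (t (i + 1) - t i)) {c i θ}

namespace IsPoissonLaw

variable {l : Θ → ℝ≥0} {ρ : Measure (JumpPath Θ)}

lemma isProbabilityMeasure (h : IsPoissonLaw l ρ) : IsProbabilityMeasure ρ := by
  constructor
  have := h (fun _ => 0) monotone_const rfl 0 Fin.elim0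
  simpa [incrementSet] using this

lemma measure_eval_eq (h : IsPoissonLaw l ρ) (s : ℝ≥0) (c : Θ → ℕ) :
    ρ {x | x.1 s = c} = ∏ θ, poissonMeasure (l θ * s) {c θ} := by
  have hmono : Monotone fun n : ℕ => if n = 0 then 0 else s := by
    refine monotone_nat_of_le_succ fun n => ?_
    by_cases hn : n = 0 <;> simp [hn]
  have := h _ hmono rfl 1 fun _ => c
  simp only [incrementSet, Fin.forall_fin_one] at this
  simpa [(Subtype.prop _ : IsJumpPath _).zero] using this

/-- The Markov property. -/
theorem measure_shift_mem (h : IsPoissonLaw l ρ) (s : ℝ≥0) (c : Θ → ℕ) {E : Set (JumpPath Θ)}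
    (hE : MeasurableSet E) :
    ρ {x | x.1 s = c ∧ shift s x ∈ E} = ρ {x | x.1 s = c} * ρ E := by
  have := h.isProbabilityMeasure
  have hsh : Measurable (shift s : JumpPath Θ → JumpPath Θ) :=
    measurable_shift_comp measurable_id measurable_const
  have key : (ρ.restrict {x | x.1 s = c}).map (shift s) = ρ {x | x.1 s = c} • ρ := by
    refine ext_of_incrementSet fun t htm ht0 k d => ?_
    rw [Measure.map_apply hsh (measurableSet_incrementSet t k d),
      Measure.restrict_apply (hsh (measurableSet_incrementSet t k d)), Measure.smul_apply,
      smul_eq_mul, h.measure_eval_eq, h t htm ht0]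
    -- The partition translated by `s`, with the cell from `0` to `s` put in front: the value `c` at
    -- time `s` becomes one more prescribed increment.
    set t' : ℕ → ℝ≥0 := fun n => Nat.casesOn n 0 fun i => s + t i with ht'
    have htm' : Monotone t' := by
      refine monotone_nat_of_le_succ fun n => ?_
      cases n with
      | zero => exact zero_le
      | succ n => exact add_le_add_right (htm (Nat.le_succ n)) s
    have h1 := h t' htm' rfl (k + 1) (Fin.cons c d)
    rw [Fin.prod_univ_succ] at h1
    have h2 : incrementSet t' (k + 1) (Fin.cons c d : Fin (k + 1) → Θ → ℕ)
        = shift s ⁻¹' incrementSet t k d ∩ {x | x.1 s = c} := by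
      ext x
      simp only [incrementSet, Set.mem_preimage, Set.mem_inter_iff, Set.mem_ofPred_eq,
        Fin.forall_fin_succ, Fin.cons_zero, Fin.cons_succ, Fin.val_zero, Fin.val_succ]
      rw [and_comm]
      refine and_congr (forall_congr' fun i => ?_) ?_
      · have h3 : (shift s x).1 (t (i + 1)) - (shift s x).1 (t i)
            = x.1 (s + t (i + 1)) - x.1 (s + t i) := by
          ext θ
          have h1 : x.1 s θ ≤ x.1 (s + t i) θ := x.2.mono le_self_add θ
          simp only [shift_apply, Pi.sub_apply]
          omega
        rw [h3]
      · simp [ht', ht0, x.2.zero]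
    rw [← h2, h1]
    congr 1
    · simp [ht', ht0]
    · refine Finset.prod_congr rfl fun i _ => Finset.prod_congr rfl fun θ _ => ?_
      simp [ht', add_tsub_add_eq_tsub_left]
  have h3 := congrArg (fun m => m E) key
  simp only [Measure.map_apply hsh hE, Measure.restrict_apply (hsh hE), Measure.smul_apply,
    smul_eq_mul] at h3
  rw [← h3]
  congr 1
  ext x
  exact and_comm

lemma measure_eval_eq_zero (h : IsPoissonLaw l ρ) (s : ℝ≥0) :
    ρ {x | x.1 s = 0} = ENNReal.ofReal (Real.exp (-(∑ θ, l θ : ℝ≥0) * s)) := by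
  rw [h.measure_eval_eq]
  simp only [Pi.zero_apply, poissonMeasure_singleton, pow_zero, Nat.factorial_zero, Nat.cast_one,
    mul_one, div_one]
  rw [← ENNReal.ofReal_prod_of_nonneg fun _ _ => (Real.exp_pos _).le, ← Real.exp_sum]
  congr 2
  push_cast
  rw [neg_mul, Finset.sum_mul, Finset.sum_neg_distrib]

lemma measure_eval_eq_single [DecidableEq Θ] (h : IsPoissonLaw l ρ) (s : ℝ≥0) (θ : Θ) :
    ρ {x | x.1 s = Pi.single θ 1}
      = ENNReal.ofReal (l θ * (s * Real.exp (-(∑ θ, l θ : ℝ≥0) * s))) := by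
  rw [h.measure_eval_eq]
  have h1 : ∀ θ', poissonMeasure (l θ' * s) {(Pi.single θ 1 : Θ → ℕ) θ'}
      = ENNReal.ofReal (Real.exp (-(l θ' * s : ℝ≥0)) * if θ' = θ then (l θ * s : ℝ) else 1) := by
    intro θ'
    rw [poissonMeasure_singleton]
    by_cases hθ : θ' = θ
    · subst hθ; simp
    · simp [hθ]
  simp_rw [h1]
  rw [← ENNReal.ofReal_prod_of_nonneg fun _ _ => by positivity, Finset.prod_mul_distrib,
    ← Real.exp_sum, Finset.prod_ite_eq' Finset.univ θ]
  congr 1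
  push_cast
  simp only [Finset.mem_univ, if_true]
  rw [neg_mul, Finset.sum_mul, Finset.sum_neg_distrib]
  ring

/-- The probability of no jump up to time `n` is `exp (-L n)`, which tends to `0`. -/
lemma ae_exists_ne_zero (h : IsPoissonLaw l ρ) (hl : 0 < ∑ θ, l θ) :
    ∀ᵐ x ∂ρ, ∃ t, x.1 t ≠ 0 := by
  have hlim : Tendsto (fun n : ℕ => ρ {x | x.1 (n : ℝ≥0) = 0}) atTop (𝓝 0) := by
    simp_rw [h.measure_eval_eq_zero]
    rw [← ENNReal.ofReal_zero]
    refine (ENNReal.continuous_ofReal.tendsto 0).comp (Real.tendsto_exp_atBot.comp ?_)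
    have : Tendsto (fun n : ℕ => (∑ θ, l θ : ℝ≥0) * (n : ℝ)) atTop atTop :=
      tendsto_natCast_atTop_atTop.const_mul_atTop (by exact_mod_cast hl)
    simp_rw [neg_mul]
    exact tendsto_neg_atTop_atBot.comp this
  rw [ae_iff]
  refine le_antisymm (ge_of_tendsto' hlim fun n => measure_mono fun x hx => ?_) zero_le
  simp only [not_exists, not_not, Set.mem_ofPred_eq] at hx ⊢
  exact hx _

end IsPoissonLaw

end JumpPath

/-! ### Discretisation of the first jump on a grid. -/

namespace JumpPath

variable {Θ : Type*}

/-- The reciprocal of the difference quotient of `1 - exp (-L h)` at `0`; it is the mesh-dependent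
factor in `IsPoissonLaw.measure_gridSet`. -/
lemma tendsto_mul_exp_div_one_sub_exp {L : ℝ} (hL : 0 < L) :
    Tendsto (fun h : ℝ => h * Real.exp (-L * h) * (1 - Real.exp (-L * h))⁻¹) (𝓝[>] 0)
      (𝓝 (1 / L)) := by
  have hd : HasDerivAt (fun h : ℝ => 1 - Real.exp (-L * h)) L 0 := by
    have h1 : HasDerivAt (fun h : ℝ => -L * h) (-L) 0 := by
      simpa using (hasDerivAt_id (0 : ℝ)).const_mul (-L)
    simpa using h1.exp.const_sub 1
  have h2 := hd.tendsto_slope_zero_right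
  have h3 : Tendsto (fun h : ℝ => Real.exp (-L * h)) (𝓝[>] 0) (𝓝 1) := by
    have : Continuous fun h : ℝ => Real.exp (-L * h) := by fun_prop
    simpa using (this.tendsto 0).mono_left nhdsWithin_le_nhds
  refine (h3.div h2 hL.ne').congr' ?_
  filter_upwards [self_mem_nhdsWithin] with h hh
  have hh : (0 : ℝ) < h := hh
  simp
  field_simp

lemma tsum_ofReal_exp_mul {L h u : ℝ} (hL : 0 < L) (hh : 0 < h) :
    ∑' m : ℕ, ENNReal.ofReal (Real.exp (-L * (u + m * h)))
      = ENNReal.ofReal (Real.exp (-L * u) * (1 - Real.exp (-L * h))⁻¹) := by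
  have he : Real.exp (-L * h) < 1 := Real.exp_lt_one_iff.2 (by nlinarith)
  have h1 : ∀ m : ℕ, ENNReal.ofReal (Real.exp (-L * (u + m * h)))
      = ENNReal.ofReal (Real.exp (-L * u)) * ENNReal.ofReal (Real.exp (-L * h)) ^ m := by
    intro m
    rw [← ENNReal.ofReal_pow (Real.exp_pos _).le, ← ENNReal.ofReal_mul (Real.exp_pos _).le,
      ← Real.exp_nat_mul, ← Real.exp_add]
    congr 2
    ring
  simp_rw [h1]
  rw [ENNReal.tsum_mul_left, ENNReal.tsum_geometric, ENNReal.ofReal_mul (Real.exp_pos _).le,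
    ENNReal.ofReal_inv_of_pos (by linarith), ENNReal.ofReal_sub _ (Real.exp_pos _).le,
    ENNReal.ofReal_one]

lemma tendsto_ceil_grid {u t : ℝ≥0} (hut : u < t) :
    Tendsto (fun k : ℕ => u + (⌈(t - u) * (k + 1)⌉₊ : ℝ≥0) * (1 / ((k : ℝ≥0) + 1))) atTop
      (𝓝[≥] t) := by
  have h : Tendsto (fun k : ℕ => (⌈(t - u) * (k + 1)⌉₊ : ℝ≥0) * (1 / ((k : ℝ≥0) + 1))) atTop
      (𝓝[≥] (t - u)) := by
    refine tendsto_nhdsWithin_iff.2 ⟨?_, Eventually.of_forall fun k => ?_⟩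
    · have h1 : Tendsto (fun k : ℕ => (t - u) + 1 / ((k : ℝ≥0) + 1)) atTop (𝓝 ((t - u) + 0)) :=
        tendsto_const_nhds.add tendsto_one_div_add_atTop_nhds_zero_nat
      rw [add_zero] at h1
      refine tendsto_of_tendsto_of_tendsto_of_le_of_le tendsto_const_nhds h1 (fun k => ?_)
        fun k => ?_
      · simp only
        rw [mul_one_div, le_div_iff₀ (by positivity)]
        exact Nat.le_ceil _
      · simp only
        rw [mul_one_div, div_le_iff₀ (by positivity), add_mul, one_div,
          inv_mul_cancel₀ (by positivity)]
        exact (Nat.ceil_lt_add_one zero_le).le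
    · rw [Set.mem_Ici, mul_one_div, le_div_iff₀ (by positivity)]
      exact Nat.le_ceil _
  have h2 := (tendsto_add_left_nhdsGE u (t - u)).comp h
  rwa [add_tsub_cancel_of_le hut.le] at h2

variable [Fintype Θ] [DecidableEq Θ]

/-- Paths whose first point on the grid `u + ℕ h` beyond the first jump carries a single unit jump
of type `θ`, and which are in `E` from there on. -/
def gridSet (θ : Θ) (u h : ℝ≥0) (E : Set (JumpPath Θ)) : Set (JumpPath Θ) :=
  ⋃ m : ℕ, {x | x.1 (u + m * h) = 0 ∧
    shift (u + m * h) x ∈ {y : JumpPath Θ | y.1 h = Pi.single θ 1 ∧ shift h y ∈ E}}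

omit [DecidableEq Θ] in
lemma measurableSet_shift_mem (s : ℝ≥0) (c : Θ → ℕ) {E : Set (JumpPath Θ)} (hE : MeasurableSet E) :
    MeasurableSet {x : JumpPath Θ | x.1 s = c ∧ shift s x ∈ E} :=
  (measurableSet_eval_eq s c).inter (measurable_shift_comp measurable_id measurable_const hE)

lemma measurableSet_gridSet (θ : Θ) (u h : ℝ≥0) {E : Set (JumpPath Θ)} (hE : MeasurableSet E) :
    MeasurableSet (gridSet θ u h E) :=
  MeasurableSet.iUnion fun _ => measurableSet_shift_mem _ _ (measurableSet_shift_mem _ _ hE)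

omit [Fintype Θ] in
lemma mem_gridSet_iff {θ : Θ} {u h : ℝ≥0} {E : Set (JumpPath Θ)} {x : JumpPath Θ} :
    x ∈ gridSet θ u h E ↔ ∃ m : ℕ, x.1 (u + m * h) = 0 ∧
      x.1 (u + (m + 1 : ℕ) * h) = Pi.single θ 1 ∧ shift (u + (m + 1 : ℕ) * h) x ∈ E := by
  simp only [gridSet, Set.mem_iUnion, Set.mem_ofPred_eq, shift_shift, shift_apply]
  refine exists_congr fun m => and_congr_right fun h0 => ?_
  have : u + (m + 1 : ℕ) * h = u + m * h + h := by push_cast; ring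
  rw [h0, tsub_zero, this]

/-- Split by the last grid point `u + m h` at which the path still vanishes. The Markov property,
used there and again one mesh later, gives `exp (-L (u + m h))` times the probability of one unit
jump in a cell times `ρ E`; the sum over `m` is geometric. -/
theorem IsPoissonLaw.measure_gridSet {l : Θ → ℝ≥0} {ρ : Measure (JumpPath Θ)}
    (hρ : IsPoissonLaw l ρ) (hl : 0 < ∑ θ, l θ) (θ : Θ) (u : ℝ≥0) {h : ℝ≥0} (hh : 0 < h)
    {E : Set (JumpPath Θ)} (hE : MeasurableSet E) :
    ρ (gridSet θ u h E) = ENNReal.ofReal (Real.exp (-(∑ θ, l θ : ℝ≥0) * u) * l θ *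
      (h * Real.exp (-(∑ θ, l θ : ℝ≥0) * h) * (1 - Real.exp (-(∑ θ, l θ : ℝ≥0) * h))⁻¹))
      * ρ E := by
  set L : ℝ≥0 := ∑ θ, l θ with hL
  have hL' : (0 : ℝ) < L := by exact_mod_cast hl
  have hdisj : Pairwise (Function.onFun Disjoint fun m : ℕ =>
      {x : JumpPath Θ | x.1 (u + m * h) = 0 ∧
      shift (u + m * h) x ∈ {y : JumpPath Θ | y.1 h = Pi.single θ 1 ∧ shift h y ∈ E}}) := by
    refine (pairwise_disjoint_on _).2 fun m n hmn => Set.disjoint_left.2 ?_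
    rintro x ⟨h0, h1, -⟩ ⟨h2, -⟩
    rw [shift_apply, h0, tsub_zero] at h1
    have h3 : x.1 (u + m * h + h) ≤ x.1 (u + n * h) := by
      refine x.2.mono ?_
      rw [add_assoc, ← add_one_mul]
      gcongr
      exact_mod_cast hmn
    rw [h1, h2] at h3
    simpa using h3 θ
  rw [gridSet, measure_iUnion hdisj fun _ =>
    measurableSet_shift_mem _ _ (measurableSet_shift_mem _ _ hE)]
  simp_rw [hρ.measure_shift_mem _ _ (measurableSet_shift_mem h _ hE), hρ.measure_shift_mem h _ hE,
    hρ.measure_eval_eq_zero, hρ.measure_eval_eq_single]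
  rw [ENNReal.tsum_mul_right]
  simp only [← hL, NNReal.coe_add, NNReal.coe_mul, NNReal.coe_natCast]
  rw [tsum_ofReal_exp_mul hL' (by exact_mod_cast hh), ← mul_assoc,
    ← ENNReal.ofReal_mul]
  · congr 2
    ring
  · have : Real.exp (-(L : ℝ) * h) < 1 := by
      refine Real.exp_lt_one_iff.2 ?_
      have : 0 < L * (h : ℝ) := mul_pos hL' (by exact_mod_cast hh)
      linarith
    have h2 : 0 < 1 - Real.exp (-(L : ℝ) * h) := by linarith
    positivity

omit [Fintype Θ] in
-- On a fine grid the first grid point after the jump is so close to it that the path, there and at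
-- the finitely many translates by `t i`, has the values it has when started from the jump itself.
lemma eventually_mem_gridSet_iff (θ : Θ) (u : ℝ≥0) (t : ℕ → ℝ≥0) (k : ℕ) (c : Fin k → Θ → ℕ)
    {x : JumpPath Θ} (hx : ∃ t, x.1 t ≠ 0) :
    ∀ᶠ n : ℕ in atTop, x ∈ gridSet θ u (1 / ((n : ℝ≥0) + 1)) (incrementSet t k c) ↔
      u < jumpTime x ∧ jump x = Pi.single θ 1 ∧ next x ∈ incrementSet t k c := by
  rcases le_or_gt (jumpTime x) u with hu | hu
  · refine Eventually.of_forall fun n => iff_of_false ?_ fun h => absurd h.1 (not_lt.2 hu)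
    rw [mem_gridSet_iff]
    rintro ⟨m, h0, -⟩
    exact absurd ((eq_zero_iff hx).1 h0) (not_lt.2 (hu.trans le_self_add))
  have hr := tendsto_ceil_grid hu
  have h1 := hr.eventually (x.2.right (jumpTime x))
  have h2 : ∀ᶠ n : ℕ in atTop, ∀ i : ℕ, i < k + 1 →
      x.1 (u + (⌈(jumpTime x - u) * (n + 1)⌉₊ : ℝ≥0) * (1 / ((n : ℝ≥0) + 1)) + t i)
        = x.1 (jumpTime x + t i) := by
    refine (Set.finite_lt_nat (k + 1)).eventually_all.2 fun i _ => ?_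
    have := tendsto_add_left_nhdsGE (t i) (jumpTime x)
    have := (this.comp hr).eventually (x.2.right (t i + jumpTime x))
    filter_upwards [this] with n hn
    rw [add_comm _ (t i), add_comm _ (t i)]
    exact hn
  filter_upwards [h1, h2] with n hn1 hn2
  set h : ℝ≥0 := 1 / ((n : ℝ≥0) + 1) with hh
  have hpos : 0 < h := by positivity
  have hcancel : ((n : ℝ≥0) + 1) * h = 1 := by rw [hh]; field_simp
  set q := ⌈(jumpTime x - u) * (n + 1)⌉₊ with hq
  have hmem : shift (u + q * h) x ∈ incrementSet t k c ↔ next x ∈ incrementSet t k c := by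
    refine forall_congr' fun i => ?_
    simp only [next, shift_apply]
    rw [hn2 _ (by omega), hn2 _ (by omega), hn1]
  have hq0 : 0 < q := Nat.ceil_pos.2 (mul_pos (tsub_pos_of_lt hu) (by positivity))
  -- So `q` is the index of the first grid point at or after the jump, and the only candidate in
  -- `gridSet` is `m = q - 1`.
  have hm : ∀ m : ℕ, x.1 (u + m * h) = 0 ↔ m < q := by
    intro m
    rw [eq_zero_iff hx, hq, Nat.lt_ceil, ← lt_tsub_iff_left]
    rw [← mul_lt_mul_iff_left₀ (show (0 : ℝ≥0) < n + 1 by positivity), mul_assoc, mul_comm h,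
      hcancel, mul_one]
  rw [mem_gridSet_iff]
  constructor
  · rintro ⟨m, h0, h3, h4⟩
    have hm1 : m + 1 = q := by
      refine le_antisymm ((hm m).1 h0) (not_lt.1 fun hlt => ?_)
      rw [(hm _).2 hlt] at h3
      simpa using congrFun h3 θ
    rw [hm1] at h3 h4
    exact ⟨hu, hn1.symm.trans h3, hmem.1 h4⟩
  · rintro ⟨-, h3, h4⟩
    refine ⟨q - 1, (hm _).2 (by omega), ?_⟩
    rw [Nat.sub_add_cancel hq0]
    exact ⟨hn1.trans h3, hmem.2 h4⟩

lemma measurableSet_jump_next (θ : Θ) (u : ℝ≥0) {E : Set (JumpPath Θ)} (hE : MeasurableSet E) :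
    MeasurableSet {x : JumpPath Θ | u < jumpTime x ∧ jump x = Pi.single θ 1 ∧ next x ∈ E} :=
  (measurable_jumpTime measurableSet_Ioi).inter
    ((measurable_jump (measurableSet_singleton _)).inter (measurable_next hE))

namespace IsPoissonLaw

variable {l : Θ → ℝ≥0} {ρ : Measure (JumpPath Θ)}

/-- The indicators of the grid events converge almost surely as the mesh `1 / (n + 1)` tends to `0`,
hence so do their probabilities, whose limit is explicit. -/
lemma measure_jump_next_incrementSet (hρ : IsPoissonLaw l ρ) (hl : 0 < ∑ θ, l θ) (θ : Θ)
    (u : ℝ≥0) (t : ℕ → ℝ≥0) (k : ℕ) (c : Fin k → Θ → ℕ) :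
    ρ {x | u < jumpTime x ∧ jump x = Pi.single θ 1 ∧ next x ∈ incrementSet t k c}
      = ENNReal.ofReal (l θ / (∑ θ, l θ : ℝ≥0) * Real.exp (-(∑ θ, l θ : ℝ≥0) * u))
        * ρ (incrementSet t k c) := by
  have := hρ.isProbabilityMeasure
  have hE := measurableSet_incrementSet t k c
  have h1 := tendsto_measure_of_ae_tendsto_indicator atTop (μ := ρ)
    (measurableSet_jump_next θ u hE)
    (fun n : ℕ => measurableSet_gridSet θ u (1 / ((n : ℝ≥0) + 1)) hE) MeasurableSet.univ
    (measure_ne_top _ _) (Eventually.of_forall fun _ => Set.subset_univ _)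
    ((hρ.ae_exists_ne_zero hl).mono fun x hx => eventually_mem_gridSet_iff θ u t k c hx)
  refine tendsto_nhds_unique h1 ?_
  have h2 : ∀ n : ℕ, 0 < 1 / ((n : ℝ≥0) + 1) := fun n => by positivity
  simp_rw [fun n => hρ.measure_gridSet hl θ u (h2 n) hE]
  refine ENNReal.Tendsto.mul_const ?_ (Or.inr (measure_ne_top _ _))
  refine (ENNReal.continuous_ofReal.tendsto _).comp ?_
  have hlim : Tendsto (fun n : ℕ => (((1 / ((n : ℝ≥0) + 1) : ℝ≥0)) : ℝ)) atTop (𝓝[>] 0) := by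
    refine tendsto_nhdsWithin_iff.2 ⟨?_, Eventually.of_forall fun n => by
      exact_mod_cast h2 n⟩
    push_cast
    exact tendsto_one_div_add_atTop_nhds_zero_nat
  have h3 := ((tendsto_mul_exp_div_one_sub_exp (L := (∑ θ, l θ : ℝ≥0))
    (by exact_mod_cast hl)).comp hlim).const_mul (Real.exp (-(∑ θ, l θ : ℝ≥0) * u) * l θ)
  have h4 : (l θ / (∑ θ, l θ : ℝ≥0) * Real.exp (-(∑ θ, l θ : ℝ≥0) * u) : ℝ)
      = Real.exp (-(∑ θ, l θ : ℝ≥0) * u) * l θ * (1 / (∑ θ, l θ : ℝ≥0)) := by ring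
  rw [h4]
  exact h3

/-- The joint law of the time and the type of the first jump and of the path after it. -/
theorem measure_jump_next (hρ : IsPoissonLaw l ρ) (hl : 0 < ∑ θ, l θ) (θ : Θ) (u : ℝ≥0)
    {E : Set (JumpPath Θ)} (hE : MeasurableSet E) :
    ρ {x | u < jumpTime x ∧ jump x = Pi.single θ 1 ∧ next x ∈ E}
      = ENNReal.ofReal (l θ / (∑ θ, l θ : ℝ≥0) * Real.exp (-(∑ θ, l θ : ℝ≥0) * u)) * ρ E := by
  have := hρ.isProbabilityMeasure
  have key : (ρ.restrict {x | u < jumpTime x ∧ jump x = Pi.single θ 1}).map next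
      = ENNReal.ofReal (l θ / (∑ θ, l θ : ℝ≥0) * Real.exp (-(∑ θ, l θ : ℝ≥0) * u)) • ρ := by
    refine ext_of_incrementSet fun t _ _ k c => ?_
    rw [Measure.map_apply measurable_next (measurableSet_incrementSet t k c),
      Measure.restrict_apply (measurable_next (measurableSet_incrementSet t k c)),
      Measure.smul_apply, smul_eq_mul, ← hρ.measure_jump_next_incrementSet hl]
    congr 1
    ext x
    simp only [Set.mem_inter_iff, Set.mem_preimage, Set.mem_ofPred_eq]
    tauto
  have h3 := congrArg (fun m => m E) key
  simp only [Measure.map_apply measurable_next hE, Measure.restrict_apply (measurable_next hE),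
    Measure.smul_apply, smul_eq_mul] at h3
  rw [← h3]
  congr 1
  ext x
  simp only [Set.mem_inter_iff, Set.mem_preimage, Set.mem_ofPred_eq]
  tauto

theorem map_jumpTime_next (hρ : IsPoissonLaw l ρ) (hl : 0 < ∑ θ, l θ) (θ : Θ) :
    (ρ.restrict {x | jump x = Pi.single θ 1}).map (fun x => ((jumpTime x : ℝ), next x))
      = ENNReal.ofReal (l θ / (∑ θ, l θ : ℝ≥0)) • (expMeasure (∑ θ, l θ : ℝ≥0)).prod ρ := by
  have := hρ.isProbabilityMeasure
  have hl' : (0 : ℝ) < (∑ θ, l θ : ℝ≥0) := by exact_mod_cast hl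
  have := isProbabilityMeasure_expMeasure hl'
  have hm : Measurable fun x : JumpPath Θ => ((jumpTime x : ℝ), next x) :=
    (measurable_jumpTime.coe_nnreal_real).prodMk measurable_next
  refine Measure.ext_prod fun {s E} hs hE => ?_
  have key : ((ρ.restrict {x | jump x = Pi.single θ 1 ∧ next x ∈ E}).map
      fun x => (jumpTime x : ℝ)) = (ENNReal.ofReal (l θ / (∑ θ, l θ : ℝ≥0)) * ρ E) •
        expMeasure (∑ θ, l θ : ℝ≥0) := by
    have hIoi : ∀ u : ℝ, (ρ.restrict {x | jump x = Pi.single θ 1 ∧ next x ∈ E}).map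
        (fun x => (jumpTime x : ℝ)) (Set.Ioi u) = ((ENNReal.ofReal (l θ / (∑ θ, l θ : ℝ≥0)) * ρ E) •
        expMeasure (∑ θ, l θ : ℝ≥0)) (Set.Ioi u) := by
      intro u
      rw [Measure.map_apply measurable_jumpTime.coe_nnreal_real measurableSet_Ioi,
        Measure.restrict_apply (measurable_jumpTime.coe_nnreal_real measurableSet_Ioi),
        Measure.smul_apply, smul_eq_mul]
      have h1 : (fun x : JumpPath Θ => (jumpTime x : ℝ)) ⁻¹' Set.Ioi u ∩
          {x | jump x = Pi.single θ 1 ∧ next x ∈ E}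
          = {x | u.toNNReal < jumpTime x ∧ jump x = Pi.single θ 1 ∧ next x ∈ E} := by
        ext x
        simp only [Set.mem_inter_iff, Set.mem_preimage, Set.mem_ofPred_eq, Set.mem_Ioi]
        refine and_congr_left fun hx => ?_
        have hpos : 0 < jumpTime x := jumpTime_pos (exists_ne_zero_of_jump (by simp [hx.1]))
        rw [← NNReal.coe_lt_coe, Real.coe_toNNReal', max_lt_iff]
        exact (and_iff_left (by exact_mod_cast hpos)).symm
      rw [h1, hρ.measure_jump_next hl θ _ hE, ENNReal.ofReal_mul (by positivity)]
      rcases le_total u 0 with hu | hu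
      · rw [expMeasure_Ioi_of_nonpos hl' hu, Real.toNNReal_of_nonpos hu]
        simp
      · rw [expMeasure_Ioi hl' hu, Real.coe_toNNReal _ hu, neg_mul]
        ring
    refine ext_of_generate_finite _ (borel_eq_generateFrom_Ioi ℝ ▸ BorelSpace.measurable_eq)
      isPiSystem_Ioi ?_ ?_
    · rintro _ ⟨u, rfl⟩
      exact hIoi u
    -- Equality of the total masses: jump times are nonnegative, so `(-1, ∞)` carries everything on
    -- both sides.
    · have h1 := hIoi (-1)
      rw [Measure.smul_apply, expMeasure_Ioi_of_nonpos hl' (by norm_num),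
        ← measure_univ (μ := expMeasure (∑ θ, l θ : ℝ≥0)), ← Measure.smul_apply] at h1
      rw [← h1, Measure.map_apply measurable_jumpTime.coe_nnreal_real MeasurableSet.univ,
        Measure.map_apply measurable_jumpTime.coe_nnreal_real measurableSet_Ioi]
      congr 1
      ext x
      simp only [Set.mem_preimage, Set.mem_univ, Set.mem_Ioi, true_iff]
      exact lt_of_lt_of_le (by norm_num) (jumpTime x).2
  have h3 := congrArg (fun m => m s) key
  simp only [Measure.map_apply measurable_jumpTime.coe_nnreal_real hs,
    Measure.restrict_apply (measurable_jumpTime.coe_nnreal_real hs),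
    Measure.smul_apply, smul_eq_mul] at h3
  rw [Measure.map_apply hm (hs.prod hE), Measure.restrict_apply (hm (hs.prod hE)),
    Measure.smul_apply, smul_eq_mul, Measure.prod_prod, mul_comm (expMeasure _ s), ← mul_assoc,
    ← h3]
  congr 1
  ext x
  simp only [Set.mem_inter_iff, Set.mem_preimage, Set.mem_ofPred_eq, Set.mem_prod]
  tauto

lemma measure_jump_eq_single (hρ : IsPoissonLaw l ρ) (hl : 0 < ∑ θ, l θ) (θ : Θ) :
    ρ {x | jump x = Pi.single θ 1} = ENNReal.ofReal (l θ / (∑ θ, l θ : ℝ≥0)) := by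
  have := hρ.isProbabilityMeasure
  have hl' : (0 : ℝ) < (∑ θ, l θ : ℝ≥0) := by exact_mod_cast hl
  have := isProbabilityMeasure_expMeasure hl'
  have h := congrArg (fun m => m Set.univ) (hρ.map_jumpTime_next hl θ)
  rw [Measure.map_apply ((measurable_jumpTime.coe_nnreal_real).prodMk measurable_next)
    MeasurableSet.univ, Set.preimage_univ, Measure.restrict_apply_univ, Measure.smul_apply,
    measure_univ, smul_eq_mul, mul_one] at h
  exact h

omit [Fintype Θ] in
lemma pairwise_disjoint_jump_eq_single :
    Pairwise (Function.onFun Disjoint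
      fun θ => {x : JumpPath Θ | jump x = Pi.single θ 1}) := by
  intro θ θ' hθ
  refine Set.disjoint_left.2 fun x (h1 : jump x = _) (h2 : jump x = _) => hθ ?_
  have := congrFun (h1.symm.trans h2) θ
  by_contra hne
  simp [hne] at this

/-- Almost surely the first jump is the unit jump of a single component. -/
lemma ae_exists_jump_eq_single (hρ : IsPoissonLaw l ρ) (hl : 0 < ∑ θ, l θ) :
    ∀ᵐ x ∂ρ, ∃ θ, jump x = Pi.single θ 1 := by
  have := hρ.isProbabilityMeasure
  have hl' : (0 : ℝ) < (∑ θ, l θ : ℝ≥0) := by exact_mod_cast hl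
  have hms : ∀ θ, MeasurableSet {x : JumpPath Θ | jump x = Pi.single θ 1} := fun θ =>
    measurable_jump (measurableSet_singleton _)
  -- The probabilities `l θ / L` of the disjoint events already sum to one, which leaves no room for
  -- simultaneous jumps.
  have h1 : ρ (⋃ θ, {x | jump x = Pi.single θ 1}) = 1 := by
    rw [measure_iUnion pairwise_disjoint_jump_eq_single hms, tsum_fintype]
    simp_rw [hρ.measure_jump_eq_single hl]
    rw [← ENNReal.ofReal_sum_of_nonneg fun _ _ => by positivity, ← Finset.sum_div,
      ← NNReal.coe_sum, div_self hl'.ne', ENNReal.ofReal_one]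
  have h2 := (mem_ae_iff_prob_eq_one (MeasurableSet.iUnion hms)).2 h1
  filter_upwards [h2] with x hx
  simpa using hx

theorem lintegral_jump (hρ : IsPoissonLaw l ρ) (hl : 0 < ∑ θ, l θ)
    {G : ℝ → (Θ → ℕ) → JumpPath Θ → ℝ≥0∞}
    (hG : ∀ c, Measurable fun q : ℝ × JumpPath Θ => G q.1 c q.2) :
    ∫⁻ x, G (jumpTime x) (jump x) (next x) ∂ρ = ∑ θ, ENNReal.ofReal (l θ / (∑ θ, l θ : ℝ≥0)) *
      ∫⁻ q, G q.1 (Pi.single θ 1) q.2 ∂(expMeasure (∑ θ, l θ : ℝ≥0)).prod ρ := by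
  have hms : ∀ θ, MeasurableSet {x : JumpPath Θ | jump x = Pi.single θ 1} := fun θ =>
    measurable_jump (measurableSet_singleton _)
  have hr : ρ.restrict (⋃ θ, {x | jump x = Pi.single θ 1}) = ρ := by
    refine Measure.restrict_eq_self_of_ae_mem ?_
    filter_upwards [hρ.ae_exists_jump_eq_single hl] with x hx
    simpa using hx
  conv_lhs => rw [← hr]
  rw [lintegral_iUnion hms pairwise_disjoint_jump_eq_single, tsum_fintype]
  refine Finset.sum_congr rfl fun θ _ => ?_
  rw [setLIntegral_congr_fun (g := fun x => G (jumpTime x) (Pi.single θ 1) (next x)) (hms θ)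
    fun x (hx : jump x = _) => by simp only [hx], ← smul_eq_mul, ← lintegral_smul_measure,
    ← hρ.map_jumpTime_next hl, lintegral_map (hG _)
      ((measurable_jumpTime.coe_nnreal_real).prodMk measurable_next)]

end IsPoissonLaw

end JumpPath

/-! ### The workload seen by successive arrivals -/

namespace JumpPath

variable {Θ : Type*} [Fintype Θ] [DecidableEq Θ]

/-- The service times left over after an arrival which does (`true`) or does not use one. -/
def dropIf (b : Bool) (s : ℕ → ℝ) : ℕ → ℝ := if b then fun n => s (n + 1) else s

/-- The time to the next arrival, whether it is of type `θ`, and the next service time of that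
type. -/
def slot (θ : Θ) (y : JumpPath Θ × (ℕ → ℝ)) : ℝ × Bool × ℝ :=
  (jumpTime y.1, decide (jump y.1 = Pi.single θ 1), y.2 0)

/-- The arrivals and the service times of type `θ` after the next arrival. -/
def advance (θ : Θ) (y : JumpPath Θ × (ℕ → ℝ)) : JumpPath Θ × (ℕ → ℝ) :=
  (next y.1, dropIf (decide (jump y.1 = Pi.single θ 1)) y.2)

/-- The workload of type `θ` just after arrival number `n`, where the system is empty after the
arrival number `0`. -/
def workload (θ : Θ) (y : JumpPath Θ × (ℕ → ℝ)) : ℕ → ℝ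
  | 0 => 0
  | n + 1 => workloadStep (workload θ y n, slot θ ((advance θ)^[n] y))

lemma measurable_dropIf : Measurable fun q : Bool × (ℕ → ℝ) => dropIf q.1 q.2 := by
  refine measurable_from_prod_countable_right fun b => ?_
  cases b
  · exact measurable_id
  · exact measurable_pi_lambda _ fun n => measurable_pi_apply (n + 1)

lemma measurable_decide_jump (θ : Θ) :
    Measurable fun x : JumpPath Θ => decide (jump x = Pi.single θ 1) :=
  (measurable_of_countable fun c : Θ → ℕ => decide (c = Pi.single θ 1)).comp measurable_jump

lemma measurable_slot (θ : Θ) : Measurable (slot θ) :=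
  (measurable_jumpTime.comp measurable_fst).coe_nnreal_real.prodMk
    (((measurable_decide_jump θ).comp measurable_fst).prodMk
      ((measurable_pi_apply 0).comp measurable_snd))

lemma measurable_advance (θ : Θ) : Measurable (advance θ) :=
  (measurable_next.comp measurable_fst).prodMk
    (measurable_dropIf.comp (((measurable_decide_jump θ).comp measurable_fst).prodMk
      measurable_snd))

lemma measurable_workload (θ : Θ) (n : ℕ) : Measurable fun y => workload θ y n := by
  induction n with
  | zero => exact measurable_const
  | succ n ih =>
    exact measurable_workloadStep.comp
      (ih.prodMk ((measurable_slot θ).comp ((measurable_advance θ).iterate n)))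

variable {l : Θ → ℝ≥0} {ρ : Measure (JumpPath Θ)}

omit [DecidableEq Θ] in
lemma div_sum_le_one (l : Θ → ℝ≥0) (θ : Θ) : (l θ : ℝ) / (∑ θ, l θ : ℝ≥0) ≤ 1 := by
  refine div_le_one_of_le₀ ?_ (NNReal.coe_nonneg _)
  exact_mod_cast Finset.single_le_sum (fun _ _ => zero_le) (Finset.mem_univ θ)

lemma sum_mul_decide_single (hl : 0 < ∑ θ, l θ) (θ : Θ) (g : Bool → ℝ≥0∞) :
    ∑ θ', ENNReal.ofReal (l θ' / (∑ θ, l θ : ℝ≥0)) *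
        g (decide ((Pi.single θ' 1 : Θ → ℕ) = Pi.single θ 1))
      = ∫⁻ b, g b ∂markMeasure (l θ / (∑ θ, l θ : ℝ≥0)) := by
  have hl' : (0 : ℝ) < (∑ θ, l θ : ℝ≥0) := by exact_mod_cast hl
  have h1 : ∀ θ', ((Pi.single θ' 1 : Θ → ℕ) = Pi.single θ 1) ↔ θ' = θ := fun θ' =>
    ⟨fun h => by
      by_contra hne
      simpa [hne] using congrFun h θ', fun h => h ▸ rfl⟩
  simp_rw [h1]
  rw [markMeasure, lintegral_add_measure, lintegral_smul_measure, lintegral_smul_measure,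
    lintegral_dirac, lintegral_dirac, ← Finset.add_sum_erase _ _ (Finset.mem_univ θ)]
  simp only [decide_true, smul_eq_mul]
  congr 1
  rw [Finset.sum_congr rfl fun θ' hθ' => by rw [decide_eq_false (Finset.ne_of_mem_erase hθ')],
    ← Finset.sum_mul, ← ENNReal.ofReal_sum_of_nonneg fun _ _ => by positivity]
  congr 2
  rw [← Finset.sum_div, eq_sub_iff_add_eq', ← add_div,
    Finset.add_sum_erase _ (fun θ => (l θ : ℝ)) (Finset.mem_univ θ), ← NNReal.coe_sum,
    div_self hl'.ne']

namespace IsPoissonLaw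

/-- The strong Markov property in the form seen by the queue of type `θ`: all other types are merged
into the mark `false`, by `sum_mul_decide_single`. -/
theorem map_jump (hρ : IsPoissonLaw l ρ) (hl : 0 < ∑ θ, l θ) (θ : Θ) :
    ρ.map (fun x => ((jumpTime x : ℝ), decide (jump x = Pi.single θ 1), next x))
      = (expMeasure (∑ θ, l θ : ℝ≥0)).prod
        ((markMeasure (l θ / (∑ θ, l θ : ℝ≥0))).prod ρ) := by
  have hl' : (0 : ℝ) < (∑ θ, l θ : ℝ≥0) := by exact_mod_cast hl
  have := hρ.isProbabilityMeasure
  have := isProbabilityMeasure_expMeasure hl'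
  have hm : Measurable fun x : JumpPath Θ =>
      ((jumpTime x : ℝ), decide (jump x = Pi.single θ 1), next x) :=
    measurable_jumpTime.coe_nnreal_real.prodMk
      ((measurable_decide_jump θ).prodMk measurable_next)
  refine Measure.ext_of_lintegral _ fun F hF => ?_
  rw [lintegral_map hF hm]
  have hG : ∀ b, Measurable fun q : ℝ × JumpPath Θ => F (q.1, b, q.2) := fun b =>
    hF.comp (measurable_fst.prodMk (measurable_const.prodMk measurable_snd))
  have h := hρ.lintegral_jump hl (G := fun a c x => F (a, decide (c = Pi.single θ 1), x))
    fun c => hG _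
  refine h.trans ?_
  rw [sum_mul_decide_single hl θ
    fun b => ∫⁻ q, F (q.1, b, q.2) ∂(expMeasure (∑ θ, l θ : ℝ≥0)).prod ρ]
  have := isProbabilityMeasure_markMeasure (q := l θ / (∑ θ, l θ : ℝ≥0)) (by positivity)
    (div_sum_le_one l θ)
  rw [lintegral_prod _ hF.aemeasurable]
  have h2 : ∀ a : ℝ, ∫⁻ q, F (a, q) ∂(markMeasure (l θ / (∑ θ, l θ : ℝ≥0))).prod ρ
      = ∫⁻ b, ∫⁻ x, F (a, b, x) ∂ρ ∂(markMeasure (l θ / (∑ θ, l θ : ℝ≥0))) := fun a =>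
    lintegral_prod _ (hF.comp measurable_prodMk_left).aemeasurable
  have h3 : ∀ b : Bool, ∫⁻ q, F (q.1, b, q.2) ∂(expMeasure (∑ θ, l θ : ℝ≥0)).prod ρ
      = ∫⁻ a, ∫⁻ x, F (a, b, x) ∂ρ ∂(expMeasure (∑ θ, l θ : ℝ≥0)) := fun b =>
    lintegral_prod _ (hG b).aemeasurable
  simp_rw [h2, h3]
  refine lintegral_lintegral_swap ?_
  have : Measurable fun p : (Bool × ℝ) × JumpPath Θ => F (p.1.2, p.1.1, p.2) := by fun_prop
  exact this.lintegral_prod_right'.aemeasurable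

variable {σ : Measure (ℕ → ℝ)} [IsProbabilityMeasure σ] {m : ℝ}

/-- If the arrival joins, the first service time is used up and the rest is a fresh copy of the
sequence. If not, the sequence is kept and the integrand ignores `v`, so a fictitious service time
may be integrated in. This makes the slots identically distributed whatever the mark. -/
lemma lintegral_dropIf (hm : 0 < m)
    (hσ : σ.map (fun s => (s 0, fun n => s (n + 1))) = (expMeasure m).prod σ) (b : Bool)
    {H : ℝ → (ℕ → ℝ) → ℝ≥0∞} (hH : Measurable fun q : ℝ × (ℕ → ℝ) => H q.1 q.2)
    (hb : b = false → ∀ v v' s, H v s = H v' s) :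
    ∫⁻ s, H (s 0) (dropIf b s) ∂σ = ∫⁻ v, ∫⁻ s, H v s ∂σ ∂expMeasure m := by
  have := isProbabilityMeasure_expMeasure hm
  cases b
  · have h1 : ∀ v s, H v s = H 0 s := fun v s => hb rfl v 0 s
    simp [h1, dropIf]
  · have hs : Measurable fun s : ℕ → ℝ => (s 0, fun n => s (n + 1)) :=
      (measurable_pi_apply 0).prodMk (measurable_pi_lambda _ fun n => measurable_pi_apply (n + 1))
    rw [← lintegral_prod _ hH.aemeasurable, ← hσ, lintegral_map hH hs]
    rfl

/-- The law of the workload and of the future after an arrival. -/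
theorem map_workloadStep_advance (hρ : IsPoissonLaw l ρ) (hl : 0 < ∑ θ, l θ) (θ : Θ) (hm : 0 < m)
    (hσ : σ.map (fun s => (s 0, fun n => s (n + 1))) = (expMeasure m).prod σ)
    (ν : Measure ℝ) [IsProbabilityMeasure ν] :
    (ν.prod (ρ.prod σ)).map (fun p => (workloadStep (p.1, slot θ p.2), advance θ p.2))
      = ((ν.prod (slotMeasure (∑ θ, l θ : ℝ≥0) (l θ / (∑ θ, l θ : ℝ≥0)) m)).map
        workloadStep).prod (ρ.prod σ) := by
  have hl' : (0 : ℝ) < (∑ θ, l θ : ℝ≥0) := by exact_mod_cast hl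
  have := hρ.isProbabilityMeasure
  have := isProbabilityMeasure_expMeasure hl'
  have := isProbabilityMeasure_expMeasure hm
  have := isProbabilityMeasure_markMeasure (q := l θ / (∑ θ, l θ : ℝ≥0)) (by positivity)
    (div_sum_le_one l θ)
  have hme : Measurable fun p : ℝ × JumpPath Θ × (ℕ → ℝ) =>
      (workloadStep (p.1, slot θ p.2), advance θ p.2) :=
    (measurable_workloadStep.comp (measurable_fst.prodMk
      ((measurable_slot θ).comp measurable_snd))).prodMk
      ((measurable_advance θ).comp measurable_snd)
  have hmj : Measurable fun x : JumpPath Θ =>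
      ((jumpTime x : ℝ), decide (jump x = Pi.single θ 1), next x) :=
    measurable_jumpTime.coe_nnreal_real.prodMk
      ((measurable_decide_jump θ).prodMk measurable_next)
  have hP := isProbabilityMeasure_slotMeasure hl' (by positivity) (div_sum_le_one l θ) hm
  refine Measure.ext_of_lintegral _ fun F hF => ?_
  have hΦ : ∀ r, Measurable fun q : (ℝ × Bool × JumpPath Θ) × (ℕ → ℝ) =>
      F (workloadStep (r, q.1.1, q.1.2.1, q.2 0), q.1.2.2, dropIf q.1.2.1 q.2) := fun r => by
    refine hF.comp ((measurable_workloadStep.comp ?_).prodMk (Measurable.prodMk ?_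
      (measurable_dropIf.comp (f := fun q : (ℝ × Bool × JumpPath Θ) × (ℕ → ℝ) =>
        (q.1.2.1, q.2)) ?_)))
    all_goals fun_prop
  have hΨ : ∀ r, Measurable fun q : (ℝ × Bool × JumpPath Θ) × ℝ × (ℕ → ℝ) =>
      F (workloadStep (r, q.1.1, q.1.2.1, q.2.1), q.1.2.2, q.2.2) := fun r => by
    refine hF.comp ((measurable_workloadStep.comp ?_).prodMk (Measurable.prodMk ?_ ?_))
    all_goals fun_prop
  have hW : Measurable fun q : (ℝ × ℝ × Bool × ℝ) × JumpPath Θ × (ℕ → ℝ) =>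
      F (workloadStep q.1, q.2) :=
    hF.comp ((measurable_workloadStep.comp measurable_fst).prodMk measurable_snd)
  calc ∫⁻ z, F z ∂(ν.prod (ρ.prod σ)).map
        (fun p => (workloadStep (p.1, slot θ p.2), advance θ p.2))
      = ∫⁻ p, F (workloadStep (p.1, slot θ p.2), advance θ p.2) ∂ν.prod (ρ.prod σ) :=
        lintegral_map hF hme
    _ = ∫⁻ r, ∫⁻ y, F (workloadStep (r, slot θ y), advance θ y) ∂ρ.prod σ ∂ν :=
        lintegral_prod _ (hF.comp hme).aemeasurable
    _ = ∫⁻ r, ∫⁻ e, ∫⁻ y, F (workloadStep (r, e), y) ∂ρ.prod σ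
          ∂slotMeasure (∑ θ, l θ : ℝ≥0) (l θ / (∑ θ, l θ : ℝ≥0)) m ∂ν := by
        refine lintegral_congr fun r => ?_
        calc ∫⁻ y, F (workloadStep (r, slot θ y), advance θ y) ∂ρ.prod σ
            = ∫⁻ x, ∫⁻ s, F (workloadStep (r, slot θ (x, s)), advance θ (x, s)) ∂σ ∂ρ :=
              lintegral_prod _ ((hF.comp hme).comp measurable_prodMk_left).aemeasurable
          _ = ∫⁻ k, ∫⁻ s, F (workloadStep (r, k.1, k.2.1, s 0), k.2.2, dropIf k.2.1 s) ∂σ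
                ∂ρ.map (fun x => ((jumpTime x : ℝ), decide (jump x = Pi.single θ 1), next x)) :=
              (lintegral_map (hΦ r).lintegral_prod_right' hmj).symm
          _ = ∫⁻ k, ∫⁻ v, ∫⁻ s, F (workloadStep (r, k.1, k.2.1, v), k.2.2, s) ∂σ ∂expMeasure m
                ∂(expMeasure (∑ θ, l θ : ℝ≥0)).prod
                  ((markMeasure (l θ / (∑ θ, l θ : ℝ≥0))).prod ρ) := by
              rw [hρ.map_jump hl θ]
              refine lintegral_congr fun k => ?_
              refine lintegral_dropIf hm hσ k.2.1
                (H := fun v s => F (workloadStep (r, k.1, k.2.1, v), k.2.2, s))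
                ((hΨ r).comp measurable_prodMk_left) fun hk v v' s => ?_
              simp [workloadStep, hk]
          _ = ∫⁻ a, ∫⁻ b, ∫⁻ x, ∫⁻ v, ∫⁻ s, F (workloadStep (r, a, b, v), x, s) ∂σ ∂expMeasure m ∂ρ
                ∂markMeasure (l θ / (∑ θ, l θ : ℝ≥0)) ∂expMeasure (∑ θ, l θ : ℝ≥0) := by
              have h1 : Measurable fun k : ℝ × Bool × JumpPath Θ =>
                  ∫⁻ v, ∫⁻ s, F (workloadStep (r, k.1, k.2.1, v), k.2.2, s) ∂σ ∂expMeasure m := by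
                refine Measurable.lintegral_prod_right' (f := fun q :
                  (ℝ × Bool × JumpPath Θ) × ℝ =>
                  ∫⁻ s, F (workloadStep (r, q.1.1, q.1.2.1, q.2), q.1.2.2, s) ∂σ) ?_
                refine Measurable.lintegral_prod_right' (f := fun q :
                  ((ℝ × Bool × JumpPath Θ) × ℝ) × (ℕ → ℝ) =>
                  F (workloadStep (r, q.1.1.1, q.1.1.2.1, q.1.2), q.1.1.2.2, q.2)) ?_
                exact (hΨ r).comp ((measurable_fst.comp measurable_fst).prodMk
                  ((measurable_snd.comp measurable_fst).prodMk measurable_snd))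
              refine (lintegral_prod _ h1.aemeasurable).trans (lintegral_congr fun a => ?_)
              exact lintegral_prod _ (h1.comp measurable_prodMk_left).aemeasurable
          _ = ∫⁻ a, ∫⁻ b, ∫⁻ v, ∫⁻ x, ∫⁻ s, F (workloadStep (r, a, b, v), x, s) ∂σ ∂ρ ∂expMeasure m
                ∂markMeasure (l θ / (∑ θ, l θ : ℝ≥0)) ∂expMeasure (∑ θ, l θ : ℝ≥0) := by
              -- Exchanging the path `x` and the service time `v` separates the slot `(a, b, v)`
              -- from the future `(x, s)`.
              refine lintegral_congr fun a => lintegral_congr fun b => lintegral_lintegral_swap ?_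
              refine Measurable.aemeasurable ?_
              refine Measurable.lintegral_prod_right' (f := fun q : (JumpPath Θ × ℝ) × (ℕ → ℝ) =>
                F (workloadStep (r, a, b, q.1.2), q.1.1, q.2)) ?_
              exact (hΨ r).comp (f := fun q : (JumpPath Θ × ℝ) × (ℕ → ℝ) =>
                ((a, b, q.1.1), q.1.2, q.2)) (by fun_prop)
          _ = ∫⁻ e, ∫⁻ y, F (workloadStep (r, e), y) ∂ρ.prod σ
                ∂slotMeasure (∑ θ, l θ : ℝ≥0) (l θ / (∑ θ, l θ : ℝ≥0)) m := by
              have h1 : Measurable fun e : ℝ × Bool × ℝ =>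
                  ∫⁻ y, F (workloadStep (r, e), y) ∂ρ.prod σ := by
                refine Measurable.lintegral_prod_right' (f := fun q :
                  (ℝ × Bool × ℝ) × JumpPath Θ × (ℕ → ℝ) => F (workloadStep (r, q.1), q.2)) ?_
                exact hW.comp (f := fun q : (ℝ × Bool × ℝ) × JumpPath Θ × (ℕ → ℝ) =>
                  ((r, q.1), q.2)) (by fun_prop)
              refine Eq.symm ?_
              refine (lintegral_prod _ h1.aemeasurable).trans (lintegral_congr fun a => ?_)
              refine (lintegral_prod _ (h1.comp measurable_prodMk_left).aemeasurable).trans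
                (lintegral_congr fun b => lintegral_congr fun v => ?_)
              exact lintegral_prod _ (hF.comp measurable_prodMk_left).aemeasurable
    _ = ∫⁻ z, ∫⁻ y, F (workloadStep z, y) ∂ρ.prod σ
          ∂ν.prod (slotMeasure (∑ θ, l θ : ℝ≥0) (l θ / (∑ θ, l θ : ℝ≥0)) m) :=
        (lintegral_prod _ hW.lintegral_prod_right'.aemeasurable).symm
    _ = ∫⁻ z, ∫⁻ y, F (z, y) ∂ρ.prod σ
          ∂(ν.prod (slotMeasure (∑ θ, l θ : ℝ≥0) (l θ / (∑ θ, l θ : ℝ≥0)) m)).map workloadStep :=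
        (lintegral_map hF.lintegral_prod_right' measurable_workloadStep).symm
    _ = _ := (lintegral_prod _ hF.aemeasurable).symm

/-- The law of the inter-arrival time, the mark and the service time of an arrival. -/
theorem map_slot (hρ : IsPoissonLaw l ρ) (hl : 0 < ∑ θ, l θ) (θ : Θ) (hm : 0 < m)
    (hσ : σ.map (fun s => (s 0, fun n => s (n + 1))) = (expMeasure m).prod σ) :
    (ρ.prod σ).map (slot θ) = slotMeasure (∑ θ, l θ : ℝ≥0) (l θ / (∑ θ, l θ : ℝ≥0)) m := by
  have hl' : (0 : ℝ) < (∑ θ, l θ : ℝ≥0) := by exact_mod_cast hl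
  have := hρ.isProbabilityMeasure
  have := isProbabilityMeasure_expMeasure hl'
  have := isProbabilityMeasure_expMeasure hm
  have := isProbabilityMeasure_markMeasure (q := l θ / (∑ θ, l θ : ℝ≥0)) (by positivity)
    (div_sum_le_one l θ)
  have h1 : ρ.map (fun x => ((jumpTime x : ℝ), decide (jump x = Pi.single θ 1)))
      = (expMeasure (∑ θ, l θ : ℝ≥0)).prod (markMeasure (l θ / (∑ θ, l θ : ℝ≥0))) := by
    have h := congrArg (Measure.map (Prod.map id Prod.fst)) (hρ.map_jump hl θ)
    rw [Measure.map_map (by fun_prop) (measurable_jumpTime.coe_nnreal_real.prodMk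
      ((measurable_decide_jump θ).prodMk measurable_next)),
      ← Measure.map_prod_map _ _ measurable_id measurable_fst, Measure.map_id,
      Measure.map_fst_prod, measure_univ, one_smul] at h
    exact h
  have h2 : σ.map (fun s => s 0) = expMeasure m := by
    have h := congrArg (Measure.map Prod.fst) hσ
    have hm2 : Measurable fun s : ℕ → ℝ => (s 0, fun n => s (n + 1)) :=
      (measurable_pi_apply 0).prodMk (measurable_pi_lambda _ fun n => measurable_pi_apply (n + 1))
    rw [Measure.map_map measurable_fst hm2, Measure.map_fst_prod, measure_univ, one_smul] at h
    exact h
  have he : Measurable fun s : ℕ → ℝ => s 0 := measurable_pi_apply 0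
  have hj : Measurable fun x : JumpPath Θ => ((jumpTime x : ℝ), decide (jump x = Pi.single θ 1)) :=
    measurable_jumpTime.coe_nnreal_real.prodMk (measurable_decide_jump θ)
  have h3 := Measure.map_prod_map ρ σ hj he
  rw [h1, h2] at h3
  rw [slotMeasure, ← Measure.prodAssoc_prod, h3]
  refine Eq.trans ?_ (Measure.map_map MeasurableEquiv.prodAssoc.measurable
    (hj.prodMap he)).symm
  rfl

/-- The law of the workload and of the future after arrival number `n`. -/
theorem map_workload_advance (hρ : IsPoissonLaw l ρ) (hl : 0 < ∑ θ, l θ) (θ : Θ) (hm : 0 < m)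
    (hσ : σ.map (fun s => (s 0, fun n => s (n + 1))) = (expMeasure m).prod σ) (n : ℕ) :
    (ρ.prod σ).map (fun y => (workload θ y n, (advance θ)^[n] y))
      = ((ρ.prod σ).map fun y => workload θ y n).prod (ρ.prod σ) := by
  have := hρ.isProbabilityMeasure
  have hmw : ∀ n, Measurable fun y => (workload θ y n, (advance θ)^[n] y) := fun n =>
    (measurable_workload θ n).prodMk ((measurable_advance θ).iterate n)
  induction n with
  | zero =>
    simp [workload, Measure.dirac_prod]
  | succ n ih =>
    have hν := Measure.isProbabilityMeasure_map (μ := ρ.prod σ)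
      (measurable_workload θ n).aemeasurable
    have hl' : (0 : ℝ) < (∑ θ, l θ : ℝ≥0) := by exact_mod_cast hl
    have hP := isProbabilityMeasure_slotMeasure hl' (by positivity) (div_sum_le_one l θ) hm
    have hme : Measurable fun p : ℝ × JumpPath Θ × (ℕ → ℝ) =>
        (workloadStep (p.1, slot θ p.2), advance θ p.2) :=
      (measurable_workloadStep.comp (measurable_fst.prodMk
        ((measurable_slot θ).comp measurable_snd))).prodMk
        ((measurable_advance θ).comp measurable_snd)
    have h := hρ.map_workloadStep_advance hl θ hm hσ ((ρ.prod σ).map fun y => workload θ y n)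
    rw [← ih, Measure.map_map hme (hmw n)] at h
    have h1 : ((fun p : ℝ × JumpPath Θ × (ℕ → ℝ) =>
        (workloadStep (p.1, slot θ p.2), advance θ p.2)) ∘
          fun y => (workload θ y n, (advance θ)^[n] y))
        = fun y => (workload θ y (n + 1), (advance θ)^[n + 1] y) := by
      ext1 y
      simp [workload, Function.iterate_succ_apply']
    rw [h1] at h
    have := Measure.isProbabilityMeasure_map (μ := ((ρ.prod σ).map fun y => workload θ y n).prod
      (slotMeasure (∑ θ, l θ : ℝ≥0) (l θ / (∑ θ, l θ : ℝ≥0)) m))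
      measurable_workloadStep.aemeasurable
    -- The first marginal identifies the unnamed factor as the law of the workload at `n + 1`.
    have h2 := congrArg (Measure.map Prod.fst) h
    rw [Measure.map_fst_prod, measure_univ, one_smul,
      Measure.map_map measurable_fst (hmw (n + 1))] at h2
    rw [h, ← h2]
    rfl

/-- The next slot is a function of the future, which is independent of the present workload. This is
the Markov recursion for the workload laws. -/
lemma map_workload_slot (hρ : IsPoissonLaw l ρ) (hl : 0 < ∑ θ, l θ) (θ : Θ) (hm : 0 < m)
    (hσ : σ.map (fun s => (s 0, fun n => s (n + 1))) = (expMeasure m).prod σ) (n : ℕ) :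
    (ρ.prod σ).map (fun y => (workload θ y n, slot θ ((advance θ)^[n] y)))
      = ((ρ.prod σ).map fun y => workload θ y n).prod
        (slotMeasure (∑ θ, l θ : ℝ≥0) (l θ / (∑ θ, l θ : ℝ≥0)) m) := by
  have := hρ.isProbabilityMeasure
  have hν := Measure.isProbabilityMeasure_map (μ := ρ.prod σ)
      (measurable_workload θ n).aemeasurable
  rw [← hρ.map_slot hl θ hm hσ]
  have h := Measure.map_prod_map ((ρ.prod σ).map fun y => workload θ y n) (ρ.prod σ)
    measurable_id (measurable_slot θ)
  rw [Measure.map_id] at h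
  rw [h, ← hρ.map_workload_advance hl θ hm hσ, Measure.map_map
    (measurable_id.prodMap (measurable_slot θ))
    ((measurable_workload θ n).prodMk ((measurable_advance θ).iterate n))]
  rfl

/-- The expected value of a function of the workload, restricted to the event that arrival number
`n` is of type `θ`, converges. -/
theorem tendsto_integral_workload_jump (hρ : IsPoissonLaw l ρ) (hl : 0 < ∑ θ, l θ) (θ : Θ)
    (hm : l θ < m)
    (hσ : σ.map (fun s => (s 0, fun n => s (n + 1))) = (expMeasure m).prod σ)
    {f : ℝ → ℝ} {K : ℝ≥0} (hf : LipschitzWith K f) {B : ℝ} (hB : ∀ x, |f x| ≤ B) :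
    Tendsto (fun n => ∫ y, (if jump ((advance θ)^[n] y).1 = Pi.single θ 1 then
        f (workload θ y (n + 1)) else 0) ∂ρ.prod σ) atTop
      (𝓝 (l θ / (∑ θ, l θ : ℝ≥0) * ∫ x, f x ∂expMeasure (m - l θ))) := by
  have hl' : (0 : ℝ) < (∑ θ, l θ : ℝ≥0) := by exact_mod_cast hl
  have hm0 : 0 < m := (NNReal.coe_nonneg _).trans_lt hm
  have := hρ.isProbabilityMeasure
  have hν : ∀ n, IsProbabilityMeasure ((ρ.prod σ).map fun y => workload θ y n) := fun n =>
    Measure.isProbabilityMeasure_map (measurable_workload θ n).aemeasurable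
  -- In the notation of the workload chain `q L = l θ`, so its stability condition is that of the
  -- queue.
  have hcancel : (l θ / (∑ θ, l θ : ℝ≥0) * (∑ θ, l θ : ℝ≥0) : ℝ) = l θ :=
    div_mul_cancel₀ _ hl'.ne'
  have hpair : ∀ n, Measurable fun y : JumpPath Θ × (ℕ → ℝ) =>
      (workload θ y n, slot θ ((advance θ)^[n] y)) := fun n =>
    (measurable_workload θ n).prodMk ((measurable_slot θ).comp ((measurable_advance θ).iterate n))
  have h := tendsto_integral_workload hl' (by positivity) (div_sum_le_one l θ) hm0
    (by rw [hcancel]; exact hm) (ν := fun n => (ρ.prod σ).map fun y => workload θ y n)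
    (by simp [workload]) (fun n => by
      rw [← hρ.map_workload_slot hl θ hm0 hσ, Measure.map_map measurable_workloadStep (hpair n)]
      rfl) hf hB
  rw [hcancel] at h
  refine h.congr fun n => ?_
  rw [← hρ.map_workload_slot hl θ hm0 hσ, integral_map (hpair n).aemeasurable]
  · simp [slot, workload]
  · refine Measurable.aestronglyMeasurable (Measurable.ite ?_
      (hf.continuous.measurable.comp measurable_workloadStep) measurable_const)
    exact (measurable_fst.comp (measurable_snd.comp measurable_snd)) (measurableSet_singleton true)

end IsPoissonLaw

end JumpPath

/-! ### Sojourn times in terms of the workload -/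

namespace JumpPath

variable {Θ : Type*} [Fintype Θ] [DecidableEq Θ] {x : JumpPath Θ} {J : ℕ → Θ}

omit [Fintype Θ] in
lemma jump_ne_zero_of_eq_single {x : JumpPath Θ} {θ : Θ} (h : jump x = Pi.single θ 1) :
    jump x ≠ 0 := by
  rw [h]; simp

omit [Fintype Θ] in
lemma jumpEpoch_lt_succ (hJ : ∀ n, jump (next^[n] x) = Pi.single (J n) 1) (n : ℕ) :
    jumpEpoch x n < jumpEpoch x (n + 1) := by
  rw [jumpEpoch_succ]
  exact lt_add_of_pos_right _
    (jumpTime_pos (exists_ne_zero_of_jump (jump_ne_zero_of_eq_single (hJ n))))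

omit [Fintype Θ] in
lemma apply_jumpEpoch_succ_of_eq (hJ : ∀ n, jump (next^[n] x) = Pi.single (J n) 1) {n : ℕ} {θ : Θ}
    (h : J n = θ) : x.1 (jumpEpoch x (n + 1)) θ = x.1 (jumpEpoch x n) θ + 1 := by
  rw [apply_jumpEpoch_succ, hJ, h]
  simp

omit [Fintype Θ] in
lemma apply_jumpEpoch_succ_of_ne (hJ : ∀ n, jump (next^[n] x) = Pi.single (J n) 1) {n : ℕ} {θ : Θ}
    (h : J n ≠ θ) : x.1 (jumpEpoch x (n + 1)) θ = x.1 (jumpEpoch x n) θ := by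
  rw [apply_jumpEpoch_succ, hJ]
  simp [Pi.single_eq_of_ne (Ne.symm h)]

lemma sum_apply_jumpEpoch (hJ : ∀ n, jump (next^[n] x) = Pi.single (J n) 1) (n : ℕ) :
    ∑ θ, x.1 (jumpEpoch x n) θ = n := by
  induction n with
  | zero => simp [jumpEpoch, x.2.zero]
  | succ n ih =>
    rw [apply_jumpEpoch_succ, hJ]
    simp only [Pi.add_apply, Finset.sum_add_distrib, ih, Finset.sum_pi_single',
      Finset.mem_univ, if_true]

/-- Requests are numbered from `0`, whereas jump number `0` is time `0`: request `n` arrives at jump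
`n + 1`. -/
lemma csInf_lt_sum_apply (hJ : ∀ n, jump (next^[n] x) = Pi.single (J n) 1) (n : ℕ) :
    sInf {t | n < ∑ θ, x.1 t θ} = jumpEpoch x (n + 1) := by
  refine IsLeast.csInf_eq ⟨?_, fun t ht => ?_⟩
  · simp only [Set.mem_ofPred_eq]
    rw [sum_apply_jumpEpoch hJ]
    exact Nat.lt_succ_self n
  · by_contra hlt
    have h := apply_le_of_lt_jumpEpoch_succ (jump_ne_zero_of_eq_single (hJ n)) (not_le.1 hlt)
    have h2 : ∑ θ, x.1 t θ ≤ ∑ θ, x.1 (jumpEpoch x n) θ := Finset.sum_le_sum fun θ _ => h θ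
    rw [sum_apply_jumpEpoch hJ] at h2
    exact absurd ht (not_lt.2 h2)

omit [Fintype Θ] in
lemma csInf_lt_apply (hJ : ∀ n, jump (next^[n] x) = Pi.single (J n) 1) {n : ℕ} {θ : Θ}
    (hθ : J n = θ) {m : ℕ} (hm : x.1 (jumpEpoch x n) θ = m) :
    sInf {t | m < x.1 t θ} = jumpEpoch x (n + 1) := by
  refine IsLeast.csInf_eq ⟨?_, fun t ht => ?_⟩
  · simp only [Set.mem_ofPred_eq]
    rw [apply_jumpEpoch_succ_of_eq hJ hθ, hm]
    exact Nat.lt_succ_self _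
  · by_contra hlt
    have h := apply_le_of_lt_jumpEpoch_succ (jump_ne_zero_of_eq_single (hJ n)) (not_le.1 hlt) θ
    rw [hm] at h
    exact absurd ht (not_lt.2 h)

/-- One service time is dropped per arrival of type `θ`, so the index offset is the count of that
type. -/
lemma iterate_advance (hJ : ∀ n, jump (next^[n] x) = Pi.single (J n) 1) (θ : Θ) (s : ℕ → ℝ)
    (n : ℕ) :
    (advance θ)^[n] (x, s) = (next^[n] x, fun i => s (x.1 (jumpEpoch x n) θ + i)) := by
  induction n with
  | zero => simp [jumpEpoch, x.2.zero]
  | succ n ih =>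
    rw [Function.iterate_succ_apply', ih, advance, Function.iterate_succ_apply', hJ]
    refine Prod.ext rfl ?_
    by_cases h : J n = θ
    · simp only [h, decide_true, dropIf, if_true]
      ext i
      rw [apply_jumpEpoch_succ_of_eq hJ h]
      congr 1
      ring
    · have h1 : (Pi.single (J n) 1 : Θ → ℕ) ≠ Pi.single θ 1 := fun h' => by
        simpa [Ne.symm h] using congrFun h' θ
      simp only [h1, decide_false, dropIf]
      ext i
      rw [apply_jumpEpoch_succ_of_ne hJ h]
      rfl

lemma workload_succ (hJ : ∀ n, jump (next^[n] x) = Pi.single (J n) 1) (θ : Θ) (s : ℕ → ℝ)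
    (n : ℕ) :
    workload θ (x, s) (n + 1) = max (workload θ (x, s) n -
      ((jumpEpoch x (n + 1) : ℝ) - jumpEpoch x n)) 0 +
      if J n = θ then s (x.1 (jumpEpoch x n) θ) else 0 := by
  have h1 : ((Pi.single (J n) 1 : Θ → ℕ) = Pi.single θ 1) ↔ J n = θ :=
    ⟨fun h => by
      by_contra hne
      simpa [hne] using congrFun h (J n), fun h => h ▸ rfl⟩
  rw [workload, iterate_advance hJ, jumpEpoch_succ]
  simp only [workloadStep, slot, hJ, h1, decide_eq_true_eq, add_zero]
  push_cast
  congr 3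
  ring

variable {Ω : Type*} {Q : Queue Ω} {ω : Ω} {θ : Θ}

/-- Just after each arrival, the workload of type `θ` is the time until the departure of the last
request of type `θ` that has arrived. -/
theorem workload_eq_departure (hJ : ∀ n, jump (next^[n] x) = Pi.single (J n) 1)
    (hQ : ∀ t, Q.arrivals t ω = x.1 t θ) (hs : ∀ m, 0 ≤ Q.service m ω) (n : ℕ) :
    (x.1 (jumpEpoch x n) θ = 0 → workload θ (x, fun m => Q.service m ω) n = 0) ∧
      ∀ m, x.1 (jumpEpoch x n) θ = m + 1 → workload θ (x, fun m => Q.service m ω) n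
        = max (Q.departure m ω - jumpEpoch x n) 0 := by
  induction n with
  | zero => simp [jumpEpoch, x.2.zero, workload]
  | succ n ih =>
    have hlt : (jumpEpoch x n : ℝ) < jumpEpoch x (n + 1) := by
      exact_mod_cast jumpEpoch_lt_succ hJ n
    obtain ⟨ih0, ih1⟩ := ih
    rw [workload_succ hJ]
    by_cases h : J n = θ
    · rw [apply_jumpEpoch_succ_of_eq hJ h]
      refine ⟨fun h0 => absurd h0 (Nat.succ_ne_zero _), fun m hm => ?_⟩
      have hm : x.1 (jumpEpoch x n) θ = m := by omega
      have hep : epoch Q.arrivals m ω = jumpEpoch x (n + 1) := by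
        simp only [epoch, hQ]
        exact csInf_lt_apply hJ h hm
      rw [if_pos h, hm]
      have hsm := hs m
      -- Customer `0` finds the queue empty. A later one starts at the later of its arrival and its
      -- predecessor's departure, which is what the positive part of the old workload records.
      cases m with
      | zero =>
        rw [ih0 hm, Queue.departure, hep]
        rw [max_eq_right (by linarith), max_eq_left (by linarith)]
        ring
      | succ m =>
        rw [ih1 m hm, Queue.departure, hep]
        rcases le_total (Q.departure m ω) (jumpEpoch x (n + 1)) with hd | hd
        · rw [max_eq_left hd, max_eq_left (a := (_ + _ - _ : ℝ)) (by linarith),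
            max_eq_right (a := (_ - _ : ℝ))]
          · ring
          · have : max (Q.departure m ω - jumpEpoch x n) 0 ≤ jumpEpoch x (n + 1) - jumpEpoch x n :=
              max_le (by linarith) (by linarith)
            linarith
        · rw [max_eq_right hd, max_eq_left (a := Q.departure m ω - jumpEpoch x n) (by linarith),
            max_eq_left (by linarith), max_eq_left (by linarith)]
          ring
    · rw [apply_jumpEpoch_succ_of_ne hJ h, if_neg h, add_zero]
      -- An arrival of another type only lets time pass: the departure epoch is unchanged and the
      -- nested maxima collapse.
      refine ⟨fun h0 => ?_, fun m hm => ?_⟩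
      · rw [ih0 h0]
        exact max_eq_right (by linarith)
      · rw [ih1 m hm]
        rcases le_total (Q.departure m ω) (jumpEpoch x n) with hd | hd
        · rw [max_eq_right (a := Q.departure m ω - jumpEpoch x n) (by linarith),
            max_eq_right (by linarith), max_eq_right (by linarith)]
        · rw [max_eq_left (a := Q.departure m ω - jumpEpoch x n) (by linarith)]
          congr 1
          ring

/-- The workload just after an arrival is the time until that request departs; the positive part is
superfluous because service times are nonnegative. -/
lemma sojourn_eq_workload (hJ : ∀ n, jump (next^[n] x) = Pi.single (J n) 1)
    (hQ : ∀ t, Q.arrivals t ω = x.1 t θ) (hs : ∀ m, 0 ≤ Q.service m ω) {n : ℕ} (h : J n = θ) :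
    Q.sojourn (x.1 (jumpEpoch x n) θ) ω = workload θ (x, fun m => Q.service m ω) (n + 1) := by
  set m := x.1 (jumpEpoch x n) θ with hm
  have hep : epoch Q.arrivals m ω = jumpEpoch x (n + 1) := by
    simp only [epoch, hQ]
    exact csInf_lt_apply hJ h hm.symm
  rw [(workload_eq_departure hJ hQ hs (n + 1)).2 m (apply_jumpEpoch_succ_of_eq hJ h),
    Queue.sojourn, hep, max_eq_left]
  have := hs m
  cases hk : m with
  | zero =>
    rw [hk] at hep this
    rw [Queue.departure, hep]; linarith
  | succ k =>
    rw [hk] at hep this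
    rw [Queue.departure, hep]
    have := le_max_left (jumpEpoch x (n + 1) : ℝ) (Q.departure k ω)
    linarith

end JumpPath

namespace Primitives

variable {I J K Θ Ω : Type*} [Fintype I] [Fintype Θ] {C : Network I J K Θ} {X : Primitives I J Θ Ω}

lemma total_eq_sum_typeCount (j : J) (t : ℝ≥0) (ω : Ω) :
    X.total C j t ω = ∑ θ, X.typeCount C j θ t ω := by
  classical
  simp only [total, typeCount]
  rw [Finset.sum_comm]
  refine Finset.sum_congr rfl fun i _ => ?_
  rw [← Finset.card_eq_sum_card_fiberwise (f := fun n => X.type i n ω) (t := Finset.univ)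
    (by simp), Finset.card_range]

open JumpPath in
/-- The sojourn time of a request is the workload of its type just after its arrival. -/
theorem sojourn_eq_sum_workload [DecidableEq Θ] {j : J} {ω : Ω} {x : JumpPath Θ} {A : ℕ → Θ}
    (hA : ∀ n, jump (next^[n] x) = Pi.single (A n) 1)
    (hx : ∀ t θ, X.typeCount C j θ t ω = x.1 t θ) (hs : ∀ θ m, 0 ≤ X.service j θ m ω) (n : ℕ) :
    X.sojourn C j n ω = ∑ θ, if jump (next^[n] x) = Pi.single θ 1 then
      workload θ (x, fun m => X.service j θ m ω) (n + 1) else 0 := by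
  have he : epoch (X.total C j) n ω = jumpEpoch x (n + 1) := by
    simp only [epoch, total_eq_sum_typeCount, hx]
    exact csInf_lt_sum_apply hA n
  simp only [sojourn, he, hx]
  refine Finset.sum_congr rfl fun θ _ => ?_
  -- A type other than that of the request has already reached its count at the preceding jump, so
  -- the test in `sojourn` selects exactly one type.
  have h1 : (∀ s < jumpEpoch x (n + 1), x.1 s θ < x.1 (jumpEpoch x (n + 1)) θ) ↔ A n = θ := by
    refine ⟨fun h => ?_, fun h s hs => ?_⟩
    · by_contra hne
      have := h _ (jumpEpoch_lt_succ hA n)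
      rw [apply_jumpEpoch_succ_of_ne hA hne] at this
      exact lt_irrefl _ this
    · rw [apply_jumpEpoch_succ_of_eq hA h]
      exact Nat.lt_succ_of_le
        (apply_le_of_lt_jumpEpoch_succ (jump_ne_zero_of_eq_single (hA n)) hs θ)
  have h2 : ((Pi.single (A n) 1 : Θ → ℕ) = Pi.single θ 1) ↔ A n = θ :=
    ⟨fun h => by
      by_contra hne
      simpa [hne] using congrFun h (A n), fun h => h ▸ rfl⟩
  have h3 : (∀ s < epoch (X.total C j) n ω, X.typeCount C j θ s ω
      < X.typeCount C j θ (epoch (X.total C j) n ω) ω) ↔ A n = θ := by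
    simp only [he, hx]
    exact h1
  rw [hA]
  by_cases h : A n = θ
  · rw [if_pos (h3.2 h), if_pos (h2.2 h), apply_jumpEpoch_succ_of_eq hA h, Nat.add_sub_cancel]
    exact sojourn_eq_workload (Q := X.dsrQueue C j θ) hA (fun t => hx t θ) (hs θ) h
  · rw [if_neg (mt h3.1 h), if_neg (mt h2.1 h)]

end Primitives

/-! ### The sojourn times at an edge server -/

namespace JumpPath

variable {Θ : Type*} [Fintype Θ] [DecidableEq Θ]

lemma fst_iterate_advance (θ : Θ) (y : JumpPath Θ × (ℕ → ℝ)) (n : ℕ) :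
    ((advance θ)^[n] y).1 = next^[n] y.1 :=
  (Function.Semiconj.iterate_right (f := Prod.fst) (ga := advance θ) (gb := next)
    (fun _ => rfl) n) y

variable {l : Θ → ℝ≥0} {ρ : Measure (JumpPath Θ)}

omit [DecidableEq Θ] in
lemma IsPoissonLaw.measurePreserving_next (hρ : IsPoissonLaw l ρ) (hl : 0 < ∑ θ, l θ) :
    MeasurePreserving next ρ ρ := by
  classical
  refine ⟨measurable_next, ?_⟩
  have hl' : (0 : ℝ) < (∑ θ, l θ : ℝ≥0) := by exact_mod_cast hl
  have := hρ.isProbabilityMeasure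
  have := isProbabilityMeasure_expMeasure hl'
  obtain ⟨θ⟩ : Nonempty Θ := by
    by_contra h
    rw [not_nonempty_iff] at h
    simp at hl
  have := isProbabilityMeasure_markMeasure (q := l θ / (∑ θ, l θ : ℝ≥0)) (by positivity)
    (div_sum_le_one l θ)
  have h := congrArg (Measure.map Prod.snd) (congrArg (Measure.map Prod.snd) (hρ.map_jump hl θ))
  rw [Measure.map_snd_prod, measure_univ, one_smul, Measure.map_snd_prod, measure_univ, one_smul,
    Measure.map_map measurable_snd measurable_snd, Measure.map_map (by fun_prop)
      (measurable_jumpTime.coe_nnreal_real.prodMk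
        ((measurable_decide_jump θ).prodMk measurable_next))] at h
  exact h

lemma IsPoissonLaw.ae_forall_exists_jump (hρ : IsPoissonLaw l ρ) (hl : 0 < ∑ θ, l θ) :
    ∀ᵐ x ∂ρ, ∀ n, ∃ θ, jump (next^[n] x) = Pi.single θ 1 := by
  refine ae_all_iff.2 fun n => ?_
  exact ((hρ.measurePreserving_next hl).iterate n).quasiMeasurePreserving.ae
    (hρ.ae_exists_jump_eq_single hl)

end JumpPath

namespace Primitives

open JumpPath

variable {I J K Θ Ω : Type*} [Fintype I] [Fintype Θ] [MeasurableSpace Ω]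
  {P : Measure Ω} [IsProbabilityMeasure P] {C : Network I J K Θ} {X : Primitives I J Θ Ω}

/-- A measurable version of the paths of the arrival counts. -/
lemma exists_measurable_path (hX : X.Satisfies C P) (j : J) :
    ∃ φ : Ω → JumpPath Θ, Measurable φ ∧ ∀ᵐ ω ∂P, ∀ t θ, X.typeCount C j θ t ω = (φ ω).1 t θ := by
  classical
  -- Off a measurable set of full measure the path is replaced by the zero path.
  obtain ⟨G, hG, hGm, h⟩ := (ae_typeCount hX j).exists_measurable_mem
  have hp : ∀ ω, IsJumpPath fun t θ => if ω ∈ G then X.typeCount C j θ t ω else 0 := by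
    intro ω
    by_cases hω : ω ∈ G
    · simp only [hω, if_true]
      refine ⟨funext fun θ => (h ω hω θ).1, fun s t hst θ => (h ω hω θ).2.1 hst, fun t => ?_⟩
      filter_upwards [eventually_all.2 fun θ => (h ω hω θ).2.2 t] with s hs
      exact funext hs
    · simp only [hω, if_false]
      exact ⟨rfl, monotone_const, fun t => Eventually.of_forall fun s => rfl⟩
  refine ⟨fun ω => ⟨_, hp ω⟩, Measurable.subtype_mk ?_, ?_⟩
  · refine measurable_pi_lambda _ fun t => measurable_pi_lambda _ fun θ => ?_
    exact Measurable.ite hGm (measurable_typeCount hX j θ t) measurable_const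
  · filter_upwards [hG] with ω hω t θ
    simp [hω]

lemma isPoissonLaw_map_path (hX : X.Satisfies C P) (j : J) {φ : Ω → JumpPath Θ}
    (hφ : Measurable φ) (h : ∀ᵐ ω ∂P, ∀ t θ, X.typeCount C j θ t ω = (φ ω).1 t θ) :
    IsPoissonLaw (fun θ => (C.typeRate j θ).toNNReal) (P.map φ) := by
  intro t htm _ k c
  rw [Measure.map_apply hφ (measurableSet_incrementSet t k c)]
  have h1 := (iIndepFun_typeCount_sub_fin hX j htm k).measure_inter_preimage_eq_mul Finset.univ
    (sets := fun q => {c q.1 q.2}) fun _ _ => measurableSet_singleton _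
  have h2 : ∀ q : Fin k × Θ, P ((fun ω => X.typeCount C j q.2 (t (q.1 + 1)) ω
      - X.typeCount C j q.2 (t q.1) ω) ⁻¹' {c q.1 q.2})
      = poissonMeasure ((C.typeRate j q.2).toNNReal * (t (q.1 + 1) - t q.1)) {c q.1 q.2} := by
    intro q
    have hq := hasLaw_typeCount_sub_fin hX j htm k q
    rw [← hq.map_eq, Measure.map_apply_of_aemeasurable hq.aemeasurable (measurableSet_singleton _)]
  simp_rw [h2] at h1
  rw [Fintype.prod_prod_type] at h1
  rw [← h1]
  refine measure_congr (eventuallyEq_set.2 ?_)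
  filter_upwards [h] with ω hω
  simp only [Set.mem_preimage, incrementSet, Set.mem_ofPred_eq, Set.mem_iInter, Finset.mem_univ,
    true_imp_iff, Set.mem_singleton_iff, hω, Prod.forall]
  exact forall_congr' fun i => funext_iff

lemma indepFun_path_service (hX : X.Satisfies C P) (j : J) (θ : Θ) {φ : Ω → JumpPath Θ}
    (h : ∀ᵐ ω ∂P, ∀ t θ, X.typeCount C j θ t ω = (φ ω).1 t θ) :
    IndepFun φ (fun ω m => X.service j θ m ω) P := by
  have h1 : IndepFun (fun ω θ t => X.typeCount C j θ t ω) (fun ω m => X.service j θ m ω) P :=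
    (indepFun_typeCount_service hX j).comp measurable_id (measurable_pi_apply θ)
  have h2 : IndepFun (fun ω t θ => X.typeCount C j θ t ω) (fun ω m => X.service j θ m ω) P :=
    h1.comp (φ := fun x t θ => x θ t) (measurable_pi_lambda _ fun t => measurable_pi_lambda _
      fun θ => (measurable_pi_apply t).comp (measurable_pi_apply θ)) measurable_id
  have h3 : IndepFun (fun ω => (φ ω).1) (fun ω m => X.service j θ m ω) P :=
    h2.congr (h.mono fun ω hω => funext fun t => funext fun θ => hω t θ) (ae_eq_refl _)
  rw [IndepFun_iff_Indep] at h3 ⊢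
  convert h3 using 1
  exact MeasurableSpace.comap_comp

omit [Fintype I] [IsProbabilityMeasure P] in
lemma measurable_service_seq (hX : X.Satisfies C P) (j : J) (θ : Θ) :
    Measurable fun ω m => X.service j θ m ω :=
  measurable_pi_lambda _ fun m => hX.service_measurable j θ m

omit [Fintype I] in
/-- The first service time is independent of the later ones, which have the same law as all of
them. -/
lemma map_service_split (hX : X.Satisfies C P) (j : J) (θ : Θ) :
    (P.map fun ω m => X.service j θ m ω).map (fun s => (s 0, fun n => s (n + 1)))
      = (expMeasure (C.μ j θ)).prod (P.map fun ω m => X.service j θ m ω) := by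
  have hm : ∀ m, Measurable (X.service j θ m) := hX.service_measurable j θ
  have hseq : Measurable fun ω m => X.service j θ m ω := measurable_pi_lambda _ hm
  have hind : iIndepFun (fun m => X.service j θ m) P := (iIndepFun_iff_iIndep _ _ _).2
    (hX.indep.precomp (g := fun n : ℕ => (.inr (.inr (j, θ, n)) : I ⊕ (I × ℕ) ⊕ (J × Θ × ℕ)))
      fun a b h => by simpa using h)
  have hind' : iIndepFun (fun m => X.service j θ (m + 1)) P :=
    hind.precomp (g := fun m => m + 1) fun a b h => by simpa using h
  have htail : P.map (fun ω m => X.service j θ (m + 1) ω) = P.map fun ω m => X.service j θ m ω := by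
    rw [(iIndepFun_iff_map_fun_eq_infinitePi_map fun m => hm (m + 1)).1 hind',
      (iIndepFun_iff_map_fun_eq_infinitePi_map hm).1 hind]
    simp_rw [(hX.service_law j θ _).map_eq]
  have h0 : IndepFun (X.service j θ 0) (fun ω m => X.service j θ (m + 1) ω) P := by
    have h := indep_iSup_of_disjoint (fun m => (hm m).comap_le) hind.iIndep (S := {0})
      (T := Set.range fun m => m + 1) (by simp)
    refine indep_of_indep_of_le h (by simp) ?_
    rw [iSup_range]
    refine Measurable.comap_le (@measurable_pi_lambda _ _ _ (_) _ _ fun m => ?_)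
    exact (comap_measurable (X.service j θ (m + 1))).mono
      (le_iSup (fun m => MeasurableSpace.comap (X.service j θ (m + 1)) inferInstance) m) le_rfl
  have hsplit : Measurable fun s : ℕ → ℝ => (s 0, fun n => s (n + 1)) :=
    (measurable_pi_apply 0).prodMk (measurable_pi_lambda _ fun n => measurable_pi_apply (n + 1))
  rw [Measure.map_map hsplit hseq]
  have h1 := (indepFun_iff_map_prod_eq_prod_map_map (hm 0).aemeasurable
    (measurable_pi_lambda _ fun m => hm (m + 1)).aemeasurable).1 h0
  rw [(hX.service_law j θ 0).map_eq, htail] at h1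
  exact h1

omit [Fintype I] [IsProbabilityMeasure P] in
lemma ae_service_nonneg (hX : X.Satisfies C P) (j : J) :
    ∀ᵐ ω ∂P, ∀ θ m, 0 ≤ X.service j θ m ω := by
  refine ae_all_iff.2 fun θ => ae_all_iff.2 fun m => ?_
  have h := ae_pos_expMeasure (C.μ j θ)
  rw [← (hX.service_law j θ m).map_eq] at h
  exact (ae_of_ae_map (hX.service_measurable j θ m).aemeasurable h).mono fun ω hω => le_of_lt hω

lemma coe_sum_toNNReal_typeRate (C : Network I J K Θ) (j : J) :
    ((∑ θ, (C.typeRate j θ).toNNReal : ℝ≥0) : ℝ) = C.rate j := by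
  classical
  push_cast
  simp_rw [Real.coe_toNNReal _ (typeRate_nonneg C j _)]
  simp only [Network.typeRate, Network.rate]
  rw [Finset.sum_comm]
  refine Finset.sum_congr rfl fun i _ => ?_
  rw [← Finset.mul_sum, C.p_sum, mul_one]

lemma rate_pos (C : Network I J K Θ) {j : J} (hj : ∃ i, C.edge i = j) : 0 < C.rate j := by
  classical
  obtain ⟨i, hi⟩ := hj
  exact Finset.sum_pos (fun i _ => C.ξ_pos i) ⟨i, by simp [hi]⟩

/-- The law of the steady-state sojourn time. -/
def sojournLaw (C : Network I J K Θ) (j : J) : Measure ℝ :=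
  hyperexpMeasure (fun θ => C.typeRate j θ / C.rate j) (fun θ => C.μ j θ - C.typeRate j θ)

lemma isProbabilityMeasure_sojournLaw {j : J} (hstab : ∀ θ, C.typeRate j θ < C.μ j θ)
    (hj : ∃ i, C.edge i = j) : IsProbabilityMeasure (sojournLaw C j) := by
  have hpos := rate_pos C hj
  refine isProbabilityMeasure_hyperexpMeasure
    (fun θ => div_nonneg (typeRate_nonneg C j θ) hpos.le) ?_ fun θ => sub_pos.2 (hstab θ)
  rw [← Finset.sum_div, div_eq_one_iff_eq hpos.ne', ← coe_sum_toNNReal_typeRate]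
  push_cast
  simp_rw [Real.coe_toNNReal _ (typeRate_nonneg C j _)]

/-- The expectation is split by the type of request `n`, and each term involves a single queue, so
only the joint law of the path and that queue's service times is needed. -/
theorem tendsto_integral_sojourn (hX : X.Satisfies C P) {j : J}
    (hstab : ∀ θ, C.typeRate j θ < C.μ j θ) (hj : ∃ i, C.edge i = j) :
    (∀ n, AEMeasurable (X.sojourn C j n) P) ∧ ∀ (f : ℝ → ℝ) (K : ℝ≥0) (B : ℝ), LipschitzWith K f →
      (∀ x, |f x| ≤ B) → Tendsto (fun n => ∫ ω, f (X.sojourn C j n ω) ∂P) atTop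
        (𝓝 (∫ x, f x ∂sojournLaw C j)) := by
  classical
  have hpos := rate_pos C hj
  set l : Θ → ℝ≥0 := fun θ => (C.typeRate j θ).toNNReal with hl
  have hlθ : ∀ θ, (l θ : ℝ) = C.typeRate j θ := fun θ => Real.coe_toNNReal _ (typeRate_nonneg C j θ)
  have hsum : ((∑ θ, l θ : ℝ≥0) : ℝ) = C.rate j := coe_sum_toNNReal_typeRate C j
  have hl0 : 0 < ∑ θ, l θ := by
    rw [← NNReal.coe_pos, hsum]
    exact hpos
  obtain ⟨φ, hφ, hφX⟩ := exists_measurable_path hX j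
  have hρ : IsPoissonLaw l (P.map φ) := isPoissonLaw_map_path hX j hφ hφX
  have hσ : ∀ θ, IsProbabilityMeasure (P.map fun ω m => X.service j θ m ω) := fun θ =>
    Measure.isProbabilityMeasure_map (measurable_service_seq hX j θ).aemeasurable
  have hpair : ∀ θ, Measurable fun ω => (φ ω, fun m => X.service j θ m ω) := fun θ =>
    hφ.prodMk (measurable_service_seq hX j θ)
  have hπ : ∀ θ, P.map (fun ω => (φ ω, fun m => X.service j θ m ω))
      = (P.map φ).prod (P.map fun ω m => X.service j θ m ω) := fun θ =>
    (indepFun_iff_map_prod_eq_prod_map_map hφ.aemeasurable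
      (measurable_service_seq hX j θ).aemeasurable).1 (indepFun_path_service hX j θ hφX)
  have hjumps : ∀ᵐ ω ∂P, ∀ n, ∃ θ, jump (next^[n] (φ ω)) = Pi.single θ 1 :=
    ae_of_ae_map hφ.aemeasurable (hρ.ae_forall_exists_jump hl0)
  have hms : ∀ n θ, MeasurableSet {ω | jump (next^[n] (φ ω)) = Pi.single θ 1} := fun n θ =>
    (measurable_jump.comp ((measurable_next.iterate n).comp hφ)) (measurableSet_singleton _)
  have hmw : ∀ n θ, Measurable fun ω => workload θ (φ ω, fun m => X.service j θ m ω) n :=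
    fun n θ => (measurable_workload θ n).comp (hpair θ)
  have hsoj : ∀ᵐ ω ∂P, ∀ n, X.sojourn C j n ω
      = ∑ θ, if jump (next^[n] (φ ω)) = Pi.single θ 1 then
        workload θ (φ ω, fun m => X.service j θ m ω) (n + 1) else 0 := by
    filter_upwards [hφX, hjumps, ae_service_nonneg hX j] with ω h1 h2 h3 n
    choose A hA using h2
    exact sojourn_eq_sum_workload hA h1 h3 n
  refine ⟨fun n => ⟨_, Finset.measurable_fun_sum Finset.univ fun θ _ =>
    Measurable.ite (hms n θ) (hmw (n + 1) θ) measurable_const, hsoj.mono fun ω h => h n⟩, ?_⟩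
  intro f K B hf hB
  have hfsoj : ∀ n, ∫ ω, f (X.sojourn C j n ω) ∂P
      = ∑ θ, ∫ ω, (if jump (next^[n] (φ ω)) = Pi.single θ 1 then
        f (workload θ (φ ω, fun m => X.service j θ m ω) (n + 1)) else 0) ∂P := by
    intro n
    rw [← integral_finsetSum]
    · refine integral_congr_ae ?_
      filter_upwards [hsoj, hjumps] with ω h1 h2
      -- Exactly one type jumps, so `f` of the sum is the sum of the values of `f`, without stray
      -- terms `f 0`.
      obtain ⟨θ, hθ⟩ := h2 n
      have hne : ∀ θ', jump (next^[n] (φ ω)) = Pi.single θ' 1 ↔ θ = θ' := fun θ' =>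
        ⟨fun h => by
          by_contra hne
          simpa [hne] using congrFun (hθ.symm.trans h) θ, fun h => h ▸ hθ⟩
      simp [h1 n, hne]
    · intro θ _
      refine integrable_of_abs_le (B := B) (Measurable.ite (hms n θ)
        (hf.continuous.measurable.comp (hmw (n + 1) θ)) measurable_const) fun ω => ?_
      split_ifs
      · exact hB _
      · simpa using (abs_nonneg _).trans (hB 0)
  have hlim : ∀ θ, Tendsto (fun n => ∫ ω, (if jump (next^[n] (φ ω)) = Pi.single θ 1 then
        f (workload θ (φ ω, fun m => X.service j θ m ω) (n + 1)) else 0) ∂P) atTop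
      (𝓝 (C.typeRate j θ / C.rate j * ∫ x, f x ∂expMeasure (C.μ j θ - C.typeRate j θ))) := by
    intro θ
    have h := hρ.tendsto_integral_workload_jump hl0 θ (m := C.μ j θ) (by rw [hlθ]; exact hstab θ)
      (map_service_split hX j θ) hf hB
    rw [hlθ, hsum] at h
    refine h.congr fun n => ?_
    rw [← hπ θ, integral_map (hpair θ).aemeasurable]
    · simp only [fst_iterate_advance]
    · refine Measurable.aestronglyMeasurable (Measurable.ite ?_
        (hf.continuous.measurable.comp (measurable_workload θ (n + 1))) measurable_const)
      exact (measurable_jump.comp (measurable_fst.comp ((measurable_advance θ).iterate n)))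
        (measurableSet_singleton _)
  simp_rw [hfsoj]
  rw [sojournLaw, integral_hyperexpMeasure
    (fun θ => div_nonneg (typeRate_nonneg C j θ) hpos.le) fun θ => ?_]
  · exact tendsto_finsetSum _ fun θ _ => hlim θ
  · have := isProbabilityMeasure_expMeasure (sub_pos.2 (hstab θ))
    exact integrable_of_abs_le hf.continuous.measurable hB

/-- The sojourn times converge in distribution to the hyperexponential law. -/
theorem isSteadyStateSojourn_sojournLaw (hX : X.Satisfies C P) {j : J}
    (hstab : ∀ θ, C.typeRate j θ < C.μ j θ) (hj : ∃ i, C.edge i = j)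
    [IsProbabilityMeasure (sojournLaw C j)] :
    X.IsSteadyStateSojourn C P j id (sojournLaw C j) := by
  obtain ⟨hm, hlim⟩ := tendsto_integral_sojourn hX hstab hj
  refine ⟨hm, measurable_id.aemeasurable, ?_⟩
  -- Bounded Lipschitz functions suffice for weak convergence. Boundedness arrives as a bound on the
  -- distances between values, whence the uniform bound `|f 0| + B`.
  refine tendsto_iff_forall_lipschitz_integral_tendsto.2 ?_
  rintro f ⟨B, hB⟩ ⟨L, hL⟩
  have h := hlim f L (|f 0| + B) hL fun x => by
    have h1 := hB x 0
    rw [Real.dist_eq] at h1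
    have h2 := abs_add_le (f 0) (f x - f 0)
    rw [add_sub_cancel] at h2
    linarith
  simp only [ProbabilityMeasure.coe_mk, Measure.map_id]
  refine h.congr fun n => ?_
  rw [integral_map (hm n) hL.continuous.measurable.aestronglyMeasurable]

lemma integrable_id_sojournLaw {j : J} (hstab : ∀ θ, C.typeRate j θ < C.μ j θ) :
    Integrable (fun x => x) (sojournLaw C j) :=
  integrable_hyperexpMeasure fun θ => integrable_id_expMeasure (sub_pos.2 (hstab θ))

lemma integral_id_sojournLaw {j : J} (hstab : ∀ θ, C.typeRate j θ < C.μ j θ)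
    (hj : ∃ i, C.edge i = j) :
    ∫ x, x ∂sojournLaw C j
      = ∑ θ, C.typeRate j θ / (C.rate j * (C.μ j θ - C.typeRate j θ)) := by
  rw [sojournLaw, integral_hyperexpMeasure
    (fun θ => div_nonneg (typeRate_nonneg C j θ) (rate_pos C hj).le)
    fun θ => integrable_id_expMeasure (sub_pos.2 (hstab θ))]
  refine Finset.sum_congr rfl fun θ _ => ?_
  rw [integral_id_expMeasure (sub_pos.2 (hstab θ)), div_mul_div_comm, mul_one]

end Primitives

end CDN

end

theorem mainTheorem5 {I J K Θ : Type*} [Fintype I] [Fintype J] [Fintype K] [Fintype Θ]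
    {Ω : Type*} [MeasurableSpace Ω] (P : Measure Ω) [IsProbabilityMeasure P]
    (C : CDN.Network I J K Θ) (X : CDN.Primitives I J Θ Ω) (hX : X.Satisfies C P)
    (j : J) (hstab : ∀ θ, C.typeRate j θ < C.μ j θ) :
    ((∀ θ, (X.dsrQueue C j θ).IsMM1 (C.typeRate j θ) (C.μ j θ) P) ∧
      iIndepFun (fun θ => (X.dsrQueue C j θ).input) P) ∧
    ((∃ i, C.edge i = j) →
      (∃ ν : ProbabilityMeasure ℝ, X.IsSteadyStateSojourn C P j id (ν : Measure ℝ)) ∧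
      ∀ {Ω' : Type*} [MeasurableSpace Ω'] (P' : Measure Ω') [IsProbabilityMeasure P']
        (T : Ω' → ℝ), X.IsSteadyStateSojourn C P j T P' →
        HasLaw T (CDN.hyperexpMeasure (fun θ => C.typeRate j θ / C.rate j)
          (fun θ => C.μ j θ - C.typeRate j θ)) P' ∧
        Integrable T P' ∧
        ∫ ω, T ω ∂P' =
          ∑ θ, C.typeRate j θ / (C.rate j * (C.μ j θ - C.typeRate j θ))) := by
  refine ⟨⟨fun θ => CDN.Primitives.isMM1_dsrQueue hX j θ,
    CDN.Primitives.iIndepFun_input hX j⟩, fun hj => ?_⟩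
  have hprob := CDN.Primitives.isProbabilityMeasure_sojournLaw hstab hj
  have hlim := CDN.Primitives.isSteadyStateSojourn_sojournLaw hX hstab hj
  refine ⟨⟨⟨CDN.Primitives.sojournLaw C j, hprob⟩, hlim⟩, ?_⟩
  intro Ω' _ P' _ T hT
  have hlaw : HasLaw T (CDN.Primitives.sojournLaw C j) P' := by
    refine ⟨hT.aemeasurable_limit, ?_⟩
    -- Limits in distribution are unique in law, so any steady-state sojourn time has the law just
    -- found.
    rw [tendstoInDistribution_unique _ hT hlim, Measure.map_id]
  refine ⟨hlaw, ?_, ?_⟩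
  · have h := CDN.Primitives.integrable_id_sojournLaw hstab
    rw [← hlaw.map_eq, integrable_map_measure (by fun_prop) hlaw.aemeasurable] at h
    exact h
  · rw [hlaw.integral_eq, CDN.Primitives.integral_id_sojournLaw hstab hj]
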